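/- **Model.** A sender $S$ and a receiver $R$ with common discount factor $\delta\in[0,1)$ play an infinitely repeated game. In each period a state $\theta\in[0,1]$ is drawn independently from a prior $F$ with strictly positive density $f$ on $[0,1]$. A period runs as follows: $S$, then $R$, make ex-ante payments; $S$ privately observes $\theta$, sends a message and makes an interim payment; $R$ makes an interim payment and then chooses a decision $d\in\mathbb R$; $S$, then $R$, make ex-post payments. A payment consists of a non-negative transfer to the other player and a non-negative amount of burned money. Everything but the state is publicly observed; the state is observed by $S$ only. Period payoffs, net of payments, are quadratic: $$u_R(d,\theta)=c\big((a\theta+b)d-d^2/2\big),\qquad u(d,\theta)=u_S(d,\theta)+u_R(d,\theta)=\theta d-d^2/2,$$ with $b\in\mathbb R$, $c\in(0,1]$, $a\in(0,1/c)$. Thus the receiver's preferred decision is $\rho_R(\theta)=a\theta+b$ and the first-best decision is $\rho_{FB}(\theta)=\theta$. Equilibria are perfect Bayesian equilibria in pure public strategies (measurable, with uniformly bounded payments and decisions). Let $\overline v$ be the supremum of the equilibrium joint payoffs, $\underline v_S,\underline v_R$ the infima of the equilibrium payoffs of the two players, and $L=\frac{\delta}{1-\delta}(\overline v-\underline v_S-\underline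 v_R)\in[0,\infty]$. For a message $m$, given by a set of states, put $u_i(d,m)=\mathbb E_F[u_i(d,\theta)\mid m]$ and $u(d,m)=\mathbb E_F[u(d,\theta)\mid m]$. A decision $d$ is enforceable at $m$ if $\max_{d'}u_R(d',m)-u_R(d,m)\le L$, and $u_*(m)$ is the maximum of $u(d,m)$ over the enforceable decisions. The set of extreme states is $X=\{\theta\in[0,1]:\rho_{FB}(\theta)\text{ is not enforceable at }\{\theta\}\}$. A relatively open set $P\subset[0,1]$ stands for the message rule that pools each maximal interval of $P$ into one message and reveals every state outside $P$. The optimal pooling set $P_*$ maximizes the expectation of $u_*$ of the message over all such $P$; it is understood to be unique up to the endpoints $0$ and $1$. **Proposition.** Suppose that the receiver is highly responsive, $\rho_R'>2\rho_{FB}'$ (that is, $a>2$), and downwardly biased, $\rho_R(\theta)<\rho_{FB}(\theta)$ for all $\theta\in[0,1]$. Then there are $0<\delta^B<\delta^A<1$ such that $$X=\begin{cases}\emptyset,&\delta\in(\delta^A,1),\\ [0,\theta^L)\text{ for some }\theta^L\in(0,1),&\delta\in(\delta^B,\delta^A),\\ [0,1],&\delta\in[0,\delta^B),\end{cases}$$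 and there is $\delta_*^B\in(\delta^B,\delta^A)$ such that $$P_*=\begin{cases}\emptyset,&\delta\in(\delta^A,1),\\ [0,\theta_*^L)\text{ for some }\theta_*^L\in(\theta^L,1),&\delta\in(\delta_*^B,\delta^A),\\ [0,1],&\delta\in[0,\delta_*^B).\end{cases}$$ Moreover $\theta_*^L$ is strictly decreasing in $\delta$ on $(\delta_*^B,\delta^A)$. If $f$ is continuous on $[0,1]$, then at each $\delta\in(\delta_*^B,\delta^A)$ the difference quotients of $\theta_*^L$ near $\delta$ are bounded above by a negative constant, so $d\theta_*^L/d\delta<0$ wherever this derivative exists. -/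

import Mathlib

open MeasureTheory ProbabilityTheory Filter Topology
open scoped NNReal ENNReal

namespace RelComm

/-! ### Primitives -/

/-- Quadratic payoffs `u_R(d,θ) = c((aθ+b)d - d²/2)` and `u(d,θ) = θd - d²/2` with `b ∈ ℝ`,
`c ∈ (0,1]`, `a ∈ (0,1/c)`, and a prior on the states `[0,1]` with a strictly positive density
`f` (only the values of `f` on `[0,1]` matter). -/
structure Model where
  a : ℝ
  b : ℝ
  c : ℝ
  f : ℝ → ℝ
  c_pos : 0 < c
  c_le_one : c ≤ 1
  a_pos : 0 < a
  a_lt : a < 1 / c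
  f_measurable : Measurable f
  f_pos : ∀ θ ∈ Set.Icc (0 : ℝ) 1, 0 < f θ
  f_integral : ∫ θ in Set.Icc (0 : ℝ) 1, f θ = 1

/-- The two players. -/
inductive Player
  | sender
  | receiver

namespace Model

variable (M : Model)

/-- The prior distribution of the state. -/
noncomputable def prior : Measure ℝ :=
  (volume.restrict (Set.Icc (0 : ℝ) 1)).withDensity (fun θ => ENNReal.ofReal (M.f θ))

/-- The receiver's payoff. -/
noncomputable def uR (d θ : ℝ) : ℝ := M.c * ((M.a * θ + M.b) * d - d ^ 2 / 2)

/-- The joint payoff. -/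
noncomputable def uJoint (d θ : ℝ) : ℝ := θ * d - d ^ 2 / 2

/-- The sender's payoff. -/
noncomputable def uS (d θ : ℝ) : ℝ := uJoint d θ - M.uR d θ

/-- The receiver's preferred decision at a known state. -/
noncomputable def rhoR (θ : ℝ) : ℝ := M.a * θ + M.b

/-- The first-best decision at a known state. -/
noncomputable def rhoFB (θ : ℝ) : ℝ := θ

theorem rhoR_isMax (θ d : ℝ) : M.uR d θ ≤ M.uR (M.rhoR θ) θ := by
  unfold uR rhoR
  have h := M.c_pos
  have := mul_nonneg h.le (sq_nonneg (d - (M.a * θ + M.b)))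
  nlinarith [this]

theorem rhoFB_isMax (θ d : ℝ) : uJoint d θ ≤ uJoint (rhoFB θ) θ := by
  unfold uJoint rhoFB
  nlinarith [sq_nonneg (d - θ)]

/-- The receiver's preferred decision rule is more than twice as steep as the first-best one. -/
def HighlyResponsive : Prop :=
  ∀ θ ∈ Set.Icc (0 : ℝ) 1, 2 * deriv rhoFB θ < deriv M.rhoR θ

/-- The receiver always prefers a lower decision than the first-best one. -/
def DownwardlyBiased : Prop :=
  ∀ θ ∈ Set.Icc (0 : ℝ) 1, M.rhoR θ < rhoFB θ

end Model

/-! ### The repeated communication game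

Each period runs as follows: the sender and then the receiver make ex-ante payments; the state is
drawn and privately observed by the sender, who sends a message and makes an interim payment;
the receiver makes an interim payment; the receiver chooses a decision; the sender and then the
receiver make ex-post payments. Everything except the state is publicly observed. -/

/-- A payment: the gross transfer to the other player, and the amount of money burned. -/
abbrev Pay := ℝ≥0 × ℝ≥0

/-- A report of the sender: a message (a label in `ℝ`, identified in the analysis with the set of
states that send it) together with the sender's interim payment. -/
abbrev Report := ℝ × Pay

/-- The public outcome of a period: ex-ante payments of sender and receiver; the sender's report;
the receiver's interim payment and decision; ex-post payments of sender and receiver. -/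
abbrev Outcome := (Pay × Pay) × Report × (Pay × ℝ) × (Pay × Pay)

/-- Public histories at the beginning of period `n` (periods are numbered from `0`). -/
abbrev Hist (n : ℕ) := Fin n → Outcome

/-- Public information at the receiver's first interim move: the history, the ex-ante payments of
both players, and the sender's report. -/
abbrev Info (n : ℕ) := Hist n × (Pay × Pay) × Report

/-- The history extended by one period. -/
def extend {n : ℕ} (h : Hist n) (o : Outcome) : Hist (n + 1) :=
  Fin.snoc (α := fun _ => Outcome) h o

/-- Payments bounded by `B`. -/
def PayLE (p : Pay) (B : ℝ≥0) : Prop := p.1 ≤ B ∧ p.2 ≤ B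

/-- A pure strategy of the sender: measurable, with uniformly bounded payments. -/
structure SenderStrategy where
  exAnte : (n : ℕ) → Hist n → Pay
  report : (n : ℕ) → Hist n × (Pay × Pay) × ℝ → Report
  exPost : (n : ℕ) → Info n × (Pay × ℝ) → Pay
  measurable_exAnte : ∀ n, Measurable (exAnte n)
  measurable_report : ∀ n, Measurable (report n)
  measurable_exPost : ∀ n, Measurable (exPost n)
  bounded : ∃ B : ℝ≥0, ∀ n, (∀ x, PayLE (exAnte n x) B) ∧
    (∀ x, PayLE (report n x).2 B) ∧ (∀ x, PayLE (exPost n x) B)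

/-- A pure strategy of the receiver: measurable, with uniformly bounded payments and decisions. -/
structure ReceiverStrategy where
  exAnte : (n : ℕ) → Hist n × Pay → Pay
  interim : (n : ℕ) → Info n → Pay
  decision : (n : ℕ) → Info n × Pay → ℝ
  exPost : (n : ℕ) → (Info n × (Pay × ℝ)) × Pay → Pay
  measurable_exAnte : ∀ n, Measurable (exAnte n)
  measurable_interim : ∀ n, Measurable (interim n)
  measurable_decision : ∀ n, Measurable (decision n)
  measurable_exPost : ∀ n, Measurable (exPost n)
  bounded : ∃ B : ℝ≥0, ∀ n, (∀ x, PayLE (exAnte n x) B) ∧ (∀ x, PayLE (interim n x) B) ∧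
    (∀ x, |decision n x| ≤ B) ∧ (∀ x, PayLE (exPost n x) B)

/-- A strategy profile. -/
structure Profile where
  S : SenderStrategy
  R : ReceiverStrategy

namespace Profile

variable (σ : Profile) {n : ℕ}

/-- The outcome of the current period when the ex-post round is reached and the sender has already
made the ex-post payment `z`. -/
def playExPostR (i : Info n) (y : Pay × ℝ) (z : Pay) : Outcome :=
  (i.2.1, i.2.2, y, (z, σ.R.exPost n ((i, y), z)))

/-- The outcome of the current period from the sender's ex-post move on. -/
def playExPostS (i : Info n) (y : Pay × ℝ) : Outcome :=
  σ.playExPostR i y (σ.S.exPost n (i, y))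

/-- The outcome of the current period from the receiver's decision on. -/
def playDecision (i : Info n) (p : Pay) : Outcome :=
  σ.playExPostS i (p, σ.R.decision n (i, p))

/-- The outcome of the current period from the receiver's interim payment on. -/
def playInterimR (i : Info n) : Outcome :=
  σ.playDecision i (σ.R.interim n i)

/-- The outcome of the current period from the sender's report on, if the state is `θ`. -/
def playReport (h : Hist n) (x : Pay × Pay) (θ : ℝ) : Outcome :=
  σ.playInterimR (h, x, σ.S.report n (h, x, θ))

/-- The outcome of the current period from the receiver's ex-ante payment on. -/
def playExAnteR (h : Hist n) (x : Pay) (θ : ℝ) : Outcome :=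
  σ.playReport h (x, σ.R.exAnte n (h, x)) θ

/-- The outcome of the current period, if the state is `θ`. -/
def play (h : Hist n) (θ : ℝ) : Outcome :=
  σ.playExAnteR h (σ.S.exAnte n h) θ

end Profile

/-- The net transfer of a player whose own payment is `own`, if the other player pays `other`. -/
noncomputable def netTransfer (own other : Pay) : ℝ := (own.1 : ℝ) - other.1 + own.2

namespace Model

variable (M : Model)

/-- Payoff in one period, given the state and the outcome of the period. -/
noncomputable def stagePayoff : Player → ℝ → Outcome → ℝ
  | .sender, θ, (x, r, y, z) =>
      M.uS y.2 θ - netTransfer x.1 x.2 - netTransfer r.2 y.1 - netTransfer z.1 z.2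
  | .receiver, θ, (x, r, y, z) =>
      M.uR y.2 θ - netTransfer x.2 x.1 - netTransfer y.1 r.2 - netTransfer z.2 z.1

/-- Expected payoff in the period that comes `t` periods after the one starting at history `h`,
when states are drawn independently from the prior and the profile `σ` is played from `h` on. -/
noncomputable def expStage (σ : Profile) (i : Player) : ℕ → (n : ℕ) → Hist n → ℝ
  | 0, _, h => ∫ θ, M.stagePayoff i θ (σ.play h θ) ∂M.prior
  | t + 1, n, h => ∫ θ, expStage σ i t (n + 1) (extend h (σ.play h θ)) ∂M.prior

/-- Normalized expected discounted payoff from history `h` on. -/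
noncomputable def value (δ : ℝ) (σ : Profile) (i : Player) {n : ℕ} (h : Hist n) : ℝ :=
  (1 - δ) * ∑' t : ℕ, δ ^ t * M.expStage σ i t n h

/-- Normalized discounted payoff from history `h` on, if the state of the current period is `θ`,
the outcome of the current period is `o`, and `σ` is played from the next period on. -/
noncomputable def total (δ : ℝ) (σ : Profile) (i : Player) {n : ℕ} (h : Hist n) (θ : ℝ)
    (o : Outcome) : ℝ :=
  (1 - δ) * M.stagePayoff i θ o + δ * M.value δ σ i (extend h o)

/-- Beliefs of the receiver about the current state, at every history after every report. -/
structure Beliefs where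
  belief : (n : ℕ) → Kernel (Info n) ℝ
  isMarkov : ∀ n, IsMarkovKernel (belief n)
  support : ∀ n i, belief n i (Set.Icc (0 : ℝ) 1) = 1

/-- Bayesian consistency: at every public history, the beliefs after the reports prescribed by the
sender's strategy form the conditional distribution of the state given the report, and they are
concentrated on the states in which this report is made. -/
def Consistent (s : SenderStrategy) (β : Beliefs) : Prop :=
  ∀ (n : ℕ) (h : Hist n) (x : Pay × Pay),
    (∀ A : Set ℝ, MeasurableSet A → ∀ B : Set Report, MeasurableSet B →
      M.prior (A ∩ {θ | s.report n (h, x, θ) ∈ B}) =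
        ∫⁻ θ in {θ | s.report n (h, x, θ) ∈ B},
          β.belief n (h, x, s.report n (h, x, θ)) A ∂M.prior) ∧
    (∀ θ ∈ Set.Icc (0 : ℝ) 1, β.belief n (h, x, s.report n (h, x, θ))
      {θ' | θ' ∈ Set.Icc (0 : ℝ) 1 ∧ s.report n (h, x, θ') = s.report n (h, x, θ)} = 1)

/-- At each of the sender's information sets, no strategy does better than the prescribed one. -/
def SenderRational (δ : ℝ) (σ : Profile) : Prop :=
  ∀ (s : SenderStrategy) (n : ℕ) (h : Hist n),
    -- ex-ante payment
    (∫ θ, M.total δ ⟨s, σ.R⟩ .sender h θ (Profile.play ⟨s, σ.R⟩ h θ) ∂M.prior ≤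
      ∫ θ, M.total δ σ .sender h θ (σ.play h θ) ∂M.prior) ∧
    -- report, knowing the state
    (∀ (x : Pay × Pay), ∀ θ ∈ Set.Icc (0 : ℝ) 1,
      M.total δ ⟨s, σ.R⟩ .sender h θ (Profile.playReport ⟨s, σ.R⟩ h x θ) ≤
        M.total δ σ .sender h θ (σ.playReport h x θ)) ∧
    -- ex-post payment
    (∀ (x : Pay × Pay) (r : Report) (y : Pay × ℝ), ∀ θ ∈ Set.Icc (0 : ℝ) 1,
      M.total δ ⟨s, σ.R⟩ .sender h θ (Profile.playExPostS ⟨s, σ.R⟩ (h, x, r) y) ≤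
        M.total δ σ .sender h θ (σ.playExPostS (h, x, r) y))

/-- At each of the receiver's information sets, no strategy does better than the prescribed one,
given her belief there. -/
def ReceiverRational (δ : ℝ) (σ : Profile) (β : Beliefs) : Prop :=
  ∀ (s : ReceiverStrategy) (n : ℕ) (h : Hist n),
    -- ex-ante payment
    (∀ x : Pay,
      ∫ θ, M.total δ ⟨σ.S, s⟩ .receiver h θ (Profile.playExAnteR ⟨σ.S, s⟩ h x θ) ∂M.prior ≤
        ∫ θ, M.total δ σ .receiver h θ (σ.playExAnteR h x θ) ∂M.prior) ∧
    ∀ (x : Pay × Pay) (r : Report),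
      -- interim payment
      (∫ θ, M.total δ ⟨σ.S, s⟩ .receiver h θ (Profile.playInterimR ⟨σ.S, s⟩ (h, x, r))
          ∂(β.belief n (h, x, r)) ≤
        ∫ θ, M.total δ σ .receiver h θ (σ.playInterimR (h, x, r)) ∂(β.belief n (h, x, r))) ∧
      -- decision
      (∀ p : Pay,
        ∫ θ, M.total δ ⟨σ.S, s⟩ .receiver h θ (Profile.playDecision ⟨σ.S, s⟩ (h, x, r) p)
            ∂(β.belief n (h, x, r)) ≤
          ∫ θ, M.total δ σ .receiver h θ (σ.playDecision (h, x, r) p)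
            ∂(β.belief n (h, x, r))) ∧
      -- ex-post payment
      (∀ (y : Pay × ℝ) (z : Pay),
        ∫ θ, M.total δ ⟨σ.S, s⟩ .receiver h θ (Profile.playExPostR ⟨σ.S, s⟩ (h, x, r) y z)
            ∂(β.belief n (h, x, r)) ≤
          ∫ θ, M.total δ σ .receiver h θ (σ.playExPostR (h, x, r) y z)
            ∂(β.belief n (h, x, r)))

/-- Pure-strategy perfect Bayesian equilibrium. -/
def IsEquilibrium (δ : ℝ) (σ : Profile) : Prop :=
  ∃ β : Beliefs, M.Consistent σ.S β ∧ M.SenderRational δ σ ∧ M.ReceiverRational δ σ β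

/-- The set of equilibrium payoffs `(v_S, v_R)`. -/
def eqPayoffs (δ : ℝ) : Set (ℝ × ℝ) :=
  {v | ∃ σ : Profile, M.IsEquilibrium δ σ ∧
    v = (M.value δ σ .sender (n := 0) Fin.elim0, M.value δ σ .receiver (n := 0) Fin.elim0)}

/-- The best equilibrium joint payoff. Extended reals are used because the set of equilibrium
payoffs can be unbounded below. -/
noncomputable def vBar (δ : ℝ) : EReal := ⨆ v ∈ M.eqPayoffs δ, ((v.1 + v.2 : ℝ) : EReal)

/-- The worst equilibrium payoff of the sender. -/
noncomputable def vLowS (δ : ℝ) : EReal := ⨅ v ∈ M.eqPayoffs δ, ((v.1 : ℝ) : EReal)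

/-- The worst equilibrium payoff of the receiver. -/
noncomputable def vLowR (δ : ℝ) : EReal := ⨅ v ∈ M.eqPayoffs δ, ((v.2 : ℝ) : EReal)

/-- The discounted surplus at the best equilibrium joint payoff. -/
noncomputable def surplus (δ : ℝ) : EReal :=
  ((δ / (1 - δ) : ℝ) : EReal) * (M.vBar δ - M.vLowS δ - M.vLowR δ)

/-! ### Second-best decisions and optimal pooling

A message enters payoffs through the conditional distribution `ν` of the state given the message. -/

/-- The receiver's temptation to deviate from `d`: her best payoff minus her payoff from `d`. -/
noncomputable def temptation (d : ℝ) (ν : Measure ℝ) : ℝ :=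
  (⨆ d' : ℝ, ∫ θ, M.uR d' θ ∂ν) - ∫ θ, M.uR d θ ∂ν

/-- A decision is enforceable if the temptation does not exceed the discounted surplus. -/
def Enforceable (δ d : ℝ) (ν : Measure ℝ) : Prop :=
  ((M.temptation d ν : ℝ) : EReal) ≤ M.surplus δ

/-- The joint payoff under the second-best (best enforceable) decision. -/
noncomputable def uStar (δ : ℝ) (ν : Measure ℝ) : ℝ :=
  sSup {w : ℝ | ∃ d : ℝ, M.Enforceable δ d ν ∧ w = ∫ θ, uJoint d θ ∂ν}

/-- Extreme states: the first-best decision is not enforceable. -/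
def extremeStates (δ : ℝ) : Set ℝ :=
  {θ | θ ∈ Set.Icc (0 : ℝ) 1 ∧ ¬ M.Enforceable δ (rhoFB θ) (Measure.dirac θ)}

/-- Pooling sets: the relatively open subsets of `[0,1]`. -/
def IsPoolingSet (P : Set ℝ) : Prop := ∃ U : Set ℝ, IsOpen U ∧ P = U ∩ Set.Icc (0 : ℝ) 1

open Classical in
/-- The conditional distribution of the state given the message sent in state `θ` under the monotone
message rule with pooling set `P`: states outside `P` are revealed, and a state in `P` is pooled
with the maximal interval of `P` that contains it. -/
noncomputable def posterior (P : Set ℝ) (θ : ℝ) : Measure ℝ :=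
  if θ ∈ P then ProbabilityTheory.cond M.prior (connectedComponentIn P θ) else Measure.dirac θ

/-- Expected joint payoff under the message rule with pooling set `P` and second-best decisions. -/
noncomputable def poolingPayoff (δ : ℝ) (P : Set ℝ) : ℝ :=
  ∫ θ, M.uStar δ (M.posterior P θ) ∂M.prior

/-- `P` solves the monotone persuasion problem. -/
def IsOptimalPooling (δ : ℝ) (P : Set ℝ) : Prop :=
  IsPoolingSet P ∧ ∀ Q : Set ℝ, IsPoolingSet Q → M.poolingPayoff δ Q ≤ M.poolingPayoff δ P

/-- `Q` is the optimal pooling set: it is optimal, and it is the only one up to the two states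
`0` and `1` (the null sets `{0}` and `{1}` can be pooled or separated at no cost). -/
def OptimalPoolingSetIs (δ : ℝ) (Q : Set ℝ) : Prop :=
  M.IsOptimalPooling δ Q ∧
    ∀ P : Set ℝ, M.IsOptimalPooling δ P → P ∩ Set.Ioo (0 : ℝ) 1 = Q ∩ Set.Ioo (0 : ℝ) 1

end Model

end RelComm

namespace RelComm

/-! ### The prior and measures on the unit interval -/

/-! Payoffs are affine in the state, so a belief matters only through its mean $y$. The temptation
at $d$ is $c(d-\rho_R(y))^2/2$, so a surplus $L=cs^2/2$ allows exactly the decisions within the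
radius $s$ of $\rho_R(y)$. The hypotheses enter as `2 < M.a` and `M.a + M.b < 1`. They make the gap
$y-\rho_R(y)=(1-a)y-b$ positive and decreasing on $[0,1]$, so the best enforceable decision is
$\min(y,\rho_R(y)+s)$, with joint payoff `M.w s y`.

The surplus. If decisions stay within $s$ of $\rho_R$, the joint payoff is at most `Vsup s`, the
receiver secures the uninformed payoff `r0`, and the sender secures `punish Jinf s`: in state $0$ it
can stay silent and pay nothing, and its rent then grows in the state at rate $(1-ca)d$ with
$d\ge\rho_R(y)-s$. In an equilibrium, the extreme payoffs over all histories sustain a radius that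
obeys these bounds itself, hence $cs^2/2\le\frac{\delta}{1-\delta}G(s)$
(`exists_radius_of_isEquilibrium`). Conversely, two-state equilibria attain the bounds up to any
slack (`exists_scheme`, `le_surplus`). Since $G(ls)>l^2G(s)$ for $0<l<1$ (`G_scale`), the ratio
`kappa` $=cs^2/(2G(s))$ is strictly increasing. Equality therefore has at most one solution $s$, and
then $L=cs^2/2$ (`surplus_eq`). When the odds exceed `kappa (-b)`, it is enough that $L\ge cb^2/2$,
because every gap is at most $-b$.

Pooling. The extreme states are those below $l=(-b-s)/(a-1)$. As a function of the posterior mean,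
$w$ is $z^2/2$ above $l$ and has second derivative $1-(a-1)^2<0$ below $l$: it is concave, then
convex. The candidate pools $[0,x)$ with mean $y$, where the tangent of $w$ at $y$ meets $z^2/2$ at
$x$; this amounts to `cutoff x = l`. The tangent up to $x$, continued by $z^2/2$, is a convex
majorant of $w$. It serves as a dual certificate that bounds every pooling set and, through the
cases of equality, gives uniqueness (`Certificate.optimalPoolingSetIs`). If `cutoff 1 ≤ l`,
everything is pooled.

Comparative statics. The radius increases with $\delta$, so $l$ and the pooling threshold decrease.
The three critical discount factors are those at which $l$ equals $1$, `cutoff 1` and $0$. Because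
`kappa` grows no faster than $s^2$, the radius moves at a rate bounded away from zero; for
continuous $f$ the function `cutoff` is differentiable, so the threshold has to move at such a rate
too. -/

theorem ae_mem_of_measure_eq_one {ν : Measure ℝ} [IsProbabilityMeasure ν]
    (hν : ν (Set.Icc (0 : ℝ) 1) = 1) : ∀ᵐ θ ∂ν, θ ∈ Set.Icc (0 : ℝ) 1 :=
  (prob_compl_eq_zero_iff measurableSet_Icc).2 hν

theorem integrable_of_bound {ν : Measure ℝ} [IsFiniteMeasure ν]
    (hν : ∀ᵐ θ ∂ν, θ ∈ Set.Icc (0 : ℝ) 1) {g : ℝ → ℝ} (hg : Measurable g) (C : ℝ)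
    (hC : ∀ θ ∈ Set.Icc (0 : ℝ) 1, |g θ| ≤ C) : Integrable g ν :=
  Integrable.of_bound hg.aestronglyMeasurable C (hν.mono fun θ h => hC θ h)

theorem integrable_id_of_mem {ν : Measure ℝ} [IsFiniteMeasure ν]
    (hν : ∀ᵐ θ ∂ν, θ ∈ Set.Icc (0 : ℝ) 1) : Integrable (fun θ : ℝ => θ) ν :=
  integrable_of_bound hν measurable_id 1 fun θ h => by
    rw [abs_le]; exact ⟨by linarith [h.1], h.2⟩

/-- The mean of a distribution of states. -/
noncomputable def mean (ν : Measure ℝ) : ℝ := ∫ θ, θ ∂ν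

theorem mean_mem {ν : Measure ℝ} [IsProbabilityMeasure ν]
    (hν : ν (Set.Icc (0 : ℝ) 1) = 1) : mean ν ∈ Set.Icc (0 : ℝ) 1 := by
  have h := ae_mem_of_measure_eq_one hν
  constructor
  · exact integral_nonneg_of_ae (h.mono fun θ h => h.1)
  · have := integral_mono_ae (integrable_id_of_mem h) (integrable_const (1 : ℝ))
      (h.mono fun θ h => h.2)
    simpa [mean] using this

theorem integral_affine {ν : Measure ℝ} [IsProbabilityMeasure ν]
    (hν : ν (Set.Icc (0 : ℝ) 1) = 1) (p q : ℝ) : ∫ θ, (p * θ + q) ∂ν = p * mean ν + q := by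
  have h := integrable_id_of_mem (ae_mem_of_measure_eq_one hν)
  rw [integral_add (h.const_mul p) (integrable_const q), integral_const_mul]
  simp [mean]

theorem mean_dirac (x : ℝ) : mean (Measure.dirac x) = x := by simp [mean]

namespace Model

variable (M : Model)

theorem integral_uR {ν : Measure ℝ} [IsProbabilityMeasure ν]
    (hν : ν (Set.Icc (0 : ℝ) 1) = 1) (d : ℝ) : ∫ θ, M.uR d θ ∂ν = M.uR d (mean ν) := by
  have := integral_affine hν (M.c * M.a * d) (M.c * (M.b * d - d ^ 2 / 2))
  calc _ = ∫ θ, (M.c * M.a * d * θ + M.c * (M.b * d - d ^ 2 / 2)) ∂ν := by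
        congr 1; ext θ; unfold uR; ring
    _ = _ := by rw [this]; unfold uR; ring

theorem integral_uJoint {ν : Measure ℝ} [IsProbabilityMeasure ν]
    (hν : ν (Set.Icc (0 : ℝ) 1) = 1) (d : ℝ) : ∫ θ, uJoint d θ ∂ν = uJoint d (mean ν) := by
  have := integral_affine hν d (-(d ^ 2 / 2))
  calc _ = ∫ θ, (d * θ + -(d ^ 2 / 2)) ∂ν := by
        congr 1; ext θ; unfold uJoint; ring
    _ = _ := by rw [this]; unfold uJoint; ring

theorem uR_rhoR_sub (d y : ℝ) :
    M.uR (M.rhoR y) y - M.uR d y = M.c / 2 * (d - M.rhoR y) ^ 2 := by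
  unfold uR rhoR; ring

theorem temptation_eq {ν : Measure ℝ} [IsProbabilityMeasure ν]
    (hν : ν (Set.Icc (0 : ℝ) 1) = 1) (d : ℝ) :
    M.temptation d ν = M.c / 2 * (d - M.rhoR (mean ν)) ^ 2 := by
  unfold temptation
  simp_rw [M.integral_uR hν]
  rw [← M.uR_rhoR_sub d (mean ν)]
  congr 1
  refine le_antisymm (ciSup_le fun d' => M.rhoR_isMax _ _) ?_
  exact le_ciSup (f := fun d' => M.uR d' (mean ν))
    ⟨M.uR (M.rhoR (mean ν)) (mean ν), by rintro _ ⟨d', rfl⟩; exact M.rhoR_isMax _ _⟩ _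

theorem f_integrableOn : IntegrableOn M.f (Set.Icc (0 : ℝ) 1) := by
  by_contra h
  have := M.f_integral
  rw [integral_undef h] at this
  exact zero_ne_one this

instance prior_isProbabilityMeasure : IsProbabilityMeasure M.prior := by
  constructor
  unfold prior
  rw [withDensity_apply _ MeasurableSet.univ, Measure.restrict_univ,
    ← ofReal_integral_eq_lintegral_ofReal M.f_integrableOn, M.f_integral, ENNReal.ofReal_one]
  filter_upwards [ae_restrict_mem measurableSet_Icc] with θ hθ using (M.f_pos θ hθ).le

theorem prior_absolutelyContinuous :
    M.prior ≪ volume.restrict (Set.Icc (0 : ℝ) 1) := withDensity_absolutelyContinuous _ _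

theorem prior_ae_mem : ∀ᵐ θ ∂M.prior, θ ∈ Set.Icc (0 : ℝ) 1 :=
  M.prior_absolutelyContinuous.ae_le (ae_restrict_mem measurableSet_Icc)

theorem prior_Icc : M.prior (Set.Icc (0 : ℝ) 1) = 1 :=
  (prob_compl_eq_zero_iff measurableSet_Icc).1 M.prior_ae_mem

/-- The density is strictly positive. This moves prior-almost-sure bounds into the Lebesgue
integrals of the information rent, and gives relatively open sets positive probability. -/
theorem volume_absolutelyContinuous :
    volume.restrict (Set.Icc (0 : ℝ) 1) ≪ M.prior := by
  refine withDensity_absolutelyContinuous' M.f_measurable.ennreal_ofReal.aemeasurable ?_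
  filter_upwards [ae_restrict_mem measurableSet_Icc] with θ hθ
  simpa using M.f_pos θ hθ

instance prior_nullSingletonClass : NullSingletonClass M.prior := by
  refine ⟨fun x => M.prior_absolutelyContinuous ?_⟩
  exact measure_mono_null (le_refl _) (by simp)

theorem integrable_prior {g : ℝ → ℝ} (hg : Measurable g) (C : ℝ)
    (hC : ∀ θ ∈ Set.Icc (0 : ℝ) 1, |g θ| ≤ C) : Integrable g M.prior :=
  integrable_of_bound M.prior_ae_mem hg C hC

/-- The prior mean of the state. -/
noncomputable def mu : ℝ := mean M.prior

theorem mu_le_one : M.mu ≤ 1 := (mean_mem M.prior_Icc).2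

theorem mu_pos : 0 < M.mu := by
  have h : 0 ≤ᵐ[M.prior] fun θ : ℝ => θ := M.prior_ae_mem.mono fun θ h => h.1
  refine (integral_pos_iff_support_of_nonneg_ae h (integrable_id_of_mem M.prior_ae_mem)).2 ?_
  rw [pos_iff_ne_zero]
  intro h0
  have h1 : M.prior (Function.support (fun θ : ℝ => θ))ᶜ = 0 := by
    refine measure_mono_null (t := {0}) ?_ (measure_singleton 0)
    intro x hx; simpa using hx
  have := measure_union_null h0 h1
  rw [Set.union_compl_self, measure_univ] at this
  exact one_ne_zero this

/-- The receiver's payoff from an uninformed best decision. -/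
noncomputable def r0 : ℝ := M.uR (M.rhoR M.mu) M.mu

theorem two_lt_a (h : M.HighlyResponsive) : 2 < M.a := by
  have := h 0 (by simp)
  have e1 : deriv rhoFB 0 = 1 := by
    have : rhoFB = fun θ => θ := rfl
    rw [this]; simp
  have e2 : deriv M.rhoR 0 = M.a := by
    have : HasDerivAt M.rhoR (M.a * 1) 0 :=
      ((hasDerivAt_id (0 : ℝ)).const_mul M.a).add_const M.b
    simpa using this.deriv
  rw [e1, e2] at this; linarith

theorem a_add_b_lt (h : M.DownwardlyBiased) : M.a + M.b < 1 := by
  have := h 1 (by simp)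
  simpa [rhoR, rhoFB] using this

theorem ca_lt : M.c * M.a < 1 := by
  have := M.a_lt
  rw [lt_div_iff₀ M.c_pos] at this; linarith

end Model
end RelComm

namespace RelComm

/-! ### Disintegration of the prior along a message rule -/

/-- Bayesian consistency speaks only of rectangles, and rectangles determine the joint law of report
and state. -/
theorem map_prod_eq_compProd {α : Type*} [MeasurableSpace α] {μ : Measure ℝ}
    [IsProbabilityMeasure μ] {rep : ℝ → α} (hrep : Measurable rep) (κ : Kernel α ℝ)
    [IsMarkovKernel κ]
    (hb : ∀ A : Set ℝ, MeasurableSet A → ∀ B : Set α, MeasurableSet B →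
      μ (A ∩ {θ | rep θ ∈ B}) = ∫⁻ θ in {θ | rep θ ∈ B}, κ (rep θ) A ∂μ) :
    μ.map (fun θ => (rep θ, θ)) = (μ.map rep) ⊗ₘ κ := by
  have hm : Measurable fun θ : ℝ => (rep θ, θ) := hrep.prodMk measurable_id
  have : IsProbabilityMeasure (μ.map rep) := Measure.isProbabilityMeasure_map hrep.aemeasurable
  have : IsProbabilityMeasure (μ.map fun θ => (rep θ, θ)) :=
    Measure.isProbabilityMeasure_map hm.aemeasurable
  refine Measure.ext_prod fun {s t} hs ht => ?_
  rw [Measure.compProd_apply_prod hs ht, Measure.map_apply hm (hs.prod ht),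
    setLIntegral_map hs (κ.measurable_coe ht) hrep]
  have := hb t ht s hs
  convert this using 2
  · ext θ; simp [and_comm]
  · rfl

/-- Payoffs can be averaged report by report. The same statement serves finite rules, equilibrium
reports and the phases of the constructed equilibria. -/
theorem integral_disintegrate {α : Type*} [MeasurableSpace α] {μ : Measure ℝ}
    [IsProbabilityMeasure μ] {rep : ℝ → α} (hrep : Measurable rep) (κ : Kernel α ℝ)
    [IsMarkovKernel κ]
    (hb : ∀ A : Set ℝ, MeasurableSet A → ∀ B : Set α, MeasurableSet B →
      μ (A ∩ {θ | rep θ ∈ B}) = ∫⁻ θ in {θ | rep θ ∈ B}, κ (rep θ) A ∂μ)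
    (hμ : ∀ᵐ θ ∂μ, θ ∈ Set.Icc (0 : ℝ) 1)
    {f : α × ℝ → ℝ} (hf : Measurable f) (C : ℝ)
    (hC : ∀ θ ∈ Set.Icc (0 : ℝ) 1, |f (rep θ, θ)| ≤ C) :
    ∫ θ, f (rep θ, θ) ∂μ = ∫ θ, (∫ θ', f (rep θ, θ') ∂(κ (rep θ))) ∂μ := by
  have hm : Measurable fun θ : ℝ => (rep θ, θ) := hrep.prodMk measurable_id
  have : IsProbabilityMeasure (μ.map rep) := Measure.isProbabilityMeasure_map hrep.aemeasurable
  have e := map_prod_eq_compProd hrep κ hb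
  have hint : Integrable f ((μ.map rep) ⊗ₘ κ) := by
    rw [← e, integrable_map_measure hf.aestronglyMeasurable hm.aemeasurable]
    exact integrable_of_bound hμ (hf.comp hm) C hC
  calc _ = ∫ z, f z ∂(μ.map fun θ => (rep θ, θ)) := by
        rw [integral_map hm.aemeasurable hf.aestronglyMeasurable]
    _ = ∫ x, (∫ θ', f (x, θ') ∂(κ x)) ∂(μ.map rep) := by
        rw [e, Measure.integral_compProd hint]
    _ = _ := by
        rw [integral_map hrep.aemeasurable]
        exact (hint.1.integral_kernel_compProd)

/-! ### Finite monotone message rules -/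

/-- A monotone message rule with finitely many messages. -/
structure Rule where
  msg : ℝ → ℕ
  measurable_msg : Measurable msg
  mono : MonotoneOn msg (Set.Icc 0 1)
  bdd : ∃ N, ∀ θ, msg θ ≤ N

namespace Rule

variable (m : Rule)

/-- The states in which a message is sent. -/
def cell (k : ℕ) : Set ℝ := {θ | θ ∈ Set.Icc (0 : ℝ) 1 ∧ m.msg θ = k}

theorem measurableSet_cell (k : ℕ) : MeasurableSet (m.cell k) :=
  measurableSet_Icc.inter (m.measurable_msg (measurableSet_singleton k))

open Classical in
/-- A state in which the message is sent, if there is one. -/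
noncomputable def pt (k : ℕ) : ℝ := if h : (m.cell k).Nonempty then h.some else 0

theorem pt_mem_Icc (k : ℕ) : m.pt k ∈ Set.Icc (0 : ℝ) 1 := by
  unfold pt; split_ifs with h
  · exact h.some_mem.1
  · simp

theorem pt_mem {k : ℕ} (h : (m.cell k).Nonempty) : m.pt k ∈ m.cell k := by
  unfold pt; rw [dif_pos h]; exact h.some_mem

theorem mem_cell {θ : ℝ} (h : θ ∈ Set.Icc (0 : ℝ) 1) : θ ∈ m.cell (m.msg θ) := ⟨h, rfl⟩

variable (M : Model)

open Classical in
/-- The conditional distribution of the state given a message. -/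
noncomputable def belMeasure (k : ℕ) : Measure ℝ :=
  if M.prior (m.cell k) ≠ 0 then ProbabilityTheory.cond M.prior (m.cell k)
  else Measure.dirac (m.pt k)

instance (k : ℕ) : IsProbabilityMeasure (m.belMeasure M k) := by
  unfold belMeasure; split_ifs with h
  · exact cond_isProbabilityMeasure h
  · infer_instance

theorem belMeasure_cell {k : ℕ} (h : (m.cell k).Nonempty) : m.belMeasure M k (m.cell k) = 1 := by
  unfold belMeasure; split_ifs with h0
  · rw [cond_apply (m.measurableSet_cell k), Set.inter_self]
    exact ENNReal.inv_mul_cancel h0 (measure_ne_top _ _)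
  · simp [m.pt_mem h]

theorem belMeasure_Icc (k : ℕ) : m.belMeasure M k (Set.Icc (0 : ℝ) 1) = 1 := by
  by_cases h : (m.cell k).Nonempty
  · refine le_antisymm prob_le_one ?_
    rw [← m.belMeasure_cell M h]
    exact measure_mono fun θ h => h.1
  · have : M.prior (m.cell k) = 0 := by
      rw [Set.not_nonempty_iff_eq_empty.1 h]; simp
    unfold belMeasure
    rw [if_neg (by simpa using this), Measure.dirac_apply' _ measurableSet_Icc]
    simp [m.pt_mem_Icc k, -Set.mem_Icc]

theorem prior_mul_belMeasure (k : ℕ) (A : Set ℝ) :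
    M.prior (m.cell k) * m.belMeasure M k A = M.prior (m.cell k ∩ A) := by
  unfold belMeasure; split_ifs with h0
  · rw [cond_apply (m.measurableSet_cell k), ← mul_assoc,
      ENNReal.mul_inv_cancel h0 (measure_ne_top _ _), one_mul]
  · have : M.prior (m.cell k) = 0 := by simpa using h0
    rw [this, zero_mul]
    exact (measure_mono_null Set.inter_subset_left this).symm

/-- The beliefs as a kernel. -/
noncomputable def bel : Kernel ℕ ℝ := Kernel.ofFunOfCountable (m.belMeasure M)

theorem bel_apply (k : ℕ) : m.bel M k = m.belMeasure M k := rfl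

instance : IsMarkovKernel (m.bel M) := ⟨fun k => by rw [bel_apply]; infer_instance⟩

/-- The countably many cells exhaust the prior and the belief is constant on each of them. On a null
cell the belief is arbitrary, but both sides vanish. -/
theorem bayes (A : Set ℝ) (hA : MeasurableSet A) (B : Set ℕ) :
    M.prior (A ∩ {θ | m.msg θ ∈ B}) = ∫⁻ θ in {θ | m.msg θ ∈ B}, m.bel M (m.msg θ) A ∂M.prior := by
  have hB : MeasurableSet {θ | m.msg θ ∈ B} := m.measurable_msg (Set.to_countable B).measurableSet
  have hd : Pairwise (Function.onFun Disjoint m.cell) := fun i j hij =>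
    Set.disjoint_left.2 fun θ hi hj => hij (hi.2.symm.trans hj.2)
  have h0 : M.prior (Set.Icc (0 : ℝ) 1)ᶜ = 0 := M.prior_ae_mem
  have hU : M.prior = M.prior.restrict (⋃ k, m.cell k) := by
    refine (Measure.restrict_eq_self_of_ae_mem ?_).symm
    filter_upwards [M.prior_ae_mem] with θ hθ
    exact Set.mem_iUnion.2 ⟨_, m.mem_cell hθ⟩
  have key : ∀ k, ∫⁻ θ in m.cell k, ({θ | m.msg θ ∈ B}.indicator
      fun θ => m.bel M (m.msg θ) A) θ ∂M.prior =
      M.prior ((A ∩ {θ | m.msg θ ∈ B}) ∩ m.cell k) := by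
    intro k
    by_cases hk : k ∈ B
    · have : ∀ θ ∈ m.cell k, ({θ | m.msg θ ∈ B}.indicator
          fun θ => m.bel M (m.msg θ) A) θ = m.belMeasure M k A := by
        intro θ hθ
        rw [Set.indicator_of_mem (by simpa [hθ.2] using hk), hθ.2, bel_apply]
      rw [setLIntegral_congr_fun (m.measurableSet_cell k) this, lintegral_const,
        Measure.restrict_apply MeasurableSet.univ, Set.univ_inter, mul_comm,
        prior_mul_belMeasure]
      congr 1
      ext θ
      constructor
      · rintro ⟨h1, h2⟩; exact ⟨⟨h2, by simpa [h1.2] using hk⟩, h1⟩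
      · rintro ⟨⟨h1, _⟩, h2⟩; exact ⟨h2, h1⟩
    · have : ∀ θ ∈ m.cell k, ({θ | m.msg θ ∈ B}.indicator
          fun θ => m.bel M (m.msg θ) A) θ = 0 := by
        intro θ hθ
        rw [Set.indicator_of_notMem (by simpa [hθ.2] using hk)]
      rw [setLIntegral_congr_fun (m.measurableSet_cell k) this, lintegral_zero]
      symm
      convert measure_empty (μ := M.prior)
      ext θ
      simp only [Set.mem_inter_iff, Set.mem_ofPred_eq, Set.mem_empty_iff_false, iff_false, not_and]
      rintro ⟨_, h1⟩ h2
      exact hk (h2.2 ▸ h1)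
  rw [← lintegral_indicator hB]
  conv_rhs => rw [hU]
  rw [lintegral_iUnion m.measurableSet_cell hd]
  simp_rw [key]
  conv_lhs => rw [hU]
  rw [Measure.restrict_apply' (MeasurableSet.iUnion m.measurableSet_cell), Set.inter_iUnion]
  exact measure_iUnion (fun i j hij => (hd hij).mono Set.inter_subset_right Set.inter_subset_right)
    fun k => (hA.inter hB).inter (m.measurableSet_cell k)

end Rule
end RelComm

/-! ### Posterior means of finite monotone rules. -/

namespace RelComm

theorem mean_le_of_measure_eq_one {ν : Measure ℝ} [IsProbabilityMeasure ν]
    (hν : ν (Set.Icc (0 : ℝ) 1) = 1) {A : Set ℝ} (hA : MeasurableSet A) (h1 : ν A = 1) {x : ℝ}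
    (hx : ∀ θ ∈ A, θ ≤ x) : mean ν ≤ x := by
  have h : ∀ᵐ θ ∂ν, θ ∈ A := (prob_compl_eq_zero_iff hA).2 h1
  have := integral_mono_ae (integrable_id_of_mem (ae_mem_of_measure_eq_one hν))
    (integrable_const x) (h.mono hx)
  simpa [mean] using this

theorem le_mean_of_measure_eq_one {ν : Measure ℝ} [IsProbabilityMeasure ν]
    (hν : ν (Set.Icc (0 : ℝ) 1) = 1) {A : Set ℝ} (hA : MeasurableSet A) (h1 : ν A = 1) {x : ℝ}
    (hx : ∀ θ ∈ A, x ≤ θ) : x ≤ mean ν := by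
  have h : ∀ᵐ θ ∂ν, θ ∈ A := (prob_compl_eq_zero_iff hA).2 h1
  have := integral_mono_ae (integrable_const x)
    (integrable_id_of_mem (ae_mem_of_measure_eq_one hν)) (h.mono hx)
  simpa [mean] using this

namespace Rule

variable (m : Rule) (M : Model)

/-- The posterior mean after a message. -/
noncomputable def y (k : ℕ) : ℝ := mean (m.belMeasure M k)

/-- The posterior mean induced in a state. -/
noncomputable def Y (θ : ℝ) : ℝ := m.y M (m.msg θ)

theorem y_mem (k : ℕ) : m.y M k ∈ Set.Icc (0 : ℝ) 1 := mean_mem (m.belMeasure_Icc M k)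

theorem Y_mem (θ : ℝ) : m.Y M θ ∈ Set.Icc (0 : ℝ) 1 := m.y_mem M _

theorem measurable_comp_msg {α : Type*} [MeasurableSpace α] (g : ℕ → α) :
    Measurable fun θ => g (m.msg θ) := (measurable_from_top (f := g)).comp m.measurable_msg

theorem measurable_Y : Measurable (m.Y M) := m.measurable_comp_msg _

/-- Every state of the lower cell lies below every state of the higher one, so the supremum of the
lower cell separates the two means. -/
theorem y_le_y {θ θ' : ℝ} (h : θ ∈ Set.Icc (0 : ℝ) 1) (h' : θ' ∈ Set.Icc (0 : ℝ) 1)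
    (hlt : m.msg θ < m.msg θ') : m.y M (m.msg θ) ≤ m.y M (m.msg θ') := by
  have key : ∀ x ∈ m.cell (m.msg θ), ∀ z ∈ m.cell (m.msg θ'), x ≤ z := by
    intro x hx z hz
    by_contra! hzx
    have := m.mono hz.1 hx.1 hzx.le
    rw [hx.2, hz.2] at this
    omega
  have hne : (m.cell (m.msg θ)).Nonempty := ⟨θ, m.mem_cell h⟩
  have hne' : (m.cell (m.msg θ')).Nonempty := ⟨θ', m.mem_cell h'⟩
  have hb : BddAbove (m.cell (m.msg θ)) := ⟨1, fun x hx => hx.1.2⟩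
  calc _ ≤ sSup (m.cell (m.msg θ)) :=
        mean_le_of_measure_eq_one (m.belMeasure_Icc M _) (m.measurableSet_cell _)
          (m.belMeasure_cell M hne) fun x hx => le_csSup hb hx
    _ ≤ _ := le_mean_of_measure_eq_one (m.belMeasure_Icc M _) (m.measurableSet_cell _)
          (m.belMeasure_cell M hne') fun z hz => csSup_le hne fun x hx => key x hx z hz

theorem Y_mono : MonotoneOn (m.Y M) (Set.Icc 0 1) := by
  intro θ h θ' h' hle
  rcases (m.mono h h' hle).lt_or_eq with hlt | heq
  · exact m.y_le_y M h h' hlt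
  · unfold Y; rw [heq]

theorem exists_bound (g : ℕ → ℝ) : ∃ C, 0 ≤ C ∧ ∀ θ, |g (m.msg θ)| ≤ C := by
  obtain ⟨N, hN⟩ := m.bdd
  refine ⟨∑ k ∈ Finset.range (N + 1), |g k|, Finset.sum_nonneg fun _ _ => abs_nonneg _, fun θ => ?_⟩
  exact Finset.single_le_sum (f := fun k => |g k|) (fun _ _ => abs_nonneg _)
    (Finset.mem_range.2 (Nat.lt_succ_of_le (hN θ)))

theorem integrable_mul (g : ℕ → ℝ) {h : ℝ → ℝ} (hh : Measurable h)
    (hC : ∀ θ ∈ Set.Icc (0 : ℝ) 1, |h θ| ≤ 1) :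
    Integrable (fun θ => g (m.msg θ) * h θ) M.prior := by
  obtain ⟨C, hC0, hg⟩ := m.exists_bound g
  refine M.integrable_prior ((m.measurable_comp_msg g).mul hh) C fun θ hθ => ?_
  rw [abs_mul]
  exact (mul_le_mul (hg θ) (hC θ hθ) (abs_nonneg _) hC0).trans (by simp)

theorem integrable_comp_msg (g : ℕ → ℝ) : Integrable (fun θ => g (m.msg θ)) M.prior := by
  simpa using m.integrable_mul M g (h := fun _ => 1) measurable_const (by simp)

theorem abs_le_one_of_mem {θ : ℝ} (h : θ ∈ Set.Icc (0 : ℝ) 1) : |θ| ≤ 1 :=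
  abs_le.2 ⟨by linarith [h.1], h.2⟩

theorem integral_mul_id (g : ℕ → ℝ) :
    ∫ θ, g (m.msg θ) * θ ∂M.prior = ∫ θ, g (m.msg θ) * m.Y M θ ∂M.prior := by
  obtain ⟨C, hC0, hg⟩ := m.exists_bound g
  have hf : Measurable fun z : ℕ × ℝ => g z.1 * z.2 :=
    measurable_from_prod_countable_right fun k => by
      simpa using measurable_id.const_mul (g k)
  have := integral_disintegrate m.measurable_msg (m.bel M) (fun A hA B _ => m.bayes M A hA B)
    M.prior_ae_mem hf C (fun θ hθ => by
      rw [abs_mul]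
      exact (mul_le_mul (hg θ) (abs_le_one_of_mem hθ) (abs_nonneg _) hC0).trans (by simp))
  rw [this]
  congr 1; ext θ
  exact integral_const_mul (μ := m.belMeasure M (m.msg θ)) (g (m.msg θ)) fun θ' : ℝ => θ'

theorem integral_Y : ∫ θ, m.Y M θ ∂M.prior = M.mu := by
  have := m.integral_mul_id M (fun _ => 1)
  simp only [one_mul] at this
  exact this.symm

theorem integral_uJoint_msg (z : ℕ → ℝ) :
    ∫ θ, Model.uJoint (z (m.msg θ)) θ ∂M.prior =
      ∫ θ, Model.uJoint (z (m.msg θ)) (m.Y M θ) ∂M.prior := by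
  have e : ∀ h : ℝ → ℝ, Measurable h → (∀ θ ∈ Set.Icc (0 : ℝ) 1, |h θ| ≤ 1) →
      ∫ θ, Model.uJoint (z (m.msg θ)) (h θ) ∂M.prior =
        ∫ θ, z (m.msg θ) * h θ ∂M.prior - ∫ θ, z (m.msg θ) ^ 2 / 2 ∂M.prior := by
    intro h hh hC
    rw [← integral_sub (m.integrable_mul M z hh hC)
      (m.integrable_comp_msg M fun k => z k ^ 2 / 2)]
    congr 1; ext θ; unfold Model.uJoint; ring
  rw [e (fun θ => θ) measurable_id (fun θ => abs_le_one_of_mem),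
    e (m.Y M) (m.measurable_Y M) (fun θ _ => abs_le_one_of_mem (m.Y_mem M θ)), m.integral_mul_id]

/-- A rule without information. -/
def trivialRule : Rule := ⟨fun _ => 0, measurable_const, fun _ _ _ _ _ => le_rfl, 0, fun _ => le_rfl⟩

instance : Nonempty Rule := ⟨trivialRule⟩

theorem trivialRule_Y (θ : ℝ) : trivialRule.Y M θ = M.mu := by
  rw [← trivialRule.integral_Y M]
  have : ∀ θ', trivialRule.Y M θ' = trivialRule.Y M θ := fun θ' => rfl
  simp_rw [this]
  simp

end Rule

/-! ### Joint payoffs as a function of the radius and the posterior mean. -/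

namespace Model

variable (M : Model)

/-- The gap between the first-best and the receiver's preferred decisions. -/
noncomputable def gap (y : ℝ) : ℝ := y - M.rhoR y

/-- The joint payoff under the second-best decision, if the posterior mean is `y` and decisions
can differ by `s` from the receiver's preferred one. -/
noncomputable def w (s y : ℝ) : ℝ := y ^ 2 / 2 - (max (M.gap y - s) 0) ^ 2 / 2

theorem gap_eq (y : ℝ) : M.gap y = (1 - M.a) * y - M.b := by unfold gap rhoR; ring

theorem measurable_w (s : ℝ) : Measurable (M.w s) := by
  unfold w gap rhoR; fun_prop

/-- Since the bias is downward, only the upper limit on decisions can bind. -/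
theorem uJoint_le_w {s d y : ℝ} (h : d ≤ M.rhoR y + s) : uJoint d y ≤ M.w s y := by
  have e : uJoint d y = y ^ 2 / 2 - (y - d) ^ 2 / 2 := by unfold uJoint; ring
  rw [e]; unfold w
  have : (max (M.gap y - s) 0) ^ 2 ≤ (y - d) ^ 2 := by
    rcases le_total (M.gap y - s) 0 with h0 | h0
    · rw [max_eq_right h0]; nlinarith [sq_nonneg (y - d)]
    · rw [max_eq_left h0]
      have : M.gap y - s ≤ y - d := by unfold gap; linarith
      exact pow_le_pow_left₀ h0 this 2
  linarith

theorem uJoint_eq_w {s y : ℝ} : uJoint (min y (M.rhoR y + s)) y = M.w s y := by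
  unfold uJoint w gap
  rcases le_total y (M.rhoR y + s) with h | h
  · rw [min_eq_left h, max_eq_right (by linarith)]; ring
  · rw [min_eq_right h, max_eq_left (by linarith)]; ring

theorem w_mono {s s' : ℝ} (h : s ≤ s') (y : ℝ) : M.w s y ≤ M.w s' y := by
  unfold w
  have : max (M.gap y - s') 0 ≤ max (M.gap y - s) 0 := max_le_max (by linarith) le_rfl
  have := pow_le_pow_left₀ (le_max_right _ _) this 2
  linarith

theorem w_le_half (s : ℝ) {y : ℝ} (hy : y ∈ Set.Icc (0 : ℝ) 1) : M.w s y ≤ 1 / 2 := by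
  unfold w
  have : y ^ 2 ≤ 1 := by nlinarith [hy.1, hy.2]
  nlinarith [sq_nonneg (max (M.gap y - s) 0)]

end Model

namespace Model

theorem gap_le {M : Model} (ha : 2 < M.a) {y : ℝ} (hy : 0 ≤ y) : M.gap y ≤ -M.b := by
  rw [gap_eq]; nlinarith

theorem gap_pos {M : Model} (ha : 2 < M.a) (hb : M.a + M.b < 1) {y : ℝ} (hy : y ≤ 1) : 0 < M.gap y := by
  rw [gap_eq]; nlinarith

/-- The marginal value of radius is the gap that remains, which is at most the gap $-b$ at state
$0$. The uniform constant makes `Vsup` continuous. -/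
theorem w_lip {M : Model} (ha : 2 < M.a) (hb : M.a + M.b < 1) {s t y : ℝ} (hs : 0 ≤ s) (ht : 0 ≤ t) (hy : y ∈ Set.Icc (0 : ℝ) 1) :
    M.w (s + t) y ≤ M.w s y + -M.b * t := by
  have h1 := gap_le ha hy.1
  unfold w
  have hb' : 0 < -M.b := by linarith
  rcases le_total (M.gap y - s) 0 with h | h
  · rw [max_eq_right h, max_eq_right (by linarith)]; nlinarith
  · rw [max_eq_left h]
    rcases le_total (M.gap y - (s + t)) 0 with h' | h'
    · rw [max_eq_right h']
      nlinarith
    · rw [max_eq_left h']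
      nlinarith

/-- Until the gap is closed, $w$ is a constant plus $gs-s^2/2$ in the radius, where $g>0$ is the
gap. The constant and the square match on the two sides, and the linear term gains because $l\ge
l^2$. This is the source of the monotonicity of `kappa`. -/
theorem w_scale {M : Model} (ha : 2 < M.a) (hb : M.a + M.b < 1) {s l y : ℝ} (hs : 0 ≤ s) (hl0 : 0 ≤ l) (hl1 : l ≤ 1) (hy : y ≤ 1) :
    l ^ 2 * M.w s y + (1 - l ^ 2) * M.w 0 y ≤ M.w (l * s) y := by
  have hg := gap_pos ha hb hy
  set g := M.gap y
  have hls : l * s ≤ s := by nlinarith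
  unfold w
  rw [show M.gap y = g from rfl, max_eq_left (by linarith : 0 ≤ g - 0)]
  rcases le_total (g - s) 0 with h | h
  · rw [max_eq_right h]
    rcases le_total (g - l * s) 0 with h' | h'
    · rw [max_eq_right h']
      have : l ^ 2 ≤ 1 := by nlinarith
      nlinarith [mul_nonneg (sub_nonneg.2 this) (sq_nonneg g)]
    · rw [max_eq_left h']
      have h1 : 0 ≤ (g - l * s) * s := mul_nonneg h' hs
      have h2 : 0 ≤ g * (s - g) := mul_nonneg hg.le (by linarith)
      have h3 : l * g ^ 2 ≤ g ^ 2 := by nlinarith [sq_nonneg g]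
      have : 0 ≤ l * (2 * g * s - l * s ^ 2 - l * g ^ 2) := by
        apply mul_nonneg hl0; nlinarith
      nlinarith
  · rw [max_eq_left h, max_eq_left (by linarith)]
    have : 0 ≤ g * s * (l * (1 - l)) :=
      mul_nonneg (mul_nonneg hg.le hs) (mul_nonneg hl0 (by linarith))
    nlinarith

theorem abs_w_le {M : Model} (ha : 2 < M.a) (hb : M.a + M.b < 1) {s y : ℝ} (hs : 0 ≤ s) (hy : y ∈ Set.Icc (0 : ℝ) 1) :
    |M.w s y| ≤ 1 / 2 + M.b ^ 2 / 2 := by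
  have h1 := gap_le ha hy.1
  have h2 := M.w_le_half s hy
  rw [abs_le]
  refine ⟨?_, by nlinarith [sq_nonneg M.b]⟩
  unfold w
  have h3 : max (M.gap y - s) 0 ≤ -M.b := max_le (by linarith) (by linarith)
  have := pow_le_pow_left₀ (le_max_right _ _) h3 2
  nlinarith [sq_nonneg y]

end Model

namespace Rule

theorem integrable_w (M : Model) (m : Rule) (s : ℝ) : Integrable (fun θ => M.w s (m.Y M θ)) M.prior :=
  m.integrable_comp_msg M fun k => M.w s (m.y M k)

/-- At radius $0$ the joint payoff is concave in the posterior mean, because $a>2$, and so lies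
above its chord over $[0,1]$. The expectation of the chord depends on the prior mean only, hence the
bound is the same for all rules. -/
theorem integral_w_zero_ge {M : Model} (ha : 2 < M.a) (hb : M.a + M.b < 1) (m : Rule) :
    (M.a - M.a ^ 2 / 2) * M.mu + M.b * (1 - M.a) * M.mu - M.b ^ 2 / 2 ≤
      ∫ θ, M.w 0 (m.Y M θ) ∂M.prior := by
  have hY := m.integrable_comp_msg M (m.y M)
  have e : ∫ θ, (((M.a - M.a ^ 2 / 2) + M.b * (1 - M.a)) * m.Y M θ + -(M.b ^ 2 / 2)) ∂M.prior =
      (M.a - M.a ^ 2 / 2) * M.mu + M.b * (1 - M.a) * M.mu - M.b ^ 2 / 2 := by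
    have h2 := integral_add (μ := M.prior)
      (hY.const_mul ((M.a - M.a ^ 2 / 2) + M.b * (1 - M.a))) (integrable_const (-(M.b ^ 2 / 2)))
    rw [integral_const_mul] at h2
    change ∫ θ, (((M.a - M.a ^ 2 / 2) + M.b * (1 - M.a)) * m.y M (m.msg θ) + -(M.b ^ 2 / 2)) ∂M.prior = _
    rw [h2]
    have := m.integral_Y M
    unfold Y at this
    rw [this]; simp; ring
  rw [← e]
  refine integral_mono ((hY.const_mul _).add (integrable_const _)) (integrable_w M m 0)
    fun θ => ?_
  have hy := m.Y_mem M θ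
  have hg := Model.gap_pos ha hb hy.2
  simp only
  unfold Model.w
  rw [max_eq_left (by linarith), M.gap_eq]
  have h1 : 0 ≤ m.Y M θ * (1 - m.Y M θ) := mul_nonneg hy.1 (by linarith [hy.2])
  have h2 : 0 ≤ M.a ^ 2 / 2 - M.a := by nlinarith
  nlinarith [mul_nonneg h1 h2]

end Rule
end RelComm

/-! ### Best joint payoff, punishment payoffs and sustainable radii. -/

namespace RelComm

namespace Rule

variable (m : Rule) (M : Model)

/-- Expected joint payoff under a message rule and second-best decisions. -/
noncomputable def V (s : ℝ) : ℝ := ∫ θ, M.w s (m.Y M θ) ∂M.prior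

/-- The information rent term of a message rule. -/
noncomputable def J : ℝ := ∫ θ, (∫ t in (0 : ℝ)..θ, m.Y M t) ∂M.prior

theorem intervalIntegrable_comp_msg (g : ℕ → ℝ) (x z : ℝ) :
    IntervalIntegrable (fun t => g (m.msg t)) volume x z := by
  obtain ⟨C, _, hC⟩ := m.exists_bound g
  refine (intervalIntegrable_const (c := C)).mono_fun
    (m.measurable_comp_msg g).aestronglyMeasurable ?_
  filter_upwards with t
  exact (hC t).trans (le_abs_self C)

theorem J_nonneg : 0 ≤ m.J M := by
  refine integral_nonneg_of_ae ?_
  filter_upwards [M.prior_ae_mem] with θ hθ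
  exact intervalIntegral.integral_nonneg hθ.1 fun t _ => (m.Y_mem M t).1

theorem V_le_half (s : ℝ) : m.V M s ≤ 1 / 2 := by
  have := integral_mono (m.integrable_w M s) (integrable_const (1 / 2 : ℝ))
    fun θ => M.w_le_half s (m.Y_mem M θ)
  simpa [V] using this

theorem V_mono {s s' : ℝ} (h : s ≤ s') : m.V M s ≤ m.V M s' :=
  integral_mono (m.integrable_w M s) (m.integrable_w M s') fun _ => M.w_mono h _

theorem V_lip {M : Model} (ha : 2 < M.a) (hb : M.a + M.b < 1) (m : Rule) {s t : ℝ} (hs : 0 ≤ s)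
    (ht : 0 ≤ t) : m.V M (s + t) ≤ m.V M s + -M.b * t := by
  have := integral_mono (m.integrable_w M (s + t))
    ((m.integrable_w M s).add (integrable_const (-M.b * t)))
    fun θ => Model.w_lip ha hb hs ht (m.Y_mem M θ)
  simp only [Pi.add_apply] at this
  rw [integral_add (m.integrable_w M s) (integrable_const _)] at this
  simpa [V] using this

theorem V_scale {M : Model} (ha : 2 < M.a) (hb : M.a + M.b < 1) (m : Rule) {s l : ℝ} (hs : 0 ≤ s)
    (hl0 : 0 ≤ l) (hl1 : l ≤ 1) :
    l ^ 2 * m.V M s + (1 - l ^ 2) * m.V M 0 ≤ m.V M (l * s) := by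
  have := integral_mono (((m.integrable_w M s).const_mul (l ^ 2)).add
    ((m.integrable_w M 0).const_mul (1 - l ^ 2))) (m.integrable_w M (l * s))
    fun θ => Model.w_scale ha hb hs hl0 hl1 (m.Y_mem M θ).2
  simp only [Pi.add_apply] at this
  rw [integral_add ((m.integrable_w M s).const_mul _) ((m.integrable_w M 0).const_mul _),
    integral_const_mul, integral_const_mul] at this
  exact this

theorem trivialRule_J : trivialRule.J M = M.mu ^ 2 := by
  unfold J
  simp_rw [trivialRule_Y]
  simp only [intervalIntegral.integral_const, sub_zero, smul_eq_mul]
  rw [integral_mul_const]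
  change M.mu * M.mu = _
  ring

end Rule

namespace Model

variable (M : Model)

/-- The largest expected joint payoff. -/
noncomputable def Vsup (s : ℝ) : ℝ := ⨆ m : Rule, m.V M s

/-- The smallest information rent term. -/
noncomputable def Jinf : ℝ := ⨅ m : Rule, m.J M

theorem bddAbove_V (s : ℝ) : BddAbove (Set.range fun m : Rule => m.V M s) :=
  ⟨1 / 2, by rintro _ ⟨m, rfl⟩; exact m.V_le_half M s⟩

theorem bddBelow_J : BddBelow (Set.range fun m : Rule => m.J M) :=
  ⟨0, by rintro _ ⟨m, rfl⟩; exact m.J_nonneg M⟩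

theorem V_le_Vsup (m : Rule) (s : ℝ) : m.V M s ≤ M.Vsup s := le_ciSup (M.bddAbove_V s) m

theorem Jinf_le (m : Rule) : M.Jinf ≤ m.J M := ciInf_le M.bddBelow_J m

theorem Vsup_mono {s s' : ℝ} (h : s ≤ s') : M.Vsup s ≤ M.Vsup s' :=
  ciSup_le fun m => (m.V_mono M h).trans (M.V_le_Vsup m s')

/-- The punishment payoff of the sender with information rent term `j`. -/
noncomputable def punish (j s : ℝ) : ℝ :=
  M.uS (M.b - s) 0 + (1 - M.c * M.a) * (M.a * j + M.b * M.mu - s * M.mu)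

/-- The joint surplus over the punishment payoffs of the players. -/
noncomputable def G (s : ℝ) : ℝ := M.Vsup s - M.punish M.Jinf s - M.r0

theorem uS_b_sub (s : ℝ) :
    M.uS (M.b - s) 0 = -(1 + M.c) * M.b ^ 2 / 2 + M.b * s - (1 - M.c) * s ^ 2 / 2 := by
  unfold uS uJoint uR; ring

/-- The smallest surplus. -/
noncomputable def surplusFloor : ℝ :=
  M.mu * (M.a ^ 2 / 2 - M.a * M.mu + M.c * M.a ^ 2 * M.mu / 2)

/-- A lower bound for the joint payoff without enforcement. -/
noncomputable def jointFloor : ℝ :=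
  (M.a - M.a ^ 2 / 2) * M.mu + M.b * (1 - M.a) * M.mu - M.b ^ 2 / 2

theorem Vsup_lip {M : Model} (ha : 2 < M.a) (hb : M.a + M.b < 1) {s t : ℝ} (hs : 0 ≤ s)
    (ht : 0 ≤ t) : M.Vsup (s + t) ≤ M.Vsup s + -M.b * t :=
  ciSup_le fun m => (Rule.V_lip ha hb m hs ht).trans (by have := M.V_le_Vsup m s; linarith)

theorem Vsup_scale {M : Model} (ha : 2 < M.a) (hb : M.a + M.b < 1) {s l : ℝ} (hs : 0 ≤ s)
    (hl0 : 0 < l) (hl1 : l ≤ 1) :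
    l ^ 2 * M.Vsup s + (1 - l ^ 2) * M.jointFloor ≤ M.Vsup (l * s) := by
  have hl2 : 0 < l ^ 2 := by positivity
  have hl3 : 0 ≤ 1 - l ^ 2 := by nlinarith
  have : M.Vsup s ≤ (M.Vsup (l * s) - (1 - l ^ 2) * M.jointFloor) / l ^ 2 := by
    refine ciSup_le fun m => ?_
    rw [le_div_iff₀ hl2]
    have h1 := Rule.V_scale ha hb m hs hl0.le hl1
    have h2 := M.V_le_Vsup m (l * s)
    have h3 : M.jointFloor ≤ m.V M 0 := Rule.integral_w_zero_ge ha hb m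
    have h4 := mul_le_mul_of_nonneg_left h3 hl3
    linarith
  rw [le_div_iff₀ hl2] at this
  linarith

theorem surplusFloor_pos {M : Model} (ha : 2 < M.a) : 0 < M.surplusFloor := by
  have h1 := M.mu_pos
  have h2 := M.mu_le_one
  have h3 := M.c_pos
  unfold surplusFloor
  apply mul_pos h1
  have : 0 < M.c * M.a ^ 2 * M.mu / 2 := by positivity
  nlinarith

/-- There is a positive surplus even if nothing can be enforced. The uninformative rule gives `Jinf
≤ mu ^ 2`, and the rest is algebra with the downward bias at state $1$. -/
theorem jointFloor_ge {M : Model} (ha : 2 < M.a) (hb : M.a + M.b < 1) :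
    M.surplusFloor ≤ M.jointFloor - M.punish M.Jinf 0 - M.r0 := by
  have h1 := M.mu_pos
  have h4 := M.ca_lt
  have h5 : M.Jinf ≤ M.mu ^ 2 := (M.Jinf_le Rule.trivialRule).trans_eq (Rule.trivialRule_J M)
  have e := M.uS_b_sub 0
  have h6 : (1 - M.c * M.a) * (M.a * M.Jinf) ≤ (1 - M.c * M.a) * (M.a * M.mu ^ 2) :=
    mul_le_mul_of_nonneg_left (mul_le_mul_of_nonneg_left h5 (by linarith)) (by linarith)
  have h7 : 0 ≤ M.a * M.mu * (1 - M.a - M.b) :=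
    mul_nonneg (mul_nonneg (by linarith) h1.le) (by linarith)
  unfold surplusFloor jointFloor punish r0
  rw [e]
  unfold uR rhoR
  nlinarith

theorem punish_anti {M : Model} (ha : 2 < M.a) (hb : M.a + M.b < 1) (j : ℝ) {s s' : ℝ}
    (hs : 0 ≤ s) (h : s ≤ s') : M.punish j s' ≤ M.punish j s := by
  have h1 := M.mu_pos
  have h4 := M.ca_lt
  have h5 := M.c_le_one
  unfold punish
  rw [uS_b_sub, uS_b_sub]
  have e1 : 0 ≤ (1 - M.c * M.a) * (M.mu * (s' - s)) :=
    mul_nonneg (by linarith) (mul_nonneg h1.le (by linarith))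
  have e2 : 0 ≤ -M.b * (s' - s) := mul_nonneg (by linarith) (by linarith)
  have e3 : 0 ≤ (1 - M.c) * (s' ^ 2 - s ^ 2) := mul_nonneg (by linarith) (by nlinarith)
  nlinarith

theorem G_mono {M : Model} (ha : 2 < M.a) (hb : M.a + M.b < 1) {s s' : ℝ} (hs : 0 ≤ s)
    (h : s ≤ s') : M.G s ≤ M.G s' := by
  have := M.Vsup_mono h
  have := punish_anti ha hb M.Jinf hs h
  unfold G; linarith

/-- `Vsup` satisfies the scaling inequality, and `punish` is quadratic in $s$ with a nonpositive
linear coefficient, so it scales favourably too. Strictness comes from the positive surplus at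
radius $0$, which enters with weight $1-l^2$. -/
theorem G_scale {M : Model} (ha : 2 < M.a) (hb : M.a + M.b < 1) {s l : ℝ} (hs : 0 ≤ s)
    (hl0 : 0 < l) (hl1 : l < 1) : l ^ 2 * M.G s < M.G (l * s) := by
  have h0 := Vsup_scale ha hb hs hl0 hl1.le
  have h1 := M.mu_pos
  have h4 := M.ca_lt
  have h5 := jointFloor_ge ha hb
  have h6 := surplusFloor_pos ha
  have hl3 : 0 < 1 - l ^ 2 := by nlinarith
  have h7 : 0 < (1 - l ^ 2) * (M.jointFloor - M.punish M.Jinf 0 - M.r0) :=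
    mul_pos hl3 (by linarith)
  have h8 : 0 ≤ (l - l ^ 2) * s := mul_nonneg (by nlinarith) hs
  have h9 : 0 ≤ (l - l ^ 2) * s * (-M.b + (1 - M.c * M.a) * M.mu) :=
    mul_nonneg h8 (by nlinarith [mul_pos (by linarith : 0 < 1 - M.c * M.a) h1])
  have e : M.punish M.Jinf (l * s) = l ^ 2 * M.punish M.Jinf s + (1 - l ^ 2) * M.punish M.Jinf 0 -
      (l - l ^ 2) * s * (-M.b + (1 - M.c * M.a) * M.mu) := by
    unfold punish; simp_rw [uS_b_sub]; ring
  unfold G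
  rw [e]
  nlinarith

theorem G_pos {M : Model} (ha : 2 < M.a) (hb : M.a + M.b < 1) {s : ℝ} (hs : 0 ≤ s) :
    M.surplusFloor ≤ M.G s := by
  refine le_trans ?_ (G_mono ha hb le_rfl hs)
  have h1 : M.jointFloor ≤ M.Vsup 0 :=
    (Rule.integral_w_zero_ge ha hb Rule.trivialRule).trans (M.V_le_Vsup _ 0)
  have := jointFloor_ge ha hb
  unfold G; linarith

theorem Vsup_continuousOn {M : Model} (ha : 2 < M.a) (hb : M.a + M.b < 1) :
    ContinuousOn M.Vsup (Set.Ici 0) := by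
  have : LipschitzOnWith (Real.toNNReal (-M.b)) M.Vsup (Set.Ici 0) := by
    refine LipschitzOnWith.of_le_add_mul _ fun x hx y hy => ?_
    rw [Real.coe_toNNReal _ (by linarith), Real.dist_eq]
    have hb0 : 0 ≤ -M.b := by linarith
    rcases le_total x y with h | h
    · have := M.Vsup_mono h
      have := mul_nonneg hb0 (abs_nonneg (x - y))
      linarith
    · have := Vsup_lip ha hb (s := y) (t := x - y) hy (by linarith)
      rw [abs_of_nonneg (by linarith)]
      simpa using this
  exact this.continuousOn

theorem G_continuousOn {M : Model} (ha : 2 < M.a) (hb : M.a + M.b < 1) :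
    ContinuousOn M.G (Set.Ici 0) := by
  have h := Vsup_continuousOn ha hb
  unfold G punish
  simp_rw [uS_b_sub]
  fun_prop

/-- The odds of continuation at which the enforcement radius `s` is just sustainable. -/
noncomputable def kappa (s : ℝ) : ℝ := M.c * s ^ 2 / (2 * M.G s)

theorem kappa_zero : M.kappa 0 = 0 := by simp [kappa]

theorem kappa_le_iff {M : Model} (ha : 2 < M.a) (hb : M.a + M.b < 1) {s φ : ℝ} (hs : 0 ≤ s) :
    M.kappa s ≤ φ ↔ M.c * s ^ 2 / 2 ≤ φ * M.G s := by
  have := (surplusFloor_pos ha).trans_le (G_pos ha hb hs)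
  unfold kappa
  rw [div_le_iff₀ (by linarith)]
  constructor <;> intro h <;> linarith

theorem kappa_strictMono {M : Model} (ha : 2 < M.a) (hb : M.a + M.b < 1) :
    StrictMonoOn M.kappa (Set.Ici 0) := by
  intro s hs t ht hst
  have hG := (surplusFloor_pos ha).trans_le (G_pos ha hb hs)
  have hG' := (surplusFloor_pos ha).trans_le (G_pos ha hb ht)
  have hc := M.c_pos
  have ht0 : 0 < t := lt_of_le_of_lt hs hst
  rcases (Set.mem_Ici.1 hs).eq_or_lt with h0 | h0
  · rw [← h0, kappa_zero]; unfold kappa; positivity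
  -- With $l=s/t$ the scaling inequality reads $s^2G(t)<t^2G(s)$, which compares the two ratios.
  have := G_scale ha hb ht (l := s / t) (by positivity) ((div_lt_one ht0).2 hst)
  rw [div_mul_cancel₀ _ ht0.ne', div_pow, div_mul_eq_mul_div, div_lt_iff₀ (by positivity)] at this
  unfold kappa
  rw [div_lt_div_iff₀ (by linarith) (by linarith)]
  nlinarith

theorem kappa_continuousOn {M : Model} (ha : 2 < M.a) (hb : M.a + M.b < 1) :
    ContinuousOn M.kappa (Set.Ici 0) := by
  unfold kappa
  refine ContinuousOn.div (by fun_prop) (continuousOn_const.mul (G_continuousOn ha hb)) ?_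
  intro s hs
  have := (surplusFloor_pos ha).trans_le (G_pos ha hb hs)
  positivity

/-- Between two sustainable radii the squared radius grows at least as fast as the odds. -/
theorem kappa_div_le {M : Model} (ha : 2 < M.a) (hb : M.a + M.b < 1) {s t : ℝ} (hs : 0 ≤ s)
    (hst : s ≤ t) : M.kappa t * s ^ 2 ≤ M.kappa s * t ^ 2 := by
  have hG := (surplusFloor_pos ha).trans_le (G_pos ha hb hs)
  have hG' := (surplusFloor_pos ha).trans_le (G_pos ha hb (hs.trans hst))
  have hm := G_mono ha hb hs hst
  have hc := M.c_pos
  unfold kappa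
  rw [div_mul_eq_mul_div, div_mul_eq_mul_div, div_le_div_iff₀ (by linarith) (by linarith)]
  have : 0 ≤ M.c * t ^ 2 * s ^ 2 := by positivity
  nlinarith

end Model
end RelComm

namespace RelComm

/-! ### Payoffs in the repeated game -/

/-- All payments and the size of the decision are bounded by `B`. -/
def OutLE (B : ℝ≥0) (o : Outcome) : Prop :=
  PayLE o.1.1 B ∧ PayLE o.1.2 B ∧ PayLE o.2.1.2 B ∧ PayLE o.2.2.1.1 B ∧ |o.2.2.1.2| ≤ B ∧
    PayLE o.2.2.2.1 B ∧ PayLE o.2.2.2.2 B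

theorem PayLE.mono {p : Pay} {B B' : ℝ≥0} (h : PayLE p B) (hB : B ≤ B') : PayLE p B' :=
  ⟨h.1.trans hB, h.2.trans hB⟩

theorem exists_payLE (p : Pay) : ∃ B, PayLE p B := ⟨max p.1 p.2, le_max_left _ _, le_max_right _ _⟩

theorem abs_netTransfer_le {p q : Pay} {B : ℝ≥0} (hp : PayLE p B) (hq : PayLE q B) :
    |netTransfer p q| ≤ 2 * B := by
  unfold netTransfer
  have h1 : (p.1 : ℝ) ≤ B := by exact_mod_cast hp.1
  have h2 : (p.2 : ℝ) ≤ B := by exact_mod_cast hp.2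
  have h3 : (q.1 : ℝ) ≤ B := by exact_mod_cast hq.1
  have := p.1.coe_nonneg
  have := p.2.coe_nonneg
  have := q.1.coe_nonneg
  rw [abs_le]; constructor <;> linarith

theorem measurable_extend {n : ℕ} : Measurable fun z : Hist n × Outcome => extend z.1 z.2 := by
  refine measurable_pi_iff.2 fun i => ?_
  induction i using Fin.lastCases with
  | last => simpa [extend] using measurable_snd
  | cast j =>
    have : Measurable fun z : Hist n × Outcome => z.1 j :=
      (measurable_pi_apply j).comp measurable_fst
    simpa [extend] using this

namespace Profile

variable (σ : Profile) {n : ℕ}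

theorem measurable_playExPostR :
    Measurable fun z : (Info n × (Pay × ℝ)) × Pay => σ.playExPostR z.1.1 z.1.2 z.2 := by
  have := σ.R.measurable_exPost n
  unfold playExPostR
  fun_prop

theorem measurable_playExPostS :
    Measurable fun z : Info n × (Pay × ℝ) => σ.playExPostS z.1 z.2 :=
  σ.measurable_playExPostR.comp (measurable_id.prodMk (σ.S.measurable_exPost n))

theorem measurable_playDecision :
    Measurable fun z : Info n × Pay => σ.playDecision z.1 z.2 :=
  σ.measurable_playExPostS.comp
    (measurable_fst.prodMk (measurable_snd.prodMk (σ.R.measurable_decision n)))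

theorem measurable_playInterimR : Measurable fun i : Info n => σ.playInterimR i :=
  σ.measurable_playDecision.comp (measurable_id.prodMk (σ.R.measurable_interim n))

theorem measurable_playReport :
    Measurable fun z : Hist n × (Pay × Pay) × ℝ => σ.playReport z.1 z.2.1 z.2.2 :=
  σ.measurable_playInterimR.comp (measurable_fst.prodMk
    ((measurable_fst.comp measurable_snd).prodMk (σ.S.measurable_report n)))

theorem measurable_playExAnteR :
    Measurable fun z : (Hist n × Pay) × ℝ => σ.playExAnteR z.1.1 z.1.2 z.2 :=
  σ.measurable_playReport.comp ((measurable_fst.comp measurable_fst).prodMk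
    (((measurable_snd.comp measurable_fst).prodMk
      ((σ.R.measurable_exAnte n).comp measurable_fst)).prodMk measurable_snd))

theorem measurable_play : Measurable fun z : Hist n × ℝ => σ.play z.1 z.2 :=
  σ.measurable_playExAnteR.comp ((measurable_fst.prodMk
    ((σ.S.measurable_exAnte n).comp measurable_fst)).prodMk measurable_snd)

theorem exists_bound_playReport : ∃ B : ℝ≥0, ∀ (n : ℕ) (h : Hist n) (x : Pay × Pay) (θ : ℝ)
    (C : ℝ≥0), PayLE x.1 C → PayLE x.2 C → B ≤ C → OutLE C (σ.playReport h x θ) := by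
  obtain ⟨B, hB⟩ := σ.S.bounded
  obtain ⟨B', hB'⟩ := σ.R.bounded
  refine ⟨max B B', fun n h x θ C h1 h2 hC => ?_⟩
  have hS := (le_max_left B B').trans hC
  have hR := (le_max_right B B').trans hC
  refine ⟨h1, h2, ((hB n).2.1 _).mono hS, ((hB' n).2.1 _).mono hR,
    ((hB' n).2.2.1 _).trans (by exact_mod_cast hR), ((hB n).2.2 _).mono hS,
    ((hB' n).2.2.2 _).mono hR⟩

theorem exists_bound_playExAnteR : ∃ B : ℝ≥0, ∀ (n : ℕ) (h : Hist n) (x : Pay) (θ : ℝ)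
    (C : ℝ≥0), PayLE x C → B ≤ C → OutLE C (σ.playExAnteR h x θ) := by
  obtain ⟨B, hB⟩ := σ.exists_bound_playReport
  obtain ⟨B', hB'⟩ := σ.R.bounded
  refine ⟨max B B', fun n h x θ C h1 hC => ?_⟩
  exact hB n h _ θ C h1 (((hB' n).1 _).mono ((le_max_right _ _).trans hC))
    ((le_max_left _ _).trans hC)

theorem exists_bound_play : ∃ B : ℝ≥0, ∀ (n : ℕ) (h : Hist n) (θ : ℝ), OutLE B (σ.play h θ) := by
  obtain ⟨B, hB⟩ := σ.exists_bound_playExAnteR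
  obtain ⟨B', hB'⟩ := σ.S.bounded
  exact ⟨max B B', fun n h θ => hB n h _ θ _ (((hB' n).1 _).mono (le_max_right _ _))
    (le_max_left _ _)⟩

end Profile

namespace Model

variable (M : Model)

theorem measurable_stagePayoff (i : Player) :
    Measurable fun z : ℝ × Outcome => M.stagePayoff i z.1 z.2 := by
  cases i <;> unfold stagePayoff netTransfer uS uJoint uR <;> fun_prop

theorem exists_bound_stagePayoff (B : ℝ≥0) : ∃ K : ℝ, 0 ≤ K ∧ ∀ (i : Player) (θ : ℝ) (o : Outcome),
    θ ∈ Set.Icc (0 : ℝ) 1 → OutLE B o → |M.stagePayoff i θ o| ≤ K := by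
  have hR : ∀ d θ : ℝ, θ ∈ Set.Icc (0 : ℝ) 1 → |d| ≤ B →
      |M.uR d θ| ≤ M.c * ((|M.a| + |M.b|) * B + B ^ 2 / 2) := by
    intro d θ hθ hd
    unfold uR
    rw [abs_mul, abs_of_pos M.c_pos]
    refine mul_le_mul_of_nonneg_left ?_ M.c_pos.le
    refine (abs_sub _ _).trans (add_le_add ?_ ?_)
    · rw [abs_mul]
      refine mul_le_mul ((abs_add_le _ _).trans (add_le_add ?_ le_rfl)) hd (abs_nonneg _)
        (by positivity)
      rw [abs_mul]
      exact mul_le_of_le_one_right (abs_nonneg _) (Rule.abs_le_one_of_mem hθ)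
    · rw [abs_of_nonneg (by positivity), ← sq_abs d]
      have := pow_le_pow_left₀ (abs_nonneg d) hd 2
      linarith
  have hJ : ∀ d θ : ℝ, θ ∈ Set.Icc (0 : ℝ) 1 → |d| ≤ B → |uJoint d θ| ≤ B + B ^ 2 / 2 := by
    intro d θ hθ hd
    unfold uJoint
    refine (abs_sub _ _).trans (add_le_add ?_ ?_)
    · rw [abs_mul]
      exact (mul_le_of_le_one_left (abs_nonneg _) (Rule.abs_le_one_of_mem hθ)).trans hd
    · rw [abs_of_nonneg (by positivity), ← sq_abs d]
      have := pow_le_pow_left₀ (abs_nonneg d) hd 2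
      linarith
  refine ⟨(B + B ^ 2 / 2) + M.c * ((|M.a| + |M.b|) * B + B ^ 2 / 2) + 6 * B, ?_, ?_⟩
  · have := M.c_pos; positivity
  intro i θ o hθ ho
  obtain ⟨x, r, y, z⟩ := o
  obtain ⟨h1, h2, h3, h4, h5, h6, h7⟩ := ho
  have e1 := hR _ θ hθ h5
  have e2 := hJ _ θ hθ h5
  have hc := M.c_pos
  have e3 : (0 : ℝ) ≤ B + B ^ 2 / 2 := by positivity
  cases i
  · have a1 := abs_netTransfer_le h1 h2
    have a2 := abs_netTransfer_le h3 h4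
    have a3 := abs_netTransfer_le h6 h7
    simp only [stagePayoff, uS] at *
    rw [abs_le] at *
    constructor <;> linarith [a1.1, a1.2, a2.1, a2.2, a3.1, a3.2, e1.1, e1.2, e2.1, e2.2]
  · have a1 := abs_netTransfer_le h2 h1
    have a2 := abs_netTransfer_le h4 h3
    have a3 := abs_netTransfer_le h7 h6
    simp only [stagePayoff] at *
    rw [abs_le] at *
    constructor <;> linarith [a1.1, a1.2, a2.1, a2.2, a3.1, a3.2, e1.1, e1.2, e2.1, e2.2]

theorem measurable_expStage (σ : Profile) (i : Player) (t : ℕ) :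
    ∀ n : ℕ, Measurable (M.expStage σ i t n) := by
  induction t with
  | zero =>
    intro n
    have h : Measurable fun z : Hist n × ℝ => M.stagePayoff i z.2 (σ.play z.1 z.2) :=
      (M.measurable_stagePayoff i).comp (measurable_snd.prodMk σ.measurable_play)
    exact h.stronglyMeasurable.integral_prod_right.measurable
  | succ t ih =>
    intro n
    have h : Measurable fun z : Hist n × ℝ =>
        M.expStage σ i t (n + 1) (extend z.1 (σ.play z.1 z.2)) :=
      (ih (n + 1)).comp (measurable_extend.comp (measurable_fst.prodMk σ.measurable_play))
    exact h.stronglyMeasurable.integral_prod_right.measurable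

theorem abs_integral_prior_le {g : ℝ → ℝ} {K : ℝ}
    (h : ∀ θ ∈ Set.Icc (0 : ℝ) 1, |g θ| ≤ K) : |∫ θ, g θ ∂M.prior| ≤ K := by
  have := norm_integral_le_of_norm_le_const (μ := M.prior) (f := g) (C := K)
    (M.prior_ae_mem.mono h)
  simpa using this

theorem exists_bound_expStage (σ : Profile) : ∃ K : ℝ, 0 ≤ K ∧ ∀ (i : Player) (t n : ℕ)
    (h : Hist n), |M.expStage σ i t n h| ≤ K := by
  obtain ⟨B, hB⟩ := σ.exists_bound_play
  obtain ⟨K, hK0, hK⟩ := M.exists_bound_stagePayoff B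
  refine ⟨K, hK0, fun i t => ?_⟩
  induction t with
  | zero => exact fun n h => M.abs_integral_prior_le fun θ hθ => hK i θ _ hθ (hB n h θ)
  | succ t ih => exact fun n h => M.abs_integral_prior_le fun θ _ => ih _ _

section Value

variable {δ : ℝ} (σ : Profile) (i : Player)

theorem summable_value (h0 : 0 ≤ δ) (h1 : δ < 1) {n : ℕ} (h : Hist n) :
    Summable fun t : ℕ => δ ^ t * M.expStage σ i t n h := by
  obtain ⟨K, hK0, hK⟩ := M.exists_bound_expStage σ
  refine Summable.of_norm_bounded ((summable_geometric_of_lt_one h0 h1).mul_right K) fun t => ?_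
  rw [norm_mul, norm_pow, Real.norm_of_nonneg h0]
  exact mul_le_mul_of_nonneg_left (hK i t n h) (pow_nonneg h0 t)

theorem exists_bound_value (h0 : 0 ≤ δ) (h1 : δ < 1) : ∃ K : ℝ, 0 ≤ K ∧ ∀ (i : Player) (n : ℕ)
    (h : Hist n), |M.value δ σ i h| ≤ K := by
  obtain ⟨K, hK0, hK⟩ := M.exists_bound_expStage σ
  refine ⟨K, hK0, fun i n h => ?_⟩
  have hs := (hasSum_geometric_of_lt_one h0 h1).mul_right K
  have : ‖∑' t : ℕ, δ ^ t * M.expStage σ i t n h‖ ≤ (1 - δ)⁻¹ * K := by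
    refine tsum_of_norm_bounded hs fun t => ?_
    rw [norm_mul, norm_pow, Real.norm_of_nonneg h0]
    exact mul_le_mul_of_nonneg_left (hK i t n h) (pow_nonneg h0 t)
  have h2 : 0 < 1 - δ := by linarith
  unfold value
  rw [abs_mul, abs_of_pos h2]
  calc _ ≤ (1 - δ) * ((1 - δ)⁻¹ * K) := mul_le_mul_of_nonneg_left this h2.le
    _ = K := by field_simp

theorem measurable_value (h0 : 0 ≤ δ) (h1 : δ < 1) (n : ℕ) :
    Measurable fun h : Hist n => M.value δ σ i h := by
  refine Measurable.const_mul ?_ _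
  refine measurable_of_tendsto_metrizable (f := fun (N : ℕ) (h : Hist n) =>
    ∑ t ∈ Finset.range N, δ ^ t * M.expStage σ i t n h) (fun N => ?_) ?_
  · exact Finset.measurable_fun_sum _ fun t _ => (M.measurable_expStage σ i t n).const_mul _
  · rw [tendsto_pi_nhds]
    exact fun h => (M.summable_value σ i h0 h1 h).hasSum.tendsto_sum_nat

theorem integrable_total (h0 : 0 ≤ δ) (h1 : δ < 1) {ν : Measure ℝ} [IsFiniteMeasure ν]
    (hν : ∀ᵐ θ ∂ν, θ ∈ Set.Icc (0 : ℝ) 1) {n : ℕ} (h : Hist n)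
    {o : ℝ → Outcome} (ho : Measurable o) {B : ℝ≥0} (hB : ∀ θ, OutLE B (o θ)) :
    Integrable (fun θ => M.total δ σ i h θ (o θ)) ν := by
  obtain ⟨K, hK0, hK⟩ := M.exists_bound_value σ h0 h1
  obtain ⟨K', hK0', hK'⟩ := M.exists_bound_stagePayoff B
  refine integrable_of_bound hν ?_ ((1 - δ) * K' + δ * K) fun θ hθ => ?_
  · exact (((M.measurable_stagePayoff i).comp (measurable_id.prodMk ho)).const_mul _).add
      (((M.measurable_value σ i h0 h1 (n + 1)).comp
        (measurable_extend.comp (measurable_const.prodMk ho))).const_mul _)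
  · unfold total
    refine (abs_add_le _ _).trans (add_le_add ?_ ?_)
    · rw [abs_mul, abs_of_nonneg (by linarith)]
      exact mul_le_mul_of_nonneg_left (hK' i θ _ hθ (hB θ)) (by linarith)
    · rw [abs_mul, abs_of_nonneg h0]
      exact mul_le_mul_of_nonneg_left (hK i _ _) h0

/-- The recursive form of the payoff. Geometric domination lets the sum over periods pass through
the expectation over the current state. -/
theorem value_eq_integral_total (h0 : 0 ≤ δ) (h1 : δ < 1) {n : ℕ} (h : Hist n) :
    M.value δ σ i h = ∫ θ, M.total δ σ i h θ (σ.play h θ) ∂M.prior := by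
  obtain ⟨B, hB⟩ := σ.exists_bound_play
  obtain ⟨K, hK0, hK⟩ := M.exists_bound_expStage σ
  obtain ⟨K', hK0', hK'⟩ := M.exists_bound_stagePayoff B
  have hplay : Measurable (σ.play h) := σ.measurable_play.comp (measurable_const.prodMk measurable_id)
  have i1 : Integrable (fun θ => M.stagePayoff i θ (σ.play h θ)) M.prior :=
    M.integrable_prior ((M.measurable_stagePayoff i).comp (measurable_id.prodMk hplay)) K'
      fun θ hθ => hK' i θ _ hθ (hB n h θ)
  have hm : ∀ t, Measurable fun θ => M.expStage σ i t (n + 1) (extend h (σ.play h θ)) := fun t =>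
    (M.measurable_expStage σ i t (n + 1)).comp (measurable_extend.comp (measurable_const.prodMk hplay))
  have i2 : ∀ t, Integrable (fun θ => δ ^ t * M.expStage σ i t (n + 1) (extend h (σ.play h θ)))
      M.prior := fun t =>
    (M.integrable_prior (hm t) K fun θ _ => hK i t _ _).const_mul _
  have i3 : Integrable (fun θ => M.value δ σ i (extend h (σ.play h θ))) M.prior := by
    obtain ⟨K2, _, hK2⟩ := M.exists_bound_value σ h0 h1
    exact M.integrable_prior ((M.measurable_value σ i h0 h1 (n + 1)).comp
      (measurable_extend.comp (measurable_const.prodMk hplay))) K2 fun θ _ => hK2 i _ _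
  have hsum : HasSum (fun t => ∫ θ, δ ^ t * M.expStage σ i t (n + 1) (extend h (σ.play h θ)) ∂M.prior)
      (∫ θ, ∑' t, δ ^ t * M.expStage σ i t (n + 1) (extend h (σ.play h θ)) ∂M.prior) := by
    refine hasSum_integral_of_summable_integral_norm i2 ?_
    refine Summable.of_nonneg_of_le (fun t => integral_nonneg fun θ => norm_nonneg _) (fun t => ?_)
      ((summable_geometric_of_lt_one h0 h1).mul_right K)
    have : ∫ θ, ‖δ ^ t * M.expStage σ i t (n + 1) (extend h (σ.play h θ))‖ ∂M.prior ≤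
        ∫ _, δ ^ t * K ∂M.prior := by
      refine integral_mono (i2 t).norm (integrable_const _) fun θ => ?_
      simp only
      rw [norm_mul, norm_pow, Real.norm_of_nonneg h0]
      exact mul_le_mul_of_nonneg_left (hK i t _ _) (pow_nonneg h0 t)
    simpa using this
  have e1 : M.value δ σ i h = (1 - δ) * (M.expStage σ i 0 n h +
      ∑' t, δ ^ (t + 1) * M.expStage σ i (t + 1) n h) := by
    unfold value
    rw [(M.summable_value σ i h0 h1 h).tsum_eq_zero_add]; simp
  have e2 : ∑' t, δ ^ (t + 1) * M.expStage σ i (t + 1) n h =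
      δ * ∫ θ, ∑' t, δ ^ t * M.expStage σ i t (n + 1) (extend h (σ.play h θ)) ∂M.prior := by
    rw [← hsum.tsum_eq, ← tsum_mul_left]
    congr 1; ext t
    rw [integral_const_mul]
    change δ ^ (t + 1) * ∫ θ, M.expStage σ i t (n + 1) (extend h (σ.play h θ)) ∂M.prior = _
    ring
  have e3 : ∀ θ, M.total δ σ i h θ (σ.play h θ) = (1 - δ) * M.stagePayoff i θ (σ.play h θ) +
      δ * M.value δ σ i (extend h (σ.play h θ)) := fun θ => rfl
  simp_rw [e3]
  rw [integral_add (i1.const_mul _) (i3.const_mul _), integral_const_mul, integral_const_mul, e1, e2]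
  unfold value
  rw [integral_const_mul]
  unfold expStage
  ring

/-- If playing one period and receiving `v` afterwards is worth at most `v`, then playing forever
is worth at most `v`. -/
theorem value_le_of_oneShot (h0 : 0 ≤ δ) (h1 : δ < 1) (v : ∀ n, Hist n → ℝ)
    (hv : ∀ n, Measurable (v n)) {K : ℝ} (hK : ∀ n h, |v n h| ≤ K)
    (hone : ∀ n (h : Hist n), ∫ θ, ((1 - δ) * M.stagePayoff i θ (σ.play h θ) +
      δ * v (n + 1) (extend h (σ.play h θ))) ∂M.prior ≤ v n h) {n : ℕ} (h : Hist n) :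
    M.value δ σ i h ≤ v n h := by
  obtain ⟨B, hB⟩ := σ.exists_bound_play
  obtain ⟨K1, hK1, hval⟩ := M.exists_bound_value σ h0 h1
  obtain ⟨K', hK0', hK'⟩ := M.exists_bound_stagePayoff B
  -- Unrolling $j$ periods leaves a discrepancy only in the far future, where it is bounded and
  -- discounted by $\delta^j$. This is the one-shot deviation principle for bounded payoffs.
  have key : ∀ j n (h : Hist n), M.value δ σ i h ≤ v n h + δ ^ j * (K1 + K) := by
    intro j
    induction j with
    | zero =>
      intro n h
      have := (abs_le.1 (hK n h)).1
      have := (abs_le.1 (hval i n h)).2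
      simp; linarith
    | succ j ih =>
      intro n h
      have hplay : Measurable (σ.play h) :=
        σ.measurable_play.comp (measurable_const.prodMk measurable_id)
      have i1 : Integrable (fun θ => M.stagePayoff i θ (σ.play h θ)) M.prior :=
        M.integrable_prior ((M.measurable_stagePayoff i).comp (measurable_id.prodMk hplay)) K'
          fun θ hθ => hK' i θ _ hθ (hB n h θ)
      have i2 : Integrable (fun θ => v (n + 1) (extend h (σ.play h θ))) M.prior :=
        M.integrable_prior ((hv _).comp (measurable_extend.comp (measurable_const.prodMk hplay))) K
          fun θ _ => hK _ _
      have i3 : Integrable (fun θ => (1 - δ) * M.stagePayoff i θ (σ.play h θ) +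
          δ * v (n + 1) (extend h (σ.play h θ))) M.prior :=
        (i1.const_mul (1 - δ)).add (i2.const_mul δ)
      rw [M.value_eq_integral_total σ i h0 h1]
      calc _ ≤ ∫ θ, (((1 - δ) * M.stagePayoff i θ (σ.play h θ) +
            δ * v (n + 1) (extend h (σ.play h θ))) + δ ^ (j + 1) * (K1 + K)) ∂M.prior := by
            refine integral_mono (M.integrable_total σ i h0 h1 M.prior_ae_mem h hplay (hB n h))
              (i3.add (integrable_const _)) fun θ => ?_
            have := mul_le_mul_of_nonneg_left (ih _ (extend h (σ.play h θ))) h0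
            simp only [total, pow_succ]
            linarith
        _ = (∫ θ, ((1 - δ) * M.stagePayoff i θ (σ.play h θ) +
            δ * v (n + 1) (extend h (σ.play h θ))) ∂M.prior) + δ ^ (j + 1) * (K1 + K) := by
            rw [integral_add i3 (integrable_const _)]; simp
        _ ≤ _ := by have := hone n h; linarith
  have hlim : Tendsto (fun j : ℕ => v n h + δ ^ j * (K1 + K)) atTop (𝓝 (v n h + 0 * (K1 + K))) :=
    tendsto_const_nhds.add ((tendsto_pow_atTop_nhds_zero_of_lt_one h0 h1).mul_const _)
  rw [zero_mul, add_zero] at hlim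
  exact ge_of_tendsto' hlim fun j => key j n h

end Value

end Model
end RelComm

/-! ### From equilibrium decision rules to finite message rules. -/

namespace RelComm

/-- A function with subgradients `d` grows at least as fast as the integral of `d`. -/
theorem add_integral_le_of_subgradient {T d : ℝ → ℝ} (hd : MonotoneOn d (Set.Icc 0 1))
    (h : ∀ θ ∈ Set.Icc (0 : ℝ) 1, ∀ θ' ∈ Set.Icc (0 : ℝ) 1, T θ' + d θ' * (θ - θ') ≤ T θ)
    {θ : ℝ} (hθ : θ ∈ Set.Icc (0 : ℝ) 1) : T 0 + ∫ t in (0 : ℝ)..θ, d t ≤ T θ := by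
  -- Summing the subgradient inequality over equal steps bounds the growth of $T$ below by a left
  -- Riemann sum. By monotonicity of $d$ the integral exceeds that sum by at most
  -- $\theta(d(\theta)-d(0))/n$; no regularity of $T$ is used.
  have key : ∀ N : ℕ, T 0 + ∫ t in (0 : ℝ)..θ, d t ≤ T θ + (θ * (d θ - d 0)) * (1 / ((N : ℝ) + 1)) := by
    intro N
    set n : ℕ := N + 1 with hn
    have hn0 : (0 : ℝ) < n := by positivity
    have hmem : ∀ x ∈ Set.Icc (0 : ℝ) n, x * (θ / n) ∈ Set.Icc (0 : ℝ) 1 := by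
      intro x hx
      have h1 : 0 ≤ θ / n := div_nonneg hθ.1 hn0.le
      refine ⟨mul_nonneg hx.1 h1, ?_⟩
      calc x * (θ / n) ≤ n * (θ / n) := mul_le_mul_of_nonneg_right hx.2 h1
        _ = θ := by field_simp
        _ ≤ 1 := hθ.2
    have hf : MonotoneOn (fun x : ℝ => d (x * (θ / n))) (Set.Icc (0 : ℝ) (0 + (n : ℕ))) := by
      intro x hx z hz hxz
      rw [zero_add] at hx hz
      exact hd (hmem x hx) (hmem z hz) (mul_le_mul_of_nonneg_right hxz (div_nonneg hθ.1 hn0.le))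
    have h1 := hf.integral_le_sum
    have h2 : ∀ j ≤ n, T 0 + (θ / n) * ∑ i ∈ Finset.range j, d (i * (θ / n)) ≤ T (j * (θ / n)) := by
      intro j
      induction j with
      | zero => intro _; simp
      | succ j ih =>
        intro hj
        have a1 := ih (by omega)
        have m1 : ((j : ℕ) : ℝ) ∈ Set.Icc (0 : ℝ) n := ⟨by positivity, by exact_mod_cast (by omega)⟩
        have m2 : ((j + 1 : ℕ) : ℝ) ∈ Set.Icc (0 : ℝ) n := ⟨by positivity, by exact_mod_cast hj⟩
        have a2 := h _ (hmem _ m2) _ (hmem _ m1)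
        rw [Finset.sum_range_succ, mul_add]
        have : ((j + 1 : ℕ) : ℝ) * (θ / n) - j * (θ / n) = θ / n := by push_cast; ring
        rw [this] at a2
        linarith
    have h3 := h2 n le_rfl
    have e1 : (n : ℝ) * (θ / n) = θ := by field_simp
    rw [e1] at h3
    -- The right and left Riemann sums differ only in their end terms.
    have h4 : ∑ i ∈ Finset.range n, d (((0 : ℝ) + (i + 1 : ℕ)) * (θ / n)) =
        ∑ i ∈ Finset.range n, d (i * (θ / n)) + (d θ - d 0) := by
      have := Finset.sum_range_succ (fun i : ℕ => d ((i : ℝ) * (θ / n))) n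
      have t2 := Finset.sum_range_succ' (fun i : ℕ => d ((i : ℝ) * (θ / n))) n
      simp only [e1] at this
      simp only [zero_add]
      simp only [Nat.cast_zero, zero_mul] at t2
      linarith
    rw [h4] at h1
    have e2 : (θ / n) * ∫ x in (0 : ℝ)..(0 + (n : ℕ)), d (x * (θ / n)) = ∫ t in (0 : ℝ)..θ, d t := by
      have := intervalIntegral.smul_integral_comp_mul_right (a := 0) (b := 0 + (n : ℝ)) d (θ / n)
      rw [smul_eq_mul] at this
      rw [this, zero_mul, zero_add, e1]
    have h5 := mul_le_mul_of_nonneg_left h1 (div_nonneg hθ.1 hn0.le)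
    rw [e2] at h5
    have e3 : (N : ℝ) + 1 = n := by rw [hn]; push_cast; ring
    rw [e3]
    have e4 : θ / n * (∑ i ∈ Finset.range n, d (i * (θ / n)) + (d θ - d 0)) =
      θ / n * ∑ i ∈ Finset.range n, d (i * (θ / n)) + θ * (d θ - d 0) * (1 / n) := by ring
    linarith
  have hlim := (tendsto_one_div_add_atTop_nhds_zero_nat (𝕜 := ℝ)).const_mul (θ * (d θ - d 0))
  have := hlim.const_add (T θ)
  rw [mul_zero, add_zero] at this
  exact ge_of_tendsto' this key

/-- The message rule that reports a bounded monotone decision up to an error of `1 / N`. -/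
noncomputable def floorRule (d : ℝ → ℝ) (hd : Measurable d) (hm : MonotoneOn d (Set.Icc 0 1))
    (B : ℝ) (hB : ∀ θ, |d θ| ≤ B) (N : ℕ) : Rule where
  msg θ := ⌊(d θ + B) * N⌋₊
  measurable_msg := Nat.measurable_floor.comp ((hd.add_const B).mul_const _)
  mono θ h θ' h' hle := Nat.floor_mono
    (mul_le_mul_of_nonneg_right (by have := hm h h' hle; linarith) (Nat.cast_nonneg _))
  bdd := ⟨⌊(B + B) * N⌋₊, fun θ => Nat.floor_mono
    (mul_le_mul_of_nonneg_right (by have := (abs_le.1 (hB θ)).2; linarith) (Nat.cast_nonneg _))⟩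

namespace Model

variable (M : Model)

theorem setIntegral_cell (m : Rule) (k : ℕ) :
    ∫ θ in m.cell k, θ ∂M.prior = m.y M k * M.prior.real (m.cell k) := by
  have h := m.integral_mul_id M (fun j => if j = k then 1 else 0)
  have e : ∀ g : ℝ → ℝ, ∫ θ, (if m.msg θ = k then (1 : ℝ) else 0) * g θ ∂M.prior =
      ∫ θ in m.cell k, g θ ∂M.prior := by
    intro g
    rw [← integral_indicator (m.measurableSet_cell k)]
    refine integral_congr_ae ?_
    filter_upwards [M.prior_ae_mem] with θ hθ
    by_cases hk : m.msg θ = k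
    · rw [Set.indicator_of_mem (show θ ∈ m.cell k from ⟨hθ, hk⟩)]; simp [hk]
    · rw [Set.indicator_of_notMem (fun hc : θ ∈ m.cell k => hk hc.2)]; simp [hk]
  rw [e, e] at h
  rw [h, setIntegral_congr_fun (m.measurableSet_cell k) (g := fun _ => m.y M k)
    (fun θ hθ => by simp only [Rule.Y, hθ.2])]
  simp [mul_comm]

/-- The data of a decision rule implemented in some period of an equilibrium: the decision is a
monotone function of the state, and differs from the receiver's preferred one by at most `s`. -/
structure Implementable (s : ℝ) (d yhat : ℝ → ℝ) (B : ℝ) : Prop where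
  measurable_d : Measurable d
  measurable_yhat : Measurable yhat
  yhat_mem : ∀ θ, yhat θ ∈ Set.Icc (0 : ℝ) 1
  mono : MonotoneOn d (Set.Icc 0 1)
  bound : ∀ θ, |d θ| ≤ B
  enforce : ∀ θ, |d θ - M.rhoR (yhat θ)| ≤ s
  cond : ∀ E : Set ℝ, MeasurableSet E →
    ∫ θ in d ⁻¹' E, θ ∂M.prior = ∫ θ in d ⁻¹' E, yhat θ ∂M.prior

section

variable {M} {s B : ℝ} {d yhat : ℝ → ℝ}

theorem Implementable.floor_bounds (I : M.Implementable s d yhat B) {N : ℕ} (hN : 0 < N) (θ : ℝ) :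
    (⌊(d θ + B) * N⌋₊ : ℝ) / N - B ≤ d θ ∧ d θ ≤ (⌊(d θ + B) * N⌋₊ : ℝ) / N - B + 1 / N := by
  have hN' : (0 : ℝ) < N := by exact_mod_cast hN
  have h0 : 0 ≤ (d θ + B) * N :=
    mul_nonneg (by have := (abs_le.1 (I.bound θ)).1; linarith) hN'.le
  have h1 := Nat.floor_le h0
  have h2 := Nat.lt_floor_add_one ((d θ + B) * N)
  constructor
  · rw [sub_le_iff_le_add, div_le_iff₀ hN']; exact h1
  · have : d θ + B ≤ ((⌊(d θ + B) * N⌋₊ : ℝ) + 1) / N := by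
      rw [le_div_iff₀ hN']; exact h2.le
    rw [add_div] at this; linarith

/-- The receiver's preferred decision is affine in the mean, so averaging the enforcement constraint
over all states with the same rounded decision gives the constraint at the mean of that cell, up to
the rounding error. Null cells are excluded because their belief is conventional. -/
theorem Implementable.cell_bounds (I : M.Implementable s d yhat B) {N : ℕ} (hN : 0 < N) {k : ℕ}
    (hk : M.prior ((floorRule d I.measurable_d I.mono B I.bound N).cell k) ≠ 0) :
    (k : ℝ) / N - B ≤ M.rhoR ((floorRule d I.measurable_d I.mono B I.bound N).y M k) + s ∧
    M.rhoR ((floorRule d I.measurable_d I.mono B I.bound N).y M k) - s ≤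
      (k : ℝ) / N - B + 1 / N := by
  set m := floorRule d I.measurable_d I.mono B I.bound N with hm
  have hp : 0 < M.prior.real (m.cell k) := ENNReal.toReal_pos hk (measure_ne_top _ _)
  have hy := M.setIntegral_cell m k
  have hE : MeasurableSet {x : ℝ | ⌊(x + B) * N⌋₊ = k} := by
    have : Measurable fun x : ℝ => ⌊(x + B) * N⌋₊ :=
      Nat.measurable_floor.comp ((measurable_id.add_const B).mul_const _)
    exact this (measurableSet_singleton k)
  -- Up to a null set the cell is an event about the decision, to which `cond` applies.
  have hae : (m.cell k : Set ℝ) =ᵐ[M.prior] d ⁻¹' {x : ℝ | ⌊(x + B) * N⌋₊ = k} := by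
    filter_upwards [M.prior_ae_mem] with θ hθ
    exact propext ⟨fun h => h.2, fun h => ⟨hθ, h⟩⟩
  have hc := I.cond _ hE
  rw [← setIntegral_congr_set hae, ← setIntegral_congr_set hae, hy] at hc
  have hint : Integrable yhat M.prior := M.integrable_prior I.measurable_yhat 1
    fun θ _ => Rule.abs_le_one_of_mem (I.yhat_mem θ)
  have hlin : ∀ q : ℝ, ∫ θ in m.cell k, (M.a * yhat θ + q) ∂M.prior =
      (M.a * m.y M k + q) * M.prior.real (m.cell k) := by
    intro q
    rw [integral_add (hint.integrableOn.const_mul _) (integrable_const _), integral_const_mul, ← hc]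
    simp; ring
  have hconst : ∀ q : ℝ, ∫ _ in m.cell k, q ∂M.prior = q * M.prior.real (m.cell k) := by
    intro q; simp [mul_comm]
  constructor
  · have : ∫ _ in m.cell k, ((k : ℝ) / N - B) ∂M.prior ≤
        ∫ θ in m.cell k, (M.a * yhat θ + (M.b + s)) ∂M.prior := by
      refine setIntegral_mono_on (integrable_const _)
        ((hint.integrableOn.const_mul _).add (integrable_const _)) (m.measurableSet_cell k)
        fun θ hθ => ?_
      have h1 := (I.floor_bounds hN θ).1
      have e : ⌊(d θ + B) * N⌋₊ = k := hθ.2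
      rw [e] at h1
      have := (abs_le.1 (I.enforce θ)).2
      unfold rhoR at this
      linarith
    rw [hlin, hconst] at this
    have := le_of_mul_le_mul_right this hp
    unfold rhoR; linarith
  · have : ∫ θ in m.cell k, (M.a * yhat θ + (M.b - s)) ∂M.prior ≤
        ∫ _ in m.cell k, ((k : ℝ) / N - B + 1 / N) ∂M.prior := by
      refine setIntegral_mono_on ((hint.integrableOn.const_mul _).add (integrable_const _))
        (integrable_const _) (m.measurableSet_cell k) fun θ hθ => ?_
      have h1 := (I.floor_bounds hN θ).2
      have e : ⌊(d θ + B) * N⌋₊ = k := hθ.2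
      rw [e] at h1
      have := (abs_le.1 (I.enforce θ)).1
      unfold rhoR at this
      linarith
    rw [hlin, hconst] at this
    have := le_of_mul_le_mul_right this hp
    unfold rhoR; linarith

theorem ae_cell_ne_zero (m : Rule) : ∀ᵐ θ ∂M.prior, M.prior (m.cell (m.msg θ)) ≠ 0 := by
  have h : ∀ k, ∀ᵐ θ ∂M.prior, θ ∈ m.cell k → M.prior (m.cell k) ≠ 0 := by
    intro k
    by_cases hk : M.prior (m.cell k) = 0
    · have : ∀ᵐ θ ∂M.prior, θ ∉ m.cell k := measure_eq_zero_iff_ae_notMem.1 hk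
      filter_upwards [this] with θ hθ h using absurd h hθ
    · exact Eventually.of_forall fun θ _ => hk
  filter_upwards [ae_all_iff.2 h, M.prior_ae_mem] with θ hθ hmem
  exact hθ _ (m.mem_cell hmem)

theorem Implementable.integrable_uJoint (I : M.Implementable s d yhat B) :
    Integrable (fun θ => uJoint (d θ) θ) M.prior := by
  have hd := I.measurable_d
  refine M.integrable_prior (by unfold uJoint; fun_prop) (B + B ^ 2 / 2) fun θ hθ => ?_
  have h1 := I.bound θ
  have hB : 0 ≤ B := (abs_nonneg _).trans h1
  unfold uJoint
  refine (abs_sub _ _).trans (add_le_add ?_ ?_)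
  · rw [abs_mul]
    exact (mul_le_of_le_one_left (abs_nonneg _) (Rule.abs_le_one_of_mem hθ)).trans h1
  · rw [abs_of_nonneg (by positivity), ← sq_abs (d θ)]
    have := pow_le_pow_left₀ (abs_nonneg _) h1 2
    linarith

/-- The decision rounded down is measurable with respect to a finite monotone rule and respects the
upper limit at the posterior means, so its value is at most `Vsup s`. Rounding costs at most
$(1+B)/N$, which vanishes. -/
theorem Implementable.integral_uJoint_le (I : M.Implementable s d yhat B) :
    ∫ θ, uJoint (d θ) θ ∂M.prior ≤ M.Vsup s := by
  have hB : 0 ≤ B := (abs_nonneg _).trans (I.bound 0)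
  have key : ∀ n : ℕ, ∫ θ, uJoint (d θ) θ ∂M.prior ≤ M.Vsup s + (1 + B) * (1 / ((n : ℝ) + 1)) := by
    intro n
    set N := n + 1 with hNdef
    have hN : 0 < N := by omega
    have hN' : (0 : ℝ) < N := by exact_mod_cast hN
    set m := floorRule d I.measurable_d I.mono B I.bound N with hm
    have e3 : (n : ℝ) + 1 = N := by rw [hNdef]; push_cast; ring
    rw [e3]
    have hz : ∀ θ, ((m.msg θ : ℝ) / N - B ≤ d θ ∧ d θ ≤ (m.msg θ : ℝ) / N - B + 1 / N) :=
      fun θ => I.floor_bounds hN θ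
    have iz : Integrable (fun θ => uJoint ((m.msg θ : ℝ) / N - B) θ) M.prior := by
      have := (m.integrable_mul M (fun k => (k : ℝ) / N - B) measurable_id
        fun θ hθ => Rule.abs_le_one_of_mem hθ).sub
        (m.integrable_comp_msg M fun k => ((k : ℝ) / N - B) ^ 2 / 2)
      refine this.congr (Eventually.of_forall fun θ => ?_)
      simp [uJoint, mul_comm]
    have h1 : ∫ θ, uJoint (d θ) θ ∂M.prior ≤
        ∫ θ, (uJoint ((m.msg θ : ℝ) / N - B) θ + (1 + B) * (1 / N)) ∂M.prior := by
      refine integral_mono_ae I.integrable_uJoint (iz.add (integrable_const _)) ?_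
      filter_upwards [M.prior_ae_mem] with θ hθ
      obtain ⟨z1, z2⟩ := hz θ
      have hb := abs_le.1 (I.bound θ)
      set z := (m.msg θ : ℝ) / N - B
      have hzB : -B ≤ z := by
        have : 0 ≤ (m.msg θ : ℝ) / N := by positivity
        simp only [z]; linarith
      have e : uJoint (d θ) θ = uJoint z θ + (d θ - z) * (θ - (d θ + z) / 2) := by
        unfold uJoint; ring
      rw [e]
      have a1 : 0 ≤ d θ - z := by linarith
      have a2 : θ - (d θ + z) / 2 ≤ 1 + B := by have := hθ.2; linarith
      have a3 : (d θ - z) * (θ - (d θ + z) / 2) ≤ (d θ - z) * (1 + B) :=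
        mul_le_mul_of_nonneg_left a2 a1
      have a4 : (d θ - z) * (1 + B) ≤ (1 / N) * (1 + B) :=
        mul_le_mul_of_nonneg_right (by linarith) (by linarith)
      linarith
    have h2 : ∫ θ, uJoint ((m.msg θ : ℝ) / N - B) θ ∂M.prior ≤ m.V M s := by
      have := m.integral_uJoint_msg M fun k => (k : ℝ) / N - B
      rw [this]
      refine integral_mono_ae (m.integrable_comp_msg M
        fun k => uJoint ((k : ℝ) / N - B) (m.y M k)) (m.integrable_w M s) ?_
      filter_upwards [ae_cell_ne_zero (M := M) m] with θ hθ
      exact M.uJoint_le_w (I.cell_bounds hN hθ).1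
    rw [integral_add iz (integrable_const _)] at h1
    have h3 := M.V_le_Vsup m s
    simp only [integral_const, probReal_univ, one_smul] at h1
    linarith
  have hlim := ((tendsto_one_div_add_atTop_nhds_zero_nat (𝕜 := ℝ)).const_mul (1 + B)).const_add
    (M.Vsup s)
  rw [mul_zero, add_zero] at hlim
  exact ge_of_tendsto' hlim key

theorem Implementable.intervalIntegrable (I : M.Implementable s d yhat B) (x z : ℝ) :
    IntervalIntegrable d volume x z := by
  refine (intervalIntegrable_const (c := B)).mono_fun I.measurable_d.aestronglyMeasurable ?_
  filter_upwards with t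
  exact (I.bound t).trans (le_abs_self B)

theorem measurable_primitive {g : ℝ → ℝ} (hg : ∀ x z, IntervalIntegrable g volume x z) :
    Measurable fun θ => ∫ t in (0 : ℝ)..θ, g t :=
  (intervalIntegral.continuous_primitive hg 0).measurable

theorem integrable_primitive (M : Model) {g : ℝ → ℝ} (hg : ∀ x z, IntervalIntegrable g volume x z)
    {C : ℝ} (hC : ∀ θ, |g θ| ≤ C) :
    Integrable (fun θ => ∫ t in (0 : ℝ)..θ, g t) M.prior := by
  have hC0 : 0 ≤ C := (abs_nonneg _).trans (hC 0)
  refine M.integrable_prior (measurable_primitive hg) C fun θ hθ => ?_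
  have := intervalIntegral.norm_integral_le_of_norm_le_const (a := 0) (b := θ) (f := g) (C := C)
    fun t _ => hC t
  rw [sub_zero] at this
  exact this.trans (mul_le_of_le_one_right hC0 (Rule.abs_le_one_of_mem hθ))

theorem integrable_primitive_comp_msg (M : Model) (m : Rule) (g : ℕ → ℝ) :
    Integrable (fun θ => ∫ t in (0 : ℝ)..θ, g (m.msg t)) M.prior := by
  obtain ⟨C, _, hC⟩ := m.exists_bound g
  exact integrable_primitive M (m.intervalIntegrable_comp_msg g) hC

theorem integral_primitive_affine (M : Model) (m : Rule) (p q : ℝ) :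
    ∫ θ, (∫ t in (0 : ℝ)..θ, (p * m.Y M t + q)) ∂M.prior = p * m.J M + q * M.mu := by
  have hY : ∀ x z, IntervalIntegrable (m.Y M) volume x z :=
    m.intervalIntegrable_comp_msg (m.y M)
  have hY' : Integrable (fun θ => ∫ t in (0 : ℝ)..θ, m.Y M t) M.prior :=
    integrable_primitive_comp_msg M m (m.y M)
  have h1 : ∀ θ, ∫ t in (0 : ℝ)..θ, (p * m.Y M t + q) = p * (∫ t in (0 : ℝ)..θ, m.Y M t) + q * θ := by
    intro θ
    rw [intervalIntegral.integral_add ((hY 0 θ).const_mul p)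
      intervalIntegrable_const, intervalIntegral.integral_const_mul]
    simp [mul_comm]
  simp_rw [h1]
  rw [integral_add (hY'.const_mul p)
    ((integrable_id_of_mem M.prior_ae_mem).const_mul q), integral_const_mul, integral_const_mul]
  rfl

/-- The lower half of the enforcement constraint, through the same rounding: the rent is at least
that of the lowest enforceable decisions under some finite rule, hence at least the one with `Jinf`.
-/
theorem Implementable.le_integral_primitive (I : M.Implementable s d yhat B) :
    M.a * M.Jinf + M.b * M.mu - s * M.mu ≤ ∫ θ, (∫ t in (0 : ℝ)..θ, d t) ∂M.prior := by
  have key : ∀ n : ℕ, M.a * M.Jinf + M.b * M.mu - s * M.mu ≤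
      ∫ θ, (∫ t in (0 : ℝ)..θ, d t) ∂M.prior + M.mu * (1 / ((n : ℝ) + 1)) := by
    intro n
    set N := n + 1 with hNdef
    have hN : 0 < N := by omega
    set m := floorRule d I.measurable_d I.mono B I.bound N with hm
    have e3 : (n : ℝ) + 1 = N := by rw [hNdef]; push_cast; ring
    rw [e3]
    have hae : ∀ᵐ t, t ∈ Set.Icc (0 : ℝ) 1 → M.a * m.Y M t + (M.b - s - 1 / N) ≤ d t := by
      have : ∀ᵐ t ∂(volume.restrict (Set.Icc (0 : ℝ) 1)), M.prior (m.cell (m.msg t)) ≠ 0 :=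
        M.volume_absolutelyContinuous.ae_le (ae_cell_ne_zero (M := M) m)
      rw [ae_restrict_iff' measurableSet_Icc] at this
      filter_upwards [this] with t ht hmem
      have h1 := (I.cell_bounds hN (ht hmem)).2
      have h2 : (m.msg t : ℝ) / N - B ≤ d t := (I.floor_bounds hN t).1
      unfold rhoR at h1
      unfold Rule.Y
      linarith
    have h1 : ∫ θ, (∫ t in (0 : ℝ)..θ, (M.a * m.Y M t + (M.b - s - 1 / N))) ∂M.prior ≤
        ∫ θ, (∫ t in (0 : ℝ)..θ, d t) ∂M.prior := by
      refine integral_mono_ae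
        (integrable_primitive_comp_msg M m fun k => M.a * m.y M k + (M.b - s - 1 / N))
        (integrable_primitive M I.intervalIntegrable I.bound) ?_
      filter_upwards [M.prior_ae_mem] with θ hθ
      refine intervalIntegral.integral_mono_ae_restrict hθ.1
        (m.intervalIntegrable_comp_msg (fun k => M.a * m.y M k + (M.b - s - 1 / N)) 0 θ)
        (I.intervalIntegrable 0 θ) ?_
      refine (ae_restrict_iff' measurableSet_Icc).2 ?_
      filter_upwards [hae] with t ht hmem
      exact ht ⟨hmem.1, hmem.2.trans hθ.2⟩
    rw [integral_primitive_affine] at h1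
    have h2 := mul_le_mul_of_nonneg_left (M.Jinf_le m) M.a_pos.le
    have : M.mu * (1 / (N : ℝ)) = 1 / N * M.mu := mul_comm _ _
    nlinarith
  have hlim := ((tendsto_one_div_add_atTop_nhds_zero_nat (𝕜 := ℝ)).const_mul M.mu).const_add
    (∫ θ, (∫ t in (0 : ℝ)..θ, d t) ∂M.prior)
  rw [mul_zero, add_zero] at hlim
  exact ge_of_tendsto' hlim key

end
end Model
end RelComm

namespace RelComm

/-! ### Deviations -/

/-- The sender's strategy `s` in period `k`, and `s'` in all other periods. -/
def SenderStrategy.splice (k : ℕ) (s s' : SenderStrategy) : SenderStrategy where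
  exAnte n := if n = k then s.exAnte n else s'.exAnte n
  report n := if n = k then s.report n else s'.report n
  exPost n := if n = k then s.exPost n else s'.exPost n
  measurable_exAnte n := by
    split_ifs
    exacts [s.measurable_exAnte n, s'.measurable_exAnte n]
  measurable_report n := by
    split_ifs
    exacts [s.measurable_report n, s'.measurable_report n]
  measurable_exPost n := by
    split_ifs
    exacts [s.measurable_exPost n, s'.measurable_exPost n]
  bounded := by
    obtain ⟨B, hB⟩ := s.bounded
    obtain ⟨B', hB'⟩ := s'.bounded
    refine ⟨max B B', fun n => ?_⟩
    have h1 := le_max_left B B'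
    have h2 := le_max_right B B'
    split_ifs
    · exact ⟨fun x => ((hB n).1 x).mono h1, fun x => ((hB n).2.1 x).mono h1,
        fun x => ((hB n).2.2 x).mono h1⟩
    · exact ⟨fun x => ((hB' n).1 x).mono h2, fun x => ((hB' n).2.1 x).mono h2,
        fun x => ((hB' n).2.2 x).mono h2⟩

theorem exists_bound_outcome (o : Outcome) : ∃ B : ℝ≥0, OutLE B o := by
  obtain ⟨⟨x, x'⟩, ⟨_, p⟩, ⟨q, d⟩, z, z'⟩ := o
  refine ⟨x.1 + x.2 + x'.1 + x'.2 + p.1 + p.2 + q.1 + q.2 + Real.nnabs d + z.1 + z.2 + z'.1 + z'.2,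
    ?_⟩
  have hd : |d| = (Real.nnabs d : ℝ) := (Real.coe_nnabs d).symm
  simp only [OutLE, PayLE, hd, NNReal.coe_le_coe]
  refine ⟨⟨?_, ?_⟩, ⟨?_, ?_⟩, ⟨?_, ?_⟩, ⟨?_, ?_⟩, ?_, ⟨?_, ?_⟩, ⟨?_, ?_⟩⟩ <;>
  · rw [← NNReal.coe_le_coe]
    push_cast
    refine le_of_sub_nonneg ?_
    ring_nf
    positivity

theorem zero_payLE (B : ℝ≥0) : PayLE 0 B := ⟨zero_le, zero_le⟩

/-- The sender's strategy `s` without ex-ante payments. -/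
def SenderStrategy.noExAnte (s : SenderStrategy) : SenderStrategy :=
  { s with
    exAnte := fun _ _ => 0
    measurable_exAnte := fun _ => measurable_const
    bounded := by
      obtain ⟨B, hB⟩ := s.bounded
      exact ⟨B, fun n => ⟨fun _ => zero_payLE B, (hB n).2⟩⟩ }

/-- The sender's strategy `s` without ex-post payments. -/
def SenderStrategy.noExPost (s : SenderStrategy) : SenderStrategy :=
  { s with
    exPost := fun _ _ => 0
    measurable_exPost := fun _ => measurable_const
    bounded := by
      obtain ⟨B, hB⟩ := s.bounded
      exact ⟨B, fun n => ⟨(hB n).1, (hB n).2.1, fun _ => zero_payLE B⟩⟩ }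

/-- The sender's strategy `s`, reporting as if the state were `θ₀`. -/
def SenderStrategy.mimic (s : SenderStrategy) (θ₀ : ℝ) : SenderStrategy :=
  { s with
    report := fun n z => s.report n (z.1, z.2.1, θ₀)
    measurable_report := fun n => (s.measurable_report n).comp
      (measurable_fst.prodMk ((measurable_fst.comp measurable_snd).prodMk measurable_const))
    bounded := by
      obtain ⟨B, hB⟩ := s.bounded
      exact ⟨B, fun n => ⟨(hB n).1, fun _ => (hB n).2.1 _, (hB n).2.2⟩⟩ }

/-- The sender's strategy `s`, with an empty report and without interim payments. -/
def SenderStrategy.silent (s : SenderStrategy) : SenderStrategy :=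
  { s with
    report := fun _ _ => 0
    measurable_report := fun _ => measurable_const
    bounded := by
      obtain ⟨B, hB⟩ := s.bounded
      exact ⟨B, fun n => ⟨(hB n).1, fun _ => zero_payLE B, (hB n).2.2⟩⟩ }

/-- The receiver never pays; she takes decision `d'` in period `k` and `d` in other periods. -/
noncomputable def ReceiverStrategy.noPay (k : ℕ) (d' d : ℝ) : ReceiverStrategy where
  exAnte _ _ := 0
  interim _ _ := 0
  decision n _ := if n = k then d' else d
  exPost _ _ := 0
  measurable_exAnte _ := measurable_const
  measurable_interim _ := measurable_const
  measurable_decision _ := measurable_const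
  measurable_exPost _ := measurable_const
  bounded := by
    refine ⟨Real.toNNReal (max |d'| |d|), fun n => ⟨fun _ => zero_payLE _, fun _ => zero_payLE _,
      fun _ => ?_, fun _ => zero_payLE _⟩⟩
    rw [Real.coe_toNNReal _ (by positivity)]
    split_ifs
    exacts [le_max_left _ _, le_max_right _ _]

namespace Model

variable (M : Model)

/-- Rationality compares whole strategies. Splicing confines a deviation to period $k$, so that
continuation payoffs remain those of the original profile. -/
theorem expStage_splice (s s' : SenderStrategy) (r : ReceiverStrategy) (i : Player) (k t : ℕ) :
    ∀ n (h : Hist n), k < n →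
      M.expStage ⟨s.splice k s', r⟩ i t n h = M.expStage ⟨s', r⟩ i t n h := by
  have hplay : ∀ n (h : Hist n) (θ : ℝ), k < n →
      Profile.play ⟨s.splice k s', r⟩ h θ = Profile.play ⟨s', r⟩ h θ := by
    intro n h θ hn
    have e1 : (s.splice k s').exAnte n = s'.exAnte n := if_neg hn.ne'
    have e2 : (s.splice k s').report n = s'.report n := if_neg hn.ne'
    have e3 : (s.splice k s').exPost n = s'.exPost n := if_neg hn.ne'
    simp only [Profile.play, Profile.playExAnteR, Profile.playReport, Profile.playInterimR,
      Profile.playDecision, Profile.playExPostS, Profile.playExPostR, e1, e2, e3]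
  induction t with
  | zero =>
    intro n h hn
    simp only [expStage, hplay n h _ hn]
  | succ t ih =>
    intro n h hn
    have hn' : k < n + 1 := by omega
    simp only [expStage, hplay n h _ hn, ih (n + 1) _ hn']

theorem total_splice (δ : ℝ) (s s' : SenderStrategy) (r : ReceiverStrategy) (i : Player) {n : ℕ}
    (h : Hist n) (θ : ℝ) (o : Outcome) :
    M.total δ ⟨s.splice n s', r⟩ i h θ o = M.total δ ⟨s', r⟩ i h θ o := by
  unfold total value
  simp_rw [M.expStage_splice s s' r i n _ (n + 1) (extend h o) (Nat.lt_succ_self n)]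

theorem integrable_uR {ν : Measure ℝ} [IsFiniteMeasure ν]
    (hν : ∀ᵐ θ ∂ν, θ ∈ Set.Icc (0 : ℝ) 1) (d : ℝ) : Integrable (M.uR d) ν :=
  ((((integrable_id_of_mem hν).const_mul M.a).add
    (integrable_const M.b)).mul_const d |>.sub (integrable_const (d ^ 2 / 2))).const_mul M.c

theorem integrable_stagePayoff {i : Player} {o : ℝ → Outcome} (ho : Measurable o) {B : ℝ≥0}
    (hB : ∀ θ, OutLE B (o θ)) : Integrable (fun θ => M.stagePayoff i θ (o θ)) M.prior := by
  obtain ⟨K', _, hK'⟩ := M.exists_bound_stagePayoff B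
  exact M.integrable_prior ((M.measurable_stagePayoff i).comp (measurable_id.prodMk ho)) K'
    fun θ hθ => hK' _ θ _ hθ (hB θ)

theorem integrable_stagePayoff_play (σ : Profile) (i : Player) {n : ℕ} (h : Hist n) :
    Integrable (fun θ => M.stagePayoff i θ (σ.play h θ)) M.prior := by
  obtain ⟨B, hB⟩ := σ.exists_bound_play
  exact M.integrable_stagePayoff
    (σ.measurable_play.comp (measurable_const.prodMk measurable_id)) (hB n h)

theorem noPay_stagePayoff (S : SenderStrategy) {k n : ℕ} {d' d : ℝ} (hn : k < n ∨ d' = d)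
    (h : Hist n) (θ : ℝ) :
    M.uR d θ ≤ M.stagePayoff .receiver θ (Profile.play ⟨S, .noPay k d' d⟩ h θ) := by
  have hd : (if n = k then d' else d) = d := by
    split_ifs with h1
    · rcases hn with hn | hn
      · omega
      · exact hn
    · rfl
  simp only [Profile.play, Profile.playExAnteR, Profile.playReport, Profile.playInterimR,
    Profile.playDecision, Profile.playExPostS, Profile.playExPostR, stagePayoff,
    ReceiverStrategy.noPay, netTransfer, hd]
  simp only [Prod.fst_zero, Prod.snd_zero, NNReal.coe_zero]
  refine le_of_sub_nonneg ?_
  ring_nf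
  positivity

/-- By paying nothing and taking the uninformed optimum, the receiver secures `r0` in every period,
whatever the sender does. The disjunction says that the exceptional period $k$ is over or is not
exceptional. -/
theorem r0_le_expStage (S : SenderStrategy) (k : ℕ) (d' : ℝ) (t : ℕ) :
    ∀ n (h : Hist n), (k < n ∨ d' = M.rhoR M.mu) →
      M.r0 ≤ M.expStage ⟨S, .noPay k d' (M.rhoR M.mu)⟩ .receiver t n h := by
  induction t with
  | zero =>
    intro n h hn
    have hst := fun θ => M.noPay_stagePayoff S hn h θ
    generalize Profile.mk S (.noPay k d' (M.rhoR M.mu)) = σ at hst ⊢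
    have hr0 : ∫ θ, M.uR (M.rhoR M.mu) θ ∂M.prior = M.r0 := M.integral_uR M.prior_Icc _
    have hint := M.integrable_stagePayoff_play σ .receiver h
    rw [← hr0, expStage]
    exact integral_mono (M.integrable_uR M.prior_ae_mem _) hint hst
  | succ t ih =>
    intro n h hn
    have ih' := fun h => ih (n + 1) h (hn.imp_left fun h => by omega)
    generalize Profile.mk S (.noPay k d' (M.rhoR M.mu)) = σ at ih' ⊢
    obtain ⟨K, _, hK⟩ := M.exists_bound_expStage σ
    have hplay : Measurable (σ.play h) :=
      σ.measurable_play.comp (measurable_const.prodMk measurable_id)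
    have hint : Integrable (fun θ => M.expStage σ .receiver t (n + 1) (extend h (σ.play h θ)))
        M.prior :=
      M.integrable_prior ((M.measurable_expStage σ .receiver t (n + 1)).comp
        (measurable_extend.comp (measurable_const.prodMk hplay))) K fun θ _ => hK _ _ _ _
    have := integral_mono (integrable_const M.r0) hint fun θ => ih' _
    rw [expStage]
    simpa using this

theorem r0_le_value {δ : ℝ} (h0 : 0 ≤ δ) (h1 : δ < 1) (S : SenderStrategy) {k n : ℕ} {d' : ℝ}
    (h : Hist n) (hn : k < n ∨ d' = M.rhoR M.mu) :
    M.r0 ≤ M.value δ ⟨S, .noPay k d' (M.rhoR M.mu)⟩ .receiver h := by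
  have hst := fun t => M.r0_le_expStage S k d' t n h hn
  generalize Profile.mk S (.noPay k d' (M.rhoR M.mu)) = σ at hst ⊢
  have hs := M.summable_value σ .receiver h0 h1 h
  have hg := (hasSum_geometric_of_lt_one h0 h1).mul_right M.r0
  have := hg.summable.tsum_le_tsum (fun t => mul_le_mul_of_nonneg_left (hst t) (pow_nonneg h0 t)) hs
  rw [hg.tsum_eq] at this
  have h2 : 0 < 1 - δ := by linarith
  calc M.r0 = (1 - δ) * ((1 - δ)⁻¹ * M.r0) := by field_simp
    _ ≤ _ := mul_le_mul_of_nonneg_left this h2.le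

section Equilibrium

variable {M} {δ : ℝ} {σ : Profile} {β : Beliefs}

theorem r0_le_value_of_rational (h0 : 0 ≤ δ) (h1 : δ < 1) (hR : M.ReceiverRational δ σ β) {n : ℕ}
    (h : Hist n) : M.r0 ≤ M.value δ σ .receiver h := by
  have h2 := (hR (.noPay n (M.rhoR M.mu) (M.rhoR M.mu)) n h).1 (σ.S.exAnte n h)
  have h3 := M.r0_le_value h0 h1 σ.S (k := n) (d' := M.rhoR M.mu) h (Or.inr rfl)
  rw [M.value_eq_integral_total _ _ h0 h1] at h3 ⊢
  exact h3.trans h2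

/-- The sender can refuse to make ex-post payments. -/
theorem le_total_playExPostS (h0 : 0 ≤ δ) (h1 : δ < 1) (hS : M.SenderRational δ σ) {U : ℝ}
    (hU : ∀ n (h : Hist n), U ≤ M.value δ σ .sender h) {n : ℕ} (h : Hist n) (x : Pay × Pay)
    (r : Report) (y : Pay × ℝ) {θ : ℝ} (hθ : θ ∈ Set.Icc (0 : ℝ) 1) :
    (1 - δ) * (M.uS y.2 θ - netTransfer x.1 x.2 - netTransfer r.2 y.1) + δ * U ≤
      M.total δ σ .sender h θ (σ.playExPostS (h, x, r) y) := by
  have h2 := (hS (σ.S.noExPost.splice n σ.S) n h).2.2 x r y θ hθ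
  rw [total_splice] at h2
  refine le_trans ?_ h2
  have e : (SenderStrategy.splice n σ.S.noExPost σ.S).exPost n = fun _ => 0 := if_pos rfl
  simp only [Profile.playExPostS, Profile.playExPostR, e]
  unfold total
  refine add_le_add (mul_le_mul_of_nonneg_left ?_ (by linarith))
    (mul_le_mul_of_nonneg_left (hU _ _) h0)
  simp only [stagePayoff, netTransfer]
  simp only [Prod.fst_zero, Prod.snd_zero, NNReal.coe_zero]
  refine le_of_sub_nonneg ?_
  ring_nf
  positivity

/-- The receiver's temptation does not exceed the future surplus. -/
theorem temptation_le (h0 : 0 ≤ δ) (h1 : δ < 1) (hS : M.SenderRational δ σ)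
    (hR : M.ReceiverRational δ σ β) {U W : ℝ}
    (hU : ∀ n (h : Hist n), U ≤ M.value δ σ .sender h)
    (hW : ∀ n (h : Hist n), M.value δ σ .sender h + M.value δ σ .receiver h ≤ W) {n : ℕ}
    (i : Info n) (p : Pay) :
    (1 - δ) * (M.c / 2 * (σ.R.decision n (i, p) - M.rhoR (mean (β.belief n i))) ^ 2) ≤
      δ * (W - U - M.r0) := by
  obtain ⟨h, x, r⟩ := i
  have := β.isMarkov n
  have hsupp := β.support n (h, x, r)
  set ν := β.belief n (h, x, r) with hν
  have hmem := ae_mem_of_measure_eq_one hsupp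
  set y := mean ν
  -- The deviation: the myopic optimum now, the uninformed optimum ever after, and no payments.
  set R' : ReceiverStrategy := .noPay n (M.rhoR y) (M.rhoR M.mu) with hR'
  have h2 := ((hR R' n h).2 x r).2.1 p
  have hδ : 0 ≤ 1 - δ := by linarith
  have low : (1 - δ) * (M.uR (M.rhoR y) y - netTransfer x.2 x.1 - netTransfer p r.2) + δ * M.r0 ≤
      ∫ θ, M.total δ ⟨σ.S, R'⟩ .receiver h θ (Profile.playDecision ⟨σ.S, R'⟩ (h, x, r) p) ∂ν := by
    have e : (1 - δ) * (M.uR (M.rhoR y) y - netTransfer x.2 x.1 - netTransfer p r.2) + δ * M.r0 =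
        ∫ θ, ((1 - δ) * M.uR (M.rhoR y) θ +
          ((1 - δ) * (- netTransfer x.2 x.1 - netTransfer p r.2) + δ * M.r0)) ∂ν := by
      rw [integral_add ((M.integrable_uR hmem _).const_mul _) (integrable_const _),
        integral_const_mul, M.integral_uR hsupp]
      simp; ring
    rw [e]
    obtain ⟨B, hB⟩ := exists_bound_outcome (Profile.playDecision ⟨σ.S, R'⟩ (h, x, r) p)
    refine integral_mono (((M.integrable_uR hmem _).const_mul _).add (integrable_const _))
      (M.integrable_total _ _ h0 h1 hmem h measurable_const fun _ => hB) fun θ => ?_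
    have h3 := M.r0_le_value h0 h1 σ.S (k := n) (d' := M.rhoR y)
      (extend h (Profile.playDecision ⟨σ.S, R'⟩ (h, x, r) p)) (Or.inl (Nat.lt_succ_self n))
    have h4 := mul_le_mul_of_nonneg_left h3 h0
    have h5 : M.uR (M.rhoR y) θ - netTransfer x.2 x.1 - netTransfer p r.2 ≤
        M.stagePayoff .receiver θ (Profile.playDecision ⟨σ.S, R'⟩ (h, x, r) p) := by
      simp only [Profile.playDecision, Profile.playExPostS, Profile.playExPostR, stagePayoff, hR',
        ReceiverStrategy.noPay, netTransfer, if_true]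
      simp only [Prod.fst_zero, Prod.snd_zero, NNReal.coe_zero]
      refine le_of_sub_nonneg ?_
      ring_nf
      positivity
    have h6 := mul_le_mul_of_nonneg_left h5 hδ
    unfold total
    linarith
  -- By obeying, the receiver gets at most the joint continuation payoff minus what the sender can
  -- secure by refusing the ex-post payment. Ex-post transfers cancel in the sum and burned money
  -- only lowers it.
  have up : ∫ θ, M.total δ σ .receiver h θ (σ.playDecision (h, x, r) p) ∂ν ≤
      (1 - δ) * (M.uR (σ.R.decision n ((h, x, r), p)) y - netTransfer x.2 x.1 - netTransfer p r.2) +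
        δ * (W - U) := by
    set d := σ.R.decision n ((h, x, r), p) with hd
    have e : (1 - δ) * (M.uR d y - netTransfer x.2 x.1 - netTransfer p r.2) + δ * (W - U) =
        ∫ θ, ((1 - δ) * M.uR d θ +
          ((1 - δ) * (- netTransfer x.2 x.1 - netTransfer p r.2) + δ * (W - U))) ∂ν := by
      rw [integral_add ((M.integrable_uR hmem _).const_mul _) (integrable_const _),
        integral_const_mul, M.integral_uR hsupp]
      simp; ring
    rw [e]
    obtain ⟨B, hB⟩ := exists_bound_outcome (σ.playDecision (h, x, r) p)
    refine integral_mono (M.integrable_total _ _ h0 h1 hmem h measurable_const fun _ => hB)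
      (((M.integrable_uR hmem _).const_mul _).add (integrable_const _)) fun θ => ?_
    -- The current payoff of the sender appears on both sides and cancels, so any state will do.
    have h3 := le_total_playExPostS h0 h1 hS hU h x r (p, d) (θ := 0) (by simp)
    have h4 := mul_le_mul_of_nonneg_left
      (hW _ (extend h (σ.playDecision (h, x, r) p))) h0
    simp only [Profile.playDecision, ← hd] at h4 ⊢
    simp only [Profile.playExPostS] at h3 h4 ⊢
    set z := σ.S.exPost n ((h, x, r), (p, d))
    simp only [Profile.playExPostR] at h3 h4 ⊢
    set z' := σ.R.exPost n (((h, x, r), (p, d)), z)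
    simp only [total, stagePayoff] at h3 h4 ⊢
    have h7 : 0 ≤ netTransfer z z' + netTransfer z' z := by
      unfold netTransfer
      ring_nf; positivity
    have h8 := mul_nonneg hδ h7
    nlinarith
  have := low.trans (h2.trans up)
  rw [← M.uR_rhoR_sub]
  nlinarith

end Equilibrium

end Model
end RelComm

/-! ### Payoff bounds for the sender and for the pair. -/

namespace RelComm
namespace Model

/-- In state $0$ the lowest decision enforceable at any belief, $b-s$, is the worst one for the
sender. The payoff difference has the factor $d-(b-s)\ge0$; the other factor is nonnegative because
$-b>a-1>a/2$. -/
theorem uS_punish_le {M : Model} (ha : 2 < M.a) (hb : M.a + M.b < 1) {s d y : ℝ}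
    (hd : |d - M.rhoR y| ≤ s) (hy : y ∈ Set.Icc (0 : ℝ) 1) : M.uS (M.b - s) 0 ≤ M.uS d 0 := by
  obtain ⟨h1, h2⟩ := abs_le.1 hd
  unfold rhoR at h1 h2
  have h3 : 0 ≤ M.a * y := mul_nonneg (by linarith) hy.1
  have h4 : M.a * y ≤ M.a := mul_le_of_le_one_right (by linarith) hy.2
  have hc := M.c_pos
  have hc1 := M.c_le_one
  have e : M.uS d 0 - M.uS (M.b - s) 0 =
      (d - (M.b - s)) * (-2 * M.c * M.b - (1 - M.c) * (d + M.b - s)) / 2 := by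
    unfold uS uJoint uR; ring
  have h5 : 0 ≤ (1 - M.c) * (M.a + 2 * M.b - (d + M.b - s)) :=
    mul_nonneg (by linarith) (by linarith)
  have h6 : 0 ≤ M.c * M.a := mul_nonneg hc.le (by linarith)
  have h7 : 0 ≤ -2 * M.c * M.b - (1 - M.c) * (d + M.b - s) := by nlinarith
  have := mul_nonneg (by linarith : 0 ≤ d - (M.b - s)) h7
  linarith

/-- Single crossing: $ca<1$, so higher decisions are worth more to the sender in higher states. -/
theorem uS_sub (M : Model) (d θ θ' : ℝ) :
    M.uS d θ - M.uS d θ' = (1 - M.c * M.a) * d * (θ - θ') := by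
  unfold uS uJoint uR; ring

section Equilibrium

variable {M : Model} {δ : ℝ} {σ : Profile} {β : Beliefs}

/-- The sender can report as another type would. The public outcome is then the same, and only the
current payoff depends on the true state, linearly. Both the monotonicity of decisions and the
information rents follow. -/
theorem sender_subgradient (hS : M.SenderRational δ σ) {n : ℕ} (h : Hist n)
    (x : Pay × Pay) {θ θ' : ℝ} (hθ : θ ∈ Set.Icc (0 : ℝ) 1) :
    M.total δ σ .sender h θ' (σ.playReport h x θ') + (1 - δ) * (1 - M.c * M.a) *
      (σ.playReport h x θ').2.2.1.2 * (θ - θ') ≤ M.total δ σ .sender h θ (σ.playReport h x θ) := by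
  have h2 := (hS ((σ.S.mimic θ').splice n σ.S) n h).2.1 x θ hθ
  rw [total_splice] at h2
  have e1 : (SenderStrategy.splice n (σ.S.mimic θ') σ.S).report n =
      fun z => σ.S.report n (z.1, z.2.1, θ') := if_pos rfl
  have e2 : (SenderStrategy.splice n (σ.S.mimic θ') σ.S).exPost n = σ.S.exPost n := by
    simp [SenderStrategy.splice, SenderStrategy.mimic]
  have e : Profile.playReport ⟨SenderStrategy.splice n (σ.S.mimic θ') σ.S, σ.R⟩ h x θ =
      σ.playReport h x θ' := by
    simp only [Profile.playReport, Profile.playInterimR, Profile.playDecision, Profile.playExPostS,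
      Profile.playExPostR, e1, e2]
  rw [e] at h2
  refine le_trans (le_of_eq ?_) h2
  obtain ⟨x', r, y, z⟩ := σ.playReport h x θ'
  have := M.uS_sub y.2 θ θ'
  simp only [total, stagePayoff]
  linear_combination -(1 - δ) * this

/-- The sender can report nothing and refuse to pay. -/
theorem silent_le (h0 : 0 ≤ δ) (h1 : δ < 1) (hS : M.SenderRational δ σ) {U v : ℝ}
    (hU : ∀ n (h : Hist n), U ≤ M.value δ σ .sender h) {n : ℕ} (h : Hist n) (q : Pay)
    {θ : ℝ} (hθ : θ ∈ Set.Icc (0 : ℝ) 1)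
    (hv : ∀ p : Pay, v ≤ M.uS (σ.R.decision n ((h, (0, q), 0), p)) θ) :
    (1 - δ) * v + δ * U ≤ M.total δ σ .sender h θ (σ.playReport h (0, q) θ) := by
  have h2 := (hS ((σ.S.silent.noExPost).splice n σ.S) n h).2.1 (0, q) θ hθ
  rw [total_splice] at h2
  have e1 : (SenderStrategy.splice n σ.S.silent.noExPost σ.S).report n = fun _ => 0 := if_pos rfl
  have e2 : (SenderStrategy.splice n σ.S.silent.noExPost σ.S).exPost n = fun _ => 0 := if_pos rfl
  refine le_trans ?_ h2
  simp only [Profile.playReport, Profile.playInterimR, Profile.playDecision, Profile.playExPostS,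
      Profile.playExPostR, e1, e2]
  unfold total
  refine add_le_add (mul_le_mul_of_nonneg_left ?_ (by linarith))
    (mul_le_mul_of_nonneg_left (hU _ _) h0)
  refine (hv (σ.R.interim n (h, (0, q), 0))).trans ?_
  simp only [stagePayoff, netTransfer]
  simp only [Prod.fst_zero, Prod.snd_zero, NNReal.coe_zero]
  refine le_of_sub_nonneg ?_
  ring_nf
  positivity

/-- Two opposite mimicking inequalities make the decision monotone. The function `yhat` is the mean
of the receiver's belief after the report; by Bayes it has the same average as the state over each
event about the decision. -/
theorem implementable_of_isEquilibrium (h1 : δ < 1)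
    (hS : M.SenderRational δ σ) (hC : M.Consistent σ.S β) {s : ℝ}
    (hs : ∀ n (i : Info n) (p : Pay),
      |σ.R.decision n (i, p) - M.rhoR (mean (β.belief n i))| ≤ s) {n : ℕ} (h : Hist n)
    (x : Pay × Pay) :
    ∃ yhat B, M.Implementable s (fun θ => (σ.playReport h x θ).2.2.1.2) yhat B := by
  obtain ⟨B, hB⟩ := σ.R.bounded
  have := β.isMarkov n
  set rep : ℝ → Report := fun θ => σ.S.report n (h, x, θ) with hrep
  have mrep : Measurable rep := (σ.S.measurable_report n).comp
    (measurable_const.prodMk (measurable_const.prodMk measurable_id))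
  have minfo : Measurable fun r : Report => ((h, x, r) : Info n) :=
    measurable_const.prodMk (measurable_const.prodMk measurable_id)
  set κ : Kernel Report ℝ := (β.belief n).comap _ minfo with hκ
  have hκp : ∀ r, κ r = β.belief n (h, x, r) := fun r => Kernel.comap_apply _ _ _
  have hκ1 : ∀ r, κ r (Set.Icc (0 : ℝ) 1) = 1 := fun r => by rw [hκp]; exact β.support n _
  set D : Report → ℝ := fun r => σ.R.decision n ((h, x, r), σ.R.interim n (h, x, r)) with hD
  have mD : Measurable D := (σ.R.measurable_decision n).comp
    (minfo.prodMk ((σ.R.measurable_interim n).comp minfo))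
  have mmean : Measurable fun r => mean (κ r) :=
    ((measurable_snd (α := Report) (β := ℝ)).stronglyMeasurable.integral_kernel_prod_right'
      (κ := κ)).measurable
  have mpath : Measurable (fun θ => (σ.playReport h x θ).2.2.1.2) := mD.comp mrep
  refine ⟨fun θ => mean (κ (rep θ)), B, mpath, mmean.comp mrep, fun θ => mean_mem (hκ1 _), ?_,
    fun θ => (hB n).2.2.1 _, fun θ => ?_, ?_⟩
  · intro θ hθ θ' hθ' hle
    rcases hle.eq_or_lt with rfl | hlt
    · exact le_rfl
    have a1 := sender_subgradient hS h x (θ := θ) (θ' := θ') hθ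
    have a2 := sender_subgradient hS h x (θ := θ') (θ' := θ) hθ'
    have hk : 0 < (1 - δ) * (1 - M.c * M.a) := mul_pos (by linarith) (by linarith [M.ca_lt])
    by_contra! hlt'
    have := mul_pos (mul_pos hk (sub_pos.2 hlt')) (sub_pos.2 hlt)
    nlinarith
  · exact hs n (h, x, rep θ) _
  · intro E hE
    have hb : ∀ A : Set ℝ, MeasurableSet A → ∀ B : Set Report, MeasurableSet B →
        M.prior (A ∩ {θ | rep θ ∈ B}) = ∫⁻ θ in {θ | rep θ ∈ B}, κ (rep θ) A ∂M.prior :=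
      fun A hA B hB => (hC n h x).1 A hA B hB
    have hmf : Measurable fun z : Report × ℝ => (D ⁻¹' E).indicator (fun _ => (1 : ℝ)) z.1 * z.2 :=
      ((measurable_const.indicator (mD hE)).comp measurable_fst).mul measurable_snd
    have key := integral_disintegrate mrep κ hb M.prior_ae_mem hmf 1 (fun θ hθ => by
      rw [abs_mul]
      refine mul_le_one₀ ?_ (abs_nonneg _) (Rule.abs_le_one_of_mem hθ)
      by_cases hd : rep θ ∈ D ⁻¹' E
      · simp [Set.indicator_of_mem hd]
      · simp [Set.indicator_of_notMem hd])
    have e : ∀ g : ℝ → ℝ, ∫ θ, (D ⁻¹' E).indicator (fun _ => (1 : ℝ)) (rep θ) * g θ ∂M.prior =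
        ∫ θ in (fun θ => (σ.playReport h x θ).2.2.1.2) ⁻¹' E, g θ ∂M.prior := by
      intro g
      rw [← integral_indicator (mpath hE)]
      congr 1; ext θ
      by_cases hd : D (rep θ) ∈ E
      · rw [Set.indicator_of_mem (show rep θ ∈ D ⁻¹' E from hd), Set.indicator_of_mem, one_mul]
        exact hd
      · rw [Set.indicator_of_notMem (show rep θ ∉ D ⁻¹' E from hd), Set.indicator_of_notMem, zero_mul]
        exact hd
    rw [← e, ← e, key]
    congr 1; ext θ
    exact integral_const_mul (μ := κ (rep θ)) ((D ⁻¹' E).indicator (fun _ => (1 : ℝ)) (rep θ)) fun θ' : ℝ => θ'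

/-- Transfers cancel in the joint payoff and burned money lowers it, so one period is worth at most
the expected joint payoff of an implementable decision rule. -/
theorem joint_value_le (h0 : 0 ≤ δ) (h1 : δ < 1)
    (hS : M.SenderRational δ σ) (hC : M.Consistent σ.S β) {s W : ℝ}
    (hs : ∀ n (i : Info n) (p : Pay),
      |σ.R.decision n (i, p) - M.rhoR (mean (β.belief n i))| ≤ s)
    (hW : ∀ n (h : Hist n), M.value δ σ .sender h + M.value δ σ .receiver h ≤ W)
    {n : ℕ} (h : Hist n) :
    M.value δ σ .sender h + M.value δ σ .receiver h ≤ (1 - δ) * M.Vsup s + δ * W := by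
  obtain ⟨B, hB⟩ := σ.exists_bound_play
  have hplay : Measurable (σ.play h) :=
    σ.measurable_play.comp (measurable_const.prodMk measurable_id)
  have iS := M.integrable_total σ .sender h0 h1 M.prior_ae_mem h hplay (hB n h)
  have iR := M.integrable_total σ .receiver h0 h1 M.prior_ae_mem h hplay (hB n h)
  obtain ⟨yhat, B', I⟩ := implementable_of_isEquilibrium h1 hS hC hs h
    (σ.S.exAnte n h, σ.R.exAnte n (h, σ.S.exAnte n h))
  have iJ : Integrable (fun θ => uJoint (σ.play h θ).2.2.1.2 θ) M.prior := I.integrable_uJoint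
  have hδ : 0 ≤ 1 - δ := by linarith
  have key : ∫ θ, (M.total δ σ .sender h θ (σ.play h θ) + M.total δ σ .receiver h θ (σ.play h θ))
      ∂M.prior ≤ ∫ θ, ((1 - δ) * uJoint (σ.play h θ).2.2.1.2 θ + δ * W) ∂M.prior := by
    refine integral_mono (iS.add iR) ((iJ.const_mul _).add (integrable_const _))
      fun θ => ?_
    have h4 := mul_le_mul_of_nonneg_left (hW _ (extend h (σ.play h θ))) h0
    simp only [total]
    generalize σ.play h θ = o at h4 ⊢
    obtain ⟨x, r, y, z⟩ := o
    have h5 : M.stagePayoff .sender θ (x, r, y, z) + M.stagePayoff .receiver θ (x, r, y, z) ≤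
        uJoint y.2 θ := by
      simp only [stagePayoff, netTransfer, uS]
      refine le_of_sub_nonneg ?_
      ring_nf
      positivity
    have h6 := mul_le_mul_of_nonneg_left h5 hδ
    simp only at h6 ⊢
    linarith
  rw [integral_add iS iR, integral_add (iJ.const_mul _) (integrable_const _),
    integral_const_mul, ← M.value_eq_integral_total σ _ h0 h1,
    ← M.value_eq_integral_total σ _ h0 h1] at key
  have h8 : ∫ θ, uJoint (σ.play h θ).2.2.1.2 θ ∂M.prior ≤ M.Vsup s := I.integral_uJoint_le
  have h9 := mul_le_mul_of_nonneg_left h8 hδ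
  simp only [integral_const, probReal_univ, one_smul] at key
  exact key.trans (add_le_add h9 le_rfl)

/-- The sender can refuse the ex-ante payment. The interim payoff in state $0$ is then at least that
of silence, and in other states it exceeds this by the integral of the subgradients. -/
theorem sender_value_ge (ha : 2 < M.a) (hb : M.a + M.b < 1) (h0 : 0 ≤ δ) (h1 : δ < 1)
    (hS : M.SenderRational δ σ) (hC : M.Consistent σ.S β) {s U : ℝ}
    (hs : ∀ n (i : Info n) (p : Pay),
      |σ.R.decision n (i, p) - M.rhoR (mean (β.belief n i))| ≤ s)
    (hU : ∀ n (h : Hist n), U ≤ M.value δ σ .sender h)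
    {n : ℕ} (h : Hist n) :
    (1 - δ) * M.punish M.Jinf s + δ * U ≤ M.value δ σ .sender h := by
  set x : Pay × Pay := (0, σ.R.exAnte n (h, 0)) with hx
  have hδ : 0 ≤ 1 - δ := by linarith
  have hk : 0 ≤ (1 - δ) * (1 - M.c * M.a) := mul_nonneg hδ (by linarith [M.ca_lt])
  obtain ⟨yhat, B', I⟩ := implementable_of_isEquilibrium h1 hS hC hs h x
  obtain ⟨B0, hB0⟩ := σ.exists_bound_playReport
  obtain ⟨B1, hB1⟩ := exists_payLE x.2
  have hB : ∀ θ, OutLE (max B0 B1) (σ.playReport h x θ) := fun θ =>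
    hB0 n h x θ _ (zero_payLE _) (hB1.mono (le_max_right _ _)) (le_max_left _ _)
  have hplay : Measurable (σ.playReport h x) :=
    σ.measurable_playReport.comp (measurable_const.prodMk (measurable_const.prodMk measurable_id))
  have iT := M.integrable_total σ .sender h0 h1 M.prior_ae_mem h hplay hB
  have h2 := (hS (σ.S.noExAnte.splice n σ.S) n h).1
  simp_rw [total_splice] at h2
  have e1 : (SenderStrategy.splice n σ.S.noExAnte σ.S).exAnte n = fun _ => 0 := if_pos rfl
  have e2 : (SenderStrategy.splice n σ.S.noExAnte σ.S).report n = σ.S.report n := by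
    simp [SenderStrategy.splice, SenderStrategy.noExAnte]
  have e3 : (SenderStrategy.splice n σ.S.noExAnte σ.S).exPost n = σ.S.exPost n := by
    simp [SenderStrategy.splice, SenderStrategy.noExAnte]
  have e : ∀ θ, Profile.play ⟨SenderStrategy.splice n σ.S.noExAnte σ.S, σ.R⟩ h θ =
      σ.playReport h x θ := by
    intro θ
    simp only [Profile.play, Profile.playExAnteR, Profile.playReport, Profile.playInterimR,
      Profile.playDecision, Profile.playExPostS, Profile.playExPostR, e1, e2, e3, hx]
  simp_rw [e] at h2
  rw [← M.value_eq_integral_total σ _ h0 h1] at h2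
  refine le_trans ?_ h2
  have hT0 : (1 - δ) * M.uS (M.b - s) 0 + δ * U ≤ M.total δ σ .sender h 0 (σ.playReport h x 0) := by
    refine silent_le h0 h1 hS hU h _ (by simp) fun p => ?_
    have := β.isMarkov n
    exact uS_punish_le ha hb (hs n _ p) (mean_mem (β.support n _))
  have hsub : ∀ θ ∈ Set.Icc (0 : ℝ) 1, M.total δ σ .sender h 0 (σ.playReport h x 0) +
      (1 - δ) * (1 - M.c * M.a) * (∫ t in (0 : ℝ)..θ, (σ.playReport h x t).2.2.1.2) ≤
      M.total δ σ .sender h θ (σ.playReport h x θ) := by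
    intro θ hθ
    rw [← intervalIntegral.integral_const_mul]
    refine add_integral_le_of_subgradient (T := fun θ => M.total δ σ .sender h θ (σ.playReport h x θ))
      (fun θ hθ θ' hθ' hle => mul_le_mul_of_nonneg_left (I.mono hθ hθ' hle) hk)
      (fun θ hθ θ' _ => sender_subgradient hS h x hθ) hθ
  have iP := (integrable_primitive M I.intervalIntegrable I.bound).const_mul
    ((1 - δ) * (1 - M.c * M.a))
  have h3 := integral_mono_ae ((integrable_const _).add iP) iT
    (M.prior_ae_mem.mono fun θ hθ => hsub θ hθ)
  simp only [Pi.add_apply] at h3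
  rw [integral_add (integrable_const _) iP, integral_const_mul] at h3
  have h4 := mul_le_mul_of_nonneg_left I.le_integral_primitive hk
  simp only [integral_const, probReal_univ, one_smul] at h3
  unfold punish
  linarith

end Equilibrium
end Model
end RelComm

/-! ### The self-sustaining radius of an equilibrium. -/

namespace RelComm
namespace Model

variable {M : Model} {δ : ℝ}

/-- Equilibrium payoffs are confined by a self-sustaining enforcement radius. -/
theorem exists_radius_of_isEquilibrium (ha : 2 < M.a) (hb : M.a + M.b < 1) (h0 : 0 ≤ δ)
    (h1 : δ < 1) {σ : Profile} (hσ : M.IsEquilibrium δ σ) :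
    ∃ s, 0 ≤ s ∧ M.c * s ^ 2 / 2 ≤ δ / (1 - δ) * M.G s ∧ ∀ n (h : Hist n),
      M.value δ σ .sender h + M.value δ σ .receiver h ≤ M.Vsup s ∧
      M.punish M.Jinf s ≤ M.value δ σ .sender h ∧ M.r0 ≤ M.value δ σ .receiver h := by
  obtain ⟨β, hC, hS, hR⟩ := hσ
  obtain ⟨K, hK0, hK⟩ := M.exists_bound_value σ h0 h1
  have hδ : 0 < 1 - δ := by linarith
  have hc := M.c_pos
  -- The extremes run over all histories, on and off the path, because the punishments of a
  -- deviation are played off the path. They are finite because strategies are bounded.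
  set W : ℝ := ⨆ p : (Σ n, Hist n), (M.value δ σ .sender p.2 + M.value δ σ .receiver p.2) with hWdef
  set U : ℝ := ⨅ p : (Σ n, Hist n), M.value δ σ .sender p.2 with hUdef
  have hbW : BddAbove (Set.range fun p : (Σ n, Hist n) =>
      M.value δ σ .sender p.2 + M.value δ σ .receiver p.2) := by
    refine ⟨K + K, ?_⟩
    rintro _ ⟨p, rfl⟩
    exact add_le_add (abs_le.1 (hK _ _ _)).2 (abs_le.1 (hK _ _ _)).2
  have hbU : BddBelow (Set.range fun p : (Σ n, Hist n) => M.value δ σ .sender p.2) := by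
    refine ⟨-K, ?_⟩
    rintro _ ⟨p, rfl⟩
    exact (abs_le.1 (hK _ _ _)).1
  have hne : Nonempty (Σ n, Hist n) := ⟨⟨0, Fin.elim0⟩⟩
  have hW : ∀ n (h : Hist n), M.value δ σ .sender h + M.value δ σ .receiver h ≤ W :=
    fun n h => le_ciSup hbW ⟨n, h⟩
  have hU : ∀ n (h : Hist n), U ≤ M.value δ σ .sender h := fun n h => ciInf_le hbU ⟨n, h⟩
  have htemp := fun n (i : Info n) p => temptation_le h0 h1 hS hR hU hW i p
  have hL : 0 ≤ δ * (W - U - M.r0) := by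
    refine le_trans ?_ (htemp 0 (Fin.elim0, 0, 0) 0)
    positivity
  -- The radius at which the temptation equals the future surplus at these extremes.
  set s := √(2 * (δ * (W - U - M.r0)) / (M.c * (1 - δ))) with hs
  have hs2 : s ^ 2 = 2 * (δ * (W - U - M.r0)) / (M.c * (1 - δ)) := Real.sq_sqrt (by positivity)
  have hs3 : (1 - δ) * (M.c / 2 * s ^ 2) = δ * (W - U - M.r0) := by
    rw [hs2]; field_simp
  have hs0 : 0 ≤ s := Real.sqrt_nonneg _
  have hdec : ∀ n (i : Info n) (p : Pay),
      |σ.R.decision n (i, p) - M.rhoR (mean (β.belief n i))| ≤ s := by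
    intro n i p
    have := htemp n i p
    rw [← hs3] at this
    have := le_of_mul_le_mul_left (le_of_mul_le_mul_left this hδ) (by positivity : 0 < M.c / 2)
    exact abs_le_of_sq_le_sq this hs0
  -- The recursive bound holds at every history, hence for the supremum, and $1-\delta>0$ lets $W$
  -- be cancelled. The infimum is treated alike.
  have hW' : W ≤ M.Vsup s := by
    have : W ≤ (1 - δ) * M.Vsup s + δ * W :=
      ciSup_le fun p => joint_value_le h0 h1 hS hC hdec hW p.2
    nlinarith
  have hU' : M.punish M.Jinf s ≤ U := by
    have : (1 - δ) * M.punish M.Jinf s + δ * U ≤ U :=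
      le_ciInf fun p => sender_value_ge ha hb h0 h1 hS hC hdec hU p.2
    nlinarith
  refine ⟨s, hs0, ?_, fun n h => ⟨(hW n h).trans hW', hU'.trans (hU n h),
    r0_le_value_of_rational h0 h1 hR h⟩⟩
  rw [div_mul_eq_mul_div, le_div_iff₀ hδ]
  have : δ * (W - U - M.r0) ≤ δ * M.G s := by
    refine mul_le_mul_of_nonneg_left ?_ h0
    unfold G; linarith
  linarith

end Model
end RelComm

namespace RelComm
namespace Model

/-! ### Equilibria with two states of play -/

section OneShot

variable (M : Model) {δ : ℝ}

/-- Payoff of one period with continuation payoff `v`. -/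
noncomputable def tot (δ : ℝ) (i : Player) (v : ∀ n, Hist n → ℝ) {n : ℕ} (h : Hist n) (θ : ℝ)
    (o : Outcome) : ℝ := (1 - δ) * M.stagePayoff i θ o + δ * v (n + 1) (extend h o)

theorem integrable_tot (i : Player) {v : ∀ n, Hist n → ℝ} (hv : ∀ n, Measurable (v n)) {K : ℝ}
    (hK : ∀ n h, |v n h| ≤ K) {ν : Measure ℝ} [IsFiniteMeasure ν]
    (hν : ∀ᵐ θ ∂ν, θ ∈ Set.Icc (0 : ℝ) 1) {n : ℕ} (h : Hist n) {o : ℝ → Outcome}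
    (ho : Measurable o) {B : ℝ≥0} (hB : ∀ θ, OutLE B (o θ)) :
    Integrable (fun θ => M.tot δ i v h θ (o θ)) ν := by
  obtain ⟨K', hK0', hK'⟩ := M.exists_bound_stagePayoff B
  refine (Integrable.const_mul ?_ _).add (Integrable.const_mul ?_ _)
  · exact integrable_of_bound hν ((M.measurable_stagePayoff i).comp (measurable_id.prodMk ho)) K'
      fun θ hθ => hK' _ θ _ hθ (hB θ)
  · exact integrable_of_bound hν ((hv _).comp (measurable_extend.comp (measurable_const.prodMk ho)))
      K fun θ _ => hK _ _

theorem value_eq_of_oneShot (σ : Profile) (i : Player) (h0 : 0 ≤ δ) (h1 : δ < 1)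
    (v : ∀ n, Hist n → ℝ) (hv : ∀ n, Measurable (v n)) {K : ℝ} (hK : ∀ n h, |v n h| ≤ K)
    (hone : ∀ n (h : Hist n), ∫ θ, M.tot δ i v h θ (σ.play h θ) ∂M.prior = v n h) {n : ℕ}
    (h : Hist n) : M.value δ σ i h = v n h := by
  obtain ⟨B, hB⟩ := σ.exists_bound_play
  obtain ⟨K1, hK1, hval⟩ := M.exists_bound_value σ h0 h1
  have key : ∀ j n (h : Hist n), |M.value δ σ i h - v n h| ≤ δ ^ j * (K1 + K) := by
    intro j
    induction j with
    | zero =>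
      intro n h
      have := (abs_sub _ _).trans (add_le_add (hval i n h) (hK n h))
      simpa using this
    | succ j ih =>
      intro n h
      have hplay : Measurable (σ.play h) :=
        σ.measurable_play.comp (measurable_const.prodMk measurable_id)
      have i1 := M.integrable_total σ i h0 h1 M.prior_ae_mem h hplay (hB n h)
      have i2 := M.integrable_tot (δ := δ) i hv hK M.prior_ae_mem h hplay (hB n h)
      rw [M.value_eq_integral_total σ i h0 h1, ← hone n h, ← integral_sub i1 i2]
      refine M.abs_integral_prior_le fun θ _ => ?_
      have e : M.total δ σ i h θ (σ.play h θ) - M.tot δ i v h θ (σ.play h θ) =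
          δ * (M.value δ σ i (extend h (σ.play h θ)) - v _ (extend h (σ.play h θ))) := by
        unfold total tot; ring
      rw [e, abs_mul, abs_of_nonneg h0, pow_succ', mul_assoc]
      exact mul_le_mul_of_nonneg_left (ih _ _) h0
  have hlim := (tendsto_pow_atTop_nhds_zero_of_lt_one h0 h1).mul_const (K1 + K)
  rw [zero_mul] at hlim
  have := ge_of_tendsto' hlim fun j => key j n h
  exact sub_eq_zero.1 (abs_eq_zero.1 (le_antisymm this (abs_nonneg _)))

end OneShot

/-- The communication and decision phase of a period. -/
structure Phase (M : Model) where
  rep : ℝ → Report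
  dec : Report → ℝ
  bel : Kernel Report ℝ
  measurable_rep : Measurable rep
  measurable_dec : Measurable dec
  markov : IsMarkovKernel bel
  support : ∀ r, bel r (Set.Icc (0 : ℝ) 1) = 1
  bdd : ∃ B : ℝ≥0, (∀ θ, PayLE (rep θ).2 B) ∧ ∀ r, |dec r| ≤ B
  bayes : ∀ A : Set ℝ, MeasurableSet A → ∀ B : Set Report, MeasurableSet B →
    M.prior (A ∩ {θ | rep θ ∈ B}) = ∫⁻ θ in {θ | rep θ ∈ B}, bel (rep θ) A ∂M.prior
  conc : ∀ θ ∈ Set.Icc (0 : ℝ) 1,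
    bel (rep θ) {θ' | θ' ∈ Set.Icc (0 : ℝ) 1 ∧ rep θ' = rep θ} = 1
  no_burning : ∀ θ, (rep θ).2.2 = 0
  ic : ∀ θ ∈ Set.Icc (0 : ℝ) 1, ∀ r : Report,
    M.uS (dec r) θ - r.2.1 - r.2.2 ≤ M.uS (dec (rep θ)) θ - (rep θ).2.1

namespace Phase

variable {M : Model} (P : M.Phase)

/-- The posterior mean after a report. -/
noncomputable def pm (r : Report) : ℝ := mean (P.bel r)

/-- The sender's payoff in the phase. -/
noncomputable def senderVal : ℝ := ∫ θ, (M.uS (P.dec (P.rep θ)) θ - (P.rep θ).2.1) ∂M.prior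

/-- The receiver's payoff in the phase. -/
noncomputable def recvVal : ℝ := ∫ θ, (M.uR (P.dec (P.rep θ)) θ + (P.rep θ).2.1) ∂M.prior

end Phase

/-- The ingredients of an equilibrium in which play is in one of two states: in the first, the
sender is kept at `vSS`; in the second, the receiver is kept at `vRR`. The phases `0`, `1`, `2` are
played after ex-ante compliance, after a deviation of the sender, and after one of the receiver. -/
structure Scheme (M : Model) (δ : ℝ) where
  phase : Fin 3 → M.Phase
  payS : ℝ≥0
  payR : ℝ≥0
  vSS : ℝ
  vSR : ℝ
  vRS : ℝ
  vRR : ℝ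
  eqSS : (phase 0).senderVal - payS = vSS
  eqRS : (phase 0).recvVal + payS = vRS
  eqSR : (1 - δ) * ((phase 0).senderVal + payR) + δ * vSS = vSR
  eqRR : (1 - δ) * ((phase 0).recvVal - payR) + δ * vRS = vRR
  punS : (phase 1).senderVal ≤ vSS
  punR : (phase 2).recvVal ≤ vRR
  enforce : ∀ j, j ≠ 2 → ∀ r,
    (1 - δ) * (M.c / 2 * ((phase j).dec r - M.rhoR ((phase j).pm r)) ^ 2) ≤ δ * (vRS - vRR)
  myopic : ∀ r, (phase 2).dec r = M.rhoR ((phase 2).pm r)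

namespace Scheme

variable {M : Model} {δ : ℝ} (Z : M.Scheme δ) (q : Bool)

open Classical in
/-- The phase after the ex-ante payments `x`. -/
noncomputable def phaseIx (s : Bool) (x : Pay × Pay) : Fin 3 :=
  if s then (if x.1 = (Z.payS, 0) then 0 else 1) else (if x.2 = (Z.payR, 0) then 0 else 2)

open Classical in
/-- The next state. -/
noncomputable def next (j : Fin 3) (r : Report) (d : ℝ) : Bool :=
  -- Value `false`, the state in which the receiver is held down, follows only a refusal of the
  -- receiver to pay ex ante or a wrong decision. Otherwise `true` follows, in which the sender is
  -- held down.
  decide (j ≠ 2 ∧ d = (Z.phase j).dec r)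

/-- The current state. -/
noncomputable def state : (n : ℕ) → Hist n → Bool
  | 0, _ => q
  | n + 1, h => Z.next (Z.phaseIx (state n fun i => h i.castSucc) (h (Fin.last n)).1)
      (h (Fin.last n)).2.1 (h (Fin.last n)).2.2.1.2

theorem state_extend {n : ℕ} (h : Hist n) (o : Outcome) :
    Z.state q (n + 1) (extend h o) = Z.next (Z.phaseIx (Z.state q n h) o.1) o.2.1 o.2.2.1.2 := by
  simp [state, extend]

theorem measurable_phaseIx : Measurable fun z : Bool × (Pay × Pay) => Z.phaseIx z.1 z.2 := by
  refine measurable_from_prod_countable_right fun s => ?_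
  cases s
  · have : MeasurableSet {x : Pay × Pay | x.2 = (Z.payR, 0)} :=
      measurable_snd (measurableSet_singleton _)
    simpa [phaseIx] using Measurable.ite this measurable_const measurable_const
  · have : MeasurableSet {x : Pay × Pay | x.1 = (Z.payS, 0)} :=
      measurable_fst (measurableSet_singleton _)
    simpa [phaseIx] using Measurable.ite this measurable_const measurable_const

theorem measurable_next : Measurable fun z : Fin 3 × (Report × ℝ) => Z.next z.1 z.2.1 z.2.2 := by
  refine measurable_from_prod_countable_right fun j => ?_
  refine measurable_to_bool ?_
  have h1 : MeasurableSet {z : Report × ℝ | z.2 = (Z.phase j).dec z.1} :=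
    measurableSet_eq_fun measurable_snd ((Z.phase j).measurable_dec.comp measurable_fst)
  have h2 : MeasurableSet {z : Report × ℝ | j ≠ 2} := MeasurableSet.const _
  convert h2.inter h1 using 1
  ext z
  simp [next]

theorem measurable_state (n : ℕ) : Measurable (Z.state q n) := by
  induction n with
  | zero => exact measurable_const
  | succ n ih =>
    have h1 : Measurable fun h : Hist (n + 1) => (fun i : Fin n => h i.castSucc) :=
      measurable_pi_iff.2 fun i => measurable_pi_apply _
    have h2 : Measurable fun h : Hist (n + 1) => h (Fin.last n) := measurable_pi_apply _
    exact Z.measurable_next.comp ((Z.measurable_phaseIx.comp ((ih.comp h1).prodMk h2.fst)).prodMk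
      (h2.snd.fst.prodMk h2.snd.snd.fst.snd))

theorem measurable_ix (n : ℕ) :
    Measurable fun z : Hist n × (Pay × Pay) => Z.phaseIx (Z.state q n z.1) z.2 :=
  Z.measurable_phaseIx.comp (((Z.measurable_state q n).comp measurable_fst).prodMk measurable_snd)

theorem exists_bound_phase : ∃ B : ℝ≥0, ∀ j, (∀ θ, PayLE ((Z.phase j).rep θ).2 B) ∧
    ∀ r, |(Z.phase j).dec r| ≤ B := by
  choose B hB using fun j => (Z.phase j).bdd
  refine ⟨∑ j, B j, fun j => ?_⟩
  have : B j ≤ ∑ j, B j := Finset.single_le_sum (f := B) (fun _ _ => zero_le) (Finset.mem_univ j)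
  exact ⟨fun θ => ((hB j).1 θ).mono this, fun r => ((hB j).2 r).trans (by exact_mod_cast this)⟩

/-- The sender's equilibrium strategy. -/
noncomputable def senderStrategy : SenderStrategy where
  exAnte n h := if Z.state q n h then (Z.payS, 0) else 0
  report n z := (Z.phase (Z.phaseIx (Z.state q n z.1) z.2.1)).rep z.2.2
  exPost _ _ := 0
  measurable_exAnte n :=
    (measurable_from_top (f := fun b : Bool => if b then (Z.payS, (0 : ℝ≥0)) else 0)).comp
      (Z.measurable_state q n)
  measurable_report n := by
    have h1 : Measurable fun z : Fin 3 × ℝ => (Z.phase z.1).rep z.2 :=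
      measurable_from_prod_countable_right fun j => (Z.phase j).measurable_rep
    exact h1.comp (((Z.measurable_ix q n).comp
      (measurable_fst.prodMk measurable_snd.fst)).prodMk measurable_snd.snd)
  measurable_exPost _ := measurable_const
  bounded := by
    obtain ⟨B, hB⟩ := Z.exists_bound_phase
    refine ⟨max B Z.payS, fun n => ⟨fun h => ?_, fun z => ((hB _).1 _).mono (le_max_left _ _),
      fun _ => zero_payLE _⟩⟩
    split_ifs
    · exact ⟨le_max_right _ _, zero_le⟩
    · exact zero_payLE _

/-- The receiver's equilibrium strategy. -/
noncomputable def receiverStrategy : ReceiverStrategy where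
  exAnte n z := if Z.state q n z.1 then 0 else (Z.payR, 0)
  interim _ _ := 0
  decision n z := (Z.phase (Z.phaseIx (Z.state q n z.1.1) z.1.2.1)).dec z.1.2.2
  exPost _ _ := 0
  measurable_exAnte n :=
    (measurable_from_top (f := fun b : Bool => if b then 0 else (Z.payR, (0 : ℝ≥0)))).comp
      ((Z.measurable_state q n).comp measurable_fst)
  measurable_interim _ := measurable_const
  measurable_decision n := by
    have h1 : Measurable fun z : Fin 3 × Report => (Z.phase z.1).dec z.2 :=
      measurable_from_prod_countable_right fun j => (Z.phase j).measurable_dec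
    exact h1.comp (((Z.measurable_ix q n).comp
      (measurable_fst.fst.prodMk measurable_fst.snd.fst)).prodMk measurable_fst.snd.snd)
  measurable_exPost _ := measurable_const
  bounded := by
    obtain ⟨B, hB⟩ := Z.exists_bound_phase
    refine ⟨max B Z.payR, fun n => ⟨fun h => ?_, fun _ => zero_payLE _,
      fun z => ((hB _).2 _).trans (by exact_mod_cast le_max_left _ _), fun _ => zero_payLE _⟩⟩
    split_ifs
    · exact zero_payLE _
    · exact ⟨le_max_right _ _, zero_le⟩

/-- The equilibrium profile. -/
noncomputable def profile : Profile := ⟨Z.senderStrategy q, Z.receiverStrategy q⟩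

/-- The receiver's beliefs. -/
noncomputable def beliefs : Beliefs where
  belief n :=
    { toFun := fun i => (Z.phase (Z.phaseIx (Z.state q n i.1) i.2.1)).bel i.2.2
      measurable' := by
        have h1 : Measurable fun z : Fin 3 × Report => (Z.phase z.1).bel z.2 :=
          measurable_from_prod_countable_right fun j => (Z.phase j).bel.measurable
        exact h1.comp (((Z.measurable_ix q n).comp
          (measurable_fst.prodMk measurable_snd.fst)).prodMk measurable_snd.snd) }
  isMarkov n := ⟨fun i => (Z.phase (Z.phaseIx (Z.state q n i.1) i.2.1)).markov.isProbabilityMeasure _⟩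
  support n i := (Z.phase _).support _

theorem consistent : M.Consistent (Z.profile q).S (Z.beliefs q) := fun n h x =>
  ⟨(Z.phase (Z.phaseIx (Z.state q n h) x)).bayes, (Z.phase (Z.phaseIx (Z.state q n h) x)).conc⟩

/-- Equilibrium payoffs in the current state. -/
noncomputable def val (i : Player) (n : ℕ) (h : Hist n) : ℝ :=
  match i with
  | .sender => if Z.state q n h then Z.vSS else Z.vSR
  | .receiver => if Z.state q n h then Z.vRS else Z.vRR

theorem measurable_val (i : Player) (n : ℕ) : Measurable (Z.val q i n) := by
  cases i
  · exact (measurable_from_top (f := fun b : Bool => if b then Z.vSS else Z.vSR)).comp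
      (Z.measurable_state q n)
  · exact (measurable_from_top (f := fun b : Bool => if b then Z.vRS else Z.vRR)).comp
      (Z.measurable_state q n)

theorem abs_val_le (i : Player) (n : ℕ) (h : Hist n) :
    |Z.val q i n h| ≤ |Z.vSS| + |Z.vSR| + |Z.vRS| + |Z.vRR| := by
  have := abs_nonneg Z.vSS
  have := abs_nonneg Z.vSR
  have := abs_nonneg Z.vRS
  have := abs_nonneg Z.vRR
  cases i <;> simp only [val] <;> split_ifs <;> linarith

end Scheme
end Model
end RelComm

/-! ### The sender's incentives in the two-state equilibria. -/

namespace RelComm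
namespace Model
namespace Scheme

variable {M : Model} {δ : ℝ} (Z : M.Scheme δ) (q : Bool)

/-- Continuation payoff after the prescribed decision in phase `j`. -/
noncomputable def vNext (i : Player) (j : Fin 3) : ℝ :=
  match i with
  | .sender => if j = 2 then Z.vSR else Z.vSS
  | .receiver => if j = 2 then Z.vRR else Z.vRS

/-- If the receiver obeys after the report actually made, expected or not, the future depends on the
phase alone. Reports and later payments thus have no effect on it, and the static condition `ic`
suffices for the sender. -/
theorem val_extend_obey (i : Player) {n : ℕ} (h : Hist n) (o : Outcome)
    (ho : o.2.2.1.2 = (Z.phase (Z.phaseIx (Z.state q n h) o.1)).dec o.2.1) :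
    Z.val q i (n + 1) (extend h o) = Z.vNext i (Z.phaseIx (Z.state q n h) o.1) := by
  cases i <;> simp only [val, vNext, state_extend, next, ho, and_true] <;>
  by_cases hj : Z.phaseIx (Z.state q n h) o.1 = 2 <;> simp [hj]

theorem integrable_sender (P : M.Phase) :
    Integrable (fun θ => M.uS (P.dec (P.rep θ)) θ - (P.rep θ).2.1) M.prior ∧
    Integrable (fun θ => M.uR (P.dec (P.rep θ)) θ + (P.rep θ).2.1) M.prior := by
  obtain ⟨B, hB, hB'⟩ := P.bdd
  have hd : Measurable fun θ => P.dec (P.rep θ) := P.measurable_dec.comp P.measurable_rep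
  set o : ℝ → Outcome := fun θ => (0, P.rep θ, (0, P.dec (P.rep θ)), 0) with ho
  have mo : Measurable o := measurable_const.prodMk (P.measurable_rep.prodMk
    ((measurable_const.prodMk hd).prodMk measurable_const))
  have hoB : ∀ θ, OutLE B (o θ) := fun θ => ⟨zero_payLE _, zero_payLE _, hB θ, zero_payLE _,
    hB' _, zero_payLE _, zero_payLE _⟩
  constructor
  · refine (M.integrable_stagePayoff (i := .sender) mo hoB).congr (Eventually.of_forall fun θ => ?_)
    simp [ho, stagePayoff, netTransfer, P.no_burning θ]
  · refine (M.integrable_stagePayoff (i := .receiver) mo hoB).congr (Eventually.of_forall fun θ => ?_)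
    simp [ho, stagePayoff, netTransfer]

theorem tot_playReport_le (h1 : δ < 1) (S : SenderStrategy) {n : ℕ} (h : Hist n)
    (x : Pay × Pay) {θ : ℝ} (hθ : θ ∈ Set.Icc (0 : ℝ) 1) :
    M.tot δ .sender (Z.val q .sender) h θ
        (Profile.playReport ⟨S, Z.receiverStrategy q⟩ h x θ) ≤
      M.tot δ .sender (Z.val q .sender) h θ ((Z.profile q).playReport h x θ) := by
  set j := Z.phaseIx (Z.state q n h) x with hj
  have e1 := Z.val_extend_obey q .sender h (Profile.playReport ⟨S, Z.receiverStrategy q⟩ h x θ) rfl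
  have e2 := Z.val_extend_obey q .sender h ((Z.profile q).playReport h x θ) rfl
  unfold tot
  rw [e1, e2]
  refine add_le_add (mul_le_mul_of_nonneg_left ?_ (by linarith)) le_rfl
  have hic := (Z.phase j).ic θ hθ (S.report n (h, x, θ))
  have hnb := (Z.phase j).no_burning θ
  simp only [Profile.playReport, Profile.playInterimR, Profile.playDecision, Profile.playExPostS,
    Profile.playExPostR, stagePayoff, netTransfer, profile, receiverStrategy, senderStrategy, ← hj]
  simp only [Prod.fst_zero, Prod.snd_zero, NNReal.coe_zero, hnb]
  have := (S.exPost n ((h, x, S.report n (h, x, θ)), 0,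
    (Z.phase j).dec (S.report n (h, x, θ)))).1.coe_nonneg
  have := (S.exPost n ((h, x, S.report n (h, x, θ)), 0,
    (Z.phase j).dec (S.report n (h, x, θ)))).2.coe_nonneg
  linarith

theorem tot_playReport_eq {n : ℕ} (h : Hist n) (x : Pay × Pay) (θ : ℝ) :
    M.tot δ .sender (Z.val q .sender) h θ ((Z.profile q).playReport h x θ) =
      (1 - δ) * (M.uS ((Z.phase (Z.phaseIx (Z.state q n h) x)).dec
        ((Z.phase (Z.phaseIx (Z.state q n h) x)).rep θ)) θ -
        ((Z.phase (Z.phaseIx (Z.state q n h) x)).rep θ).2.1 - netTransfer x.1 x.2) +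
      δ * Z.vNext .sender (Z.phaseIx (Z.state q n h) x) := by
  have e2 := Z.val_extend_obey q .sender h ((Z.profile q).playReport h x θ) rfl
  have hnb := (Z.phase (Z.phaseIx (Z.state q n h) x)).no_burning θ
  have e3 : ((Z.profile q).playReport h x θ).1 = x := rfl
  unfold tot
  rw [e2, e3]
  congr 2
  simp only [Profile.playReport, Profile.playInterimR, Profile.playDecision, Profile.playExPostS,
    Profile.playExPostR, stagePayoff, netTransfer, profile, receiverStrategy, senderStrategy]
  simp only [Prod.fst_zero, Prod.snd_zero, NNReal.coe_zero, hnb]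
  ring

theorem integral_tot_playReport {n : ℕ} (h : Hist n) (x : Pay × Pay) :
    ∫ θ, M.tot δ .sender (Z.val q .sender) h θ ((Z.profile q).playReport h x θ) ∂M.prior =
      (1 - δ) * ((Z.phase (Z.phaseIx (Z.state q n h) x)).senderVal - netTransfer x.1 x.2) +
      δ * Z.vNext .sender (Z.phaseIx (Z.state q n h) x) := by
  simp_rw [tot_playReport_eq]
  set P := Z.phase (Z.phaseIx (Z.state q n h) x)
  have i1 := (integrable_sender P).1
  have i2 : Integrable (fun θ => M.uS (P.dec (P.rep θ)) θ - (P.rep θ).2.1 -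
      netTransfer x.1 x.2) M.prior := i1.sub (integrable_const _)
  rw [integral_add (i2.const_mul _) (integrable_const _),
    integral_const_mul, integral_sub i1 (integrable_const _)]
  simp [Phase.senderVal]

/-- In state `true`, any payment other than the prescribed one triggers phase $1$, worth at most
`vSS` by `punS`, and `vSS` again afterwards. In state `false` the sender's payment has no effect on
play, so it is a pure loss. -/
theorem sender_exAnte_le (h1 : δ < 1) {n : ℕ} (h : Hist n) (x : Pay) :
    (1 - δ) * ((Z.phase (Z.phaseIx (Z.state q n h) (x, (Z.receiverStrategy q).exAnte n (h, x)))).senderVal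
      - netTransfer x ((Z.receiverStrategy q).exAnte n (h, x))) +
      δ * Z.vNext .sender (Z.phaseIx (Z.state q n h) (x, (Z.receiverStrategy q).exAnte n (h, x))) ≤
    Z.val q .sender n h := by
  have hδ : 0 ≤ 1 - δ := by linarith
  have hx1 := x.1.coe_nonneg
  have hx2 := x.2.coe_nonneg
  by_cases hs : Z.state q n h
  · simp only [receiverStrategy, hs, phaseIx, val, vNext, netTransfer, if_true]
    simp only [Prod.fst_zero, NNReal.coe_zero]
    by_cases hx : x = (Z.payS, 0)
    · subst hx
      have := Z.eqSS
      simp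
      nlinarith
    · simp only [hx, if_false]
      have := Z.punS
      simp
      nlinarith
  · simp only [receiverStrategy, hs, phaseIx, val, vNext, netTransfer]
    have := Z.eqSR
    simp
    nlinarith

theorem sender_exAnte_eq {n : ℕ} (h : Hist n) :
    (1 - δ) * ((Z.phase (Z.phaseIx (Z.state q n h) ((Z.senderStrategy q).exAnte n h,
      (Z.receiverStrategy q).exAnte n (h, (Z.senderStrategy q).exAnte n h)))).senderVal
      - netTransfer ((Z.senderStrategy q).exAnte n h)
        ((Z.receiverStrategy q).exAnte n (h, (Z.senderStrategy q).exAnte n h))) +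
      δ * Z.vNext .sender (Z.phaseIx (Z.state q n h) ((Z.senderStrategy q).exAnte n h,
      (Z.receiverStrategy q).exAnte n (h, (Z.senderStrategy q).exAnte n h))) =
    Z.val q .sender n h := by
  by_cases hs : Z.state q n h
  · simp only [receiverStrategy, senderStrategy, hs, phaseIx, val, vNext, netTransfer, if_true]
    have := Z.eqSS
    simp
    linear_combination (1 - δ) * this
  · simp only [receiverStrategy, senderStrategy, hs, phaseIx, val, vNext, netTransfer]
    have := Z.eqSR
    simp
    linear_combination this

theorem value_sender (h0 : 0 ≤ δ) (h1 : δ < 1) {n : ℕ} (h : Hist n) :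
    M.value δ (Z.profile q) .sender h = Z.val q .sender n h := by
  refine M.value_eq_of_oneShot _ _ h0 h1 _ (Z.measurable_val q .sender) (Z.abs_val_le q .sender)
    (fun n h => ?_) h
  exact (Z.integral_tot_playReport q h _).trans (Z.sender_exAnte_eq q h)

/-- Ex-ante and report deviations gain nothing when continued with the state values, so by
`value_le_of_oneShot` no strategy of the sender beats these values. -/
theorem value_deviant_sender (h0 : 0 ≤ δ) (h1 : δ < 1) (S : SenderStrategy) {n : ℕ} (h : Hist n) :
    M.value δ ⟨S, Z.receiverStrategy q⟩ .sender h ≤ Z.val q .sender n h := by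
  refine M.value_le_of_oneShot _ _ h0 h1 _ (Z.measurable_val q .sender) (Z.abs_val_le q .sender)
    (fun n h => ?_) h
  set x := S.exAnte n h
  refine le_trans ?_ (Z.sender_exAnte_le q h1 h x)
  rw [← integral_tot_playReport]
  set x' : Pay × Pay := (x, (Z.receiverStrategy q).exAnte n (h, x)) with hx'
  obtain ⟨B0, hB0⟩ := (Z.profile q).exists_bound_playReport
  obtain ⟨B1, hB1⟩ := exists_payLE x'.1
  obtain ⟨B2, hB2⟩ := exists_payLE x'.2
  obtain ⟨B, hB⟩ := Profile.exists_bound_play ⟨S, Z.receiverStrategy q⟩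
  refine integral_mono_ae (M.integrable_tot .sender (Z.measurable_val q .sender)
    (Z.abs_val_le q .sender) M.prior_ae_mem h (Profile.measurable_play _ |>.comp
      (measurable_const.prodMk measurable_id)) (hB n h))
    (M.integrable_tot .sender (Z.measurable_val q .sender)
    (Z.abs_val_le q .sender) M.prior_ae_mem h ((Z.profile q).measurable_playReport.comp
      (measurable_const.prodMk (measurable_const.prodMk measurable_id)))
      fun θ => hB0 n h x' θ (max B0 (max B1 B2))
        (hB1.mono ((le_max_left _ _).trans (le_max_right _ _)))
        (hB2.mono ((le_max_right _ _).trans (le_max_right _ _))) (le_max_left _ _)) ?_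
  filter_upwards [M.prior_ae_mem] with θ hθ
  exact Z.tot_playReport_le q h1 S h x' hθ

theorem senderRational (h0 : 0 ≤ δ) (h1 : δ < 1) : M.SenderRational δ (Z.profile q) := by
  intro S n h
  have hle : ∀ θ o, M.total δ ⟨S, (Z.profile q).R⟩ .sender h θ o ≤
      M.tot δ .sender (Z.val q .sender) h θ o := fun θ o =>
    add_le_add le_rfl (mul_le_mul_of_nonneg_left (Z.value_deviant_sender q h0 h1 S _) h0)
  have heq : ∀ θ o, M.total δ (Z.profile q) .sender h θ o =
      M.tot δ .sender (Z.val q .sender) h θ o := fun θ o => by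
    unfold total tot; rw [Z.value_sender q h0 h1]
  refine ⟨?_, fun x θ hθ => ?_, fun x r y θ hθ => ?_⟩
  · rw [← M.value_eq_integral_total _ _ h0 h1, ← M.value_eq_integral_total _ _ h0 h1,
      Z.value_sender q h0 h1]
    exact Z.value_deviant_sender q h0 h1 S h
  · rw [heq]
    exact (hle _ _).trans (Z.tot_playReport_le q h1 S h x hθ)
  · rw [heq]
    refine (hle _ _).trans ?_
    unfold tot
    refine add_le_add (mul_le_mul_of_nonneg_left ?_ (by linarith)) (le_of_eq ?_)
    · simp only [Profile.playExPostS, Profile.playExPostR, stagePayoff, netTransfer, profile,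
        receiverStrategy, senderStrategy]
      simp only [Prod.fst_zero, Prod.snd_zero, NNReal.coe_zero]
      have := (S.exPost n ((h, x, r), y)).1.coe_nonneg
      have := (S.exPost n ((h, x, r), y)).2.coe_nonneg
      linarith
    · simp only [val, state_extend]
      rfl

end Scheme
end Model
end RelComm

/-! ### The receiver's incentives in the two-state equilibria. -/

namespace RelComm
namespace Model
namespace Scheme

variable {M : Model} {δ : ℝ} (Z : M.Scheme δ) (q : Bool)

theorem measurable_tot (M : Model) (δ : ℝ) (i : Player) {v : ∀ n, Hist n → ℝ}
    (hv : ∀ n, Measurable (v n)) {n : ℕ} (h : Hist n) {α : Type*} [MeasurableSpace α] {g : α → ℝ}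
    {o : α → Outcome} (hg : Measurable g) (ho : Measurable o) :
    Measurable fun z => M.tot δ i v h (g z) (o z) :=
  (((M.measurable_stagePayoff i).comp (hg.prodMk ho)).const_mul _).add
    (((hv (n + 1)).comp (measurable_extend.comp (measurable_const.prodMk ho))).const_mul _)

theorem abs_tot_le (M : Model) (δ : ℝ) (i : Player) {v : ∀ n, Hist n → ℝ} {n : ℕ} (h : Hist n)
    {θ : ℝ} {o : Outcome} {K K' : ℝ} (hK : |M.stagePayoff i θ o| ≤ K) (hv : ∀ n h, |v n h| ≤ K') :
    |M.tot δ i v h θ o| ≤ |1 - δ| * K + |δ| * K' := by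
  refine (abs_add_le _ _).trans (add_le_add ?_ ?_) <;> rw [abs_mul]
  · exact mul_le_mul_of_nonneg_left hK (abs_nonneg _)
  · exact mul_le_mul_of_nonneg_left (hv _ _) (abs_nonneg _)

theorem integral_tot_receiver (v : ∀ n, Hist n → ℝ) {ν : Measure ℝ} [IsProbabilityMeasure ν]
    (hν : ν (Set.Icc (0 : ℝ) 1) = 1) {n : ℕ} (h : Hist n) (o : Outcome) :
    ∫ θ, M.tot δ .receiver v h θ o ∂ν = M.tot δ .receiver v h (mean ν) o := by
  obtain ⟨x, r, y, z⟩ := o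
  have i1 := M.integrable_uR (ae_mem_of_measure_eq_one hν) y.2
  set C := (1 - δ) * (-netTransfer x.2 x.1 - netTransfer y.1 r.2 - netTransfer z.2 z.1) +
    δ * v (n + 1) (extend h (x, r, y, z)) with hC
  have e : ∀ θ, M.tot δ .receiver v h θ (x, r, y, z) = (1 - δ) * M.uR y.2 θ + C := by
    intro θ; simp only [tot, stagePayoff, hC]; ring
  simp_rw [e]
  rw [integral_add (i1.const_mul _) (integrable_const _), integral_const_mul, M.integral_uR hν]
  simp

/-- In phases $0$ and $1$ a wrong decision lowers the continuation from `vRS` to `vRR`, which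
outweighs the temptation by `enforce`. In phase $2$ the prescribed decision is myopically optimal
and the next state does not depend on it. -/
theorem tot_playDecision_le (h1 : δ < 1) (R : ReceiverStrategy) {n : ℕ} (h : Hist n)
    (x : Pay × Pay) (r : Report) (p : Pay) :
    M.tot δ .receiver (Z.val q .receiver) h ((Z.phase (Z.phaseIx (Z.state q n h) x)).pm r)
      (Profile.playDecision ⟨Z.senderStrategy q, R⟩ (h, x, r) p) ≤
    M.tot δ .receiver (Z.val q .receiver) h ((Z.phase (Z.phaseIx (Z.state q n h) x)).pm r)
      ((Z.profile q).playDecision (h, x, r) p) := by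
  have e2 := Z.val_extend_obey q .receiver h ((Z.profile q).playDecision (h, x, r) p) rfl
  have e3 : ((Z.profile q).playDecision (h, x, r) p).1 = x := rfl
  rw [e3] at e2
  unfold tot
  rw [e2]
  set j := Z.phaseIx (Z.state q n h) x with hj
  set d := R.decision n ((h, x, r), p) with hd
  have hδ : 0 ≤ 1 - δ := by linarith
  have e4 : Z.val q .receiver (n + 1) (extend h (Profile.playDecision ⟨Z.senderStrategy q, R⟩
      (h, x, r) p)) = if j ≠ 2 ∧ d = (Z.phase j).dec r then Z.vRS else Z.vRR := by
    simp only [val, state_extend, next, Profile.playDecision, Profile.playExPostS,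
      Profile.playExPostR, ← hj, ← hd, decide_eq_true_eq]
  rw [e4]
  have key : (1 - δ) * M.uR d ((Z.phase j).pm r) +
      δ * (if j ≠ 2 ∧ d = (Z.phase j).dec r then Z.vRS else Z.vRR) ≤
      (1 - δ) * M.uR ((Z.phase j).dec r) ((Z.phase j).pm r) + δ * Z.vNext .receiver j := by
    have hmax := M.rhoR_isMax ((Z.phase j).pm r) d
    by_cases hj2 : j = 2
    · have := Z.myopic r
      rw [← hj2] at this
      simp only [vNext, hj2, ne_eq, not_true_eq_false, false_and, if_false, if_true]
      rw [← hj2, this]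
      exact add_le_add (mul_le_mul_of_nonneg_left hmax hδ) le_rfl
    · simp only [vNext, hj2, ne_eq, not_false_eq_true, true_and, if_false]
      split_ifs with hdd
      · rw [hdd]
      · have h2 := Z.enforce j hj2 r
        rw [← M.uR_rhoR_sub] at h2
        have h3 := mul_le_mul_of_nonneg_left hmax hδ
        linarith
  simp only [Profile.playDecision, Profile.playExPostS, Profile.playExPostR, stagePayoff,
    netTransfer, profile, receiverStrategy, senderStrategy, ← hj, ← hd]
  simp only [Prod.fst_zero, Prod.snd_zero, NNReal.coe_zero]
  have h5 := mul_nonneg hδ (R.exPost n (((h, x, r), p, d), 0)).1.coe_nonneg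
  have h6 := mul_nonneg hδ (R.exPost n (((h, x, r), p, d), 0)).2.coe_nonneg
  linarith

theorem tot_playInterimR_le (h1 : δ < 1) (R : ReceiverStrategy) {n : ℕ} (h : Hist n)
    (x : Pay × Pay) (r : Report) :
    M.tot δ .receiver (Z.val q .receiver) h ((Z.phase (Z.phaseIx (Z.state q n h) x)).pm r)
      (Profile.playInterimR ⟨Z.senderStrategy q, R⟩ (h, x, r)) ≤
    M.tot δ .receiver (Z.val q .receiver) h ((Z.phase (Z.phaseIx (Z.state q n h) x)).pm r)
      ((Z.profile q).playInterimR (h, x, r)) := by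
  refine (Z.tot_playDecision_le q h1 R h x r (R.interim n (h, x, r))).trans ?_
  have e1 := Z.val_extend_obey q .receiver h
    ((Z.profile q).playDecision (h, x, r) (R.interim n (h, x, r))) rfl
  have e2 := Z.val_extend_obey q .receiver h ((Z.profile q).playInterimR (h, x, r)) rfl
  unfold tot
  rw [e1, e2]
  refine add_le_add (mul_le_mul_of_nonneg_left ?_ (by linarith)) le_rfl
  simp only [Profile.playInterimR, Profile.playDecision, Profile.playExPostS, Profile.playExPostR,
    stagePayoff, netTransfer, profile, receiverStrategy, senderStrategy]
  simp only [Prod.fst_zero, Prod.snd_zero, NNReal.coe_zero]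
  have := (R.interim n (h, x, r)).1.coe_nonneg
  have := (R.interim n (h, x, r)).2.coe_nonneg
  linarith

/-- The interim payoffs of the receiver can be evaluated at posterior means. -/
theorem integral_tot_report (R : ReceiverStrategy) {n : ℕ} (h : Hist n) (x : Pay × Pay) :
    Integrable (fun θ => M.tot δ .receiver (Z.val q .receiver) h
      ((Z.phase (Z.phaseIx (Z.state q n h) x)).pm
        ((Z.phase (Z.phaseIx (Z.state q n h) x)).rep θ))
      (Profile.playReport ⟨Z.senderStrategy q, R⟩ h x θ)) M.prior ∧
    ∫ θ, M.tot δ .receiver (Z.val q .receiver) h θ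
      (Profile.playReport ⟨Z.senderStrategy q, R⟩ h x θ) ∂M.prior =
    ∫ θ, M.tot δ .receiver (Z.val q .receiver) h
      ((Z.phase (Z.phaseIx (Z.state q n h) x)).pm
        ((Z.phase (Z.phaseIx (Z.state q n h) x)).rep θ))
      (Profile.playReport ⟨Z.senderStrategy q, R⟩ h x θ) ∂M.prior := by
  set P := Z.phase (Z.phaseIx (Z.state q n h) x) with hP
  have := P.markov
  set σ : Profile := ⟨Z.senderStrategy q, R⟩ with hσ
  have hplay : ∀ θ, σ.playReport h x θ = σ.playInterimR (h, x, P.rep θ) := fun θ => rfl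
  obtain ⟨B0, hB0⟩ := σ.exists_bound_playReport
  obtain ⟨B1, hB1⟩ := exists_payLE x.1
  obtain ⟨B2, hB2⟩ := exists_payLE x.2
  have hB : ∀ θ, OutLE (max B0 (max B1 B2)) (σ.playReport h x θ) := fun θ =>
    hB0 n h x θ _ (hB1.mono ((le_max_left _ _).trans (le_max_right _ _)))
      (hB2.mono ((le_max_right _ _).trans (le_max_right _ _))) (le_max_left _ _)
  obtain ⟨K, hK0, hK⟩ := M.exists_bound_stagePayoff (max B0 (max B1 B2))
  set f : Report × ℝ → ℝ := fun z => M.tot δ .receiver (Z.val q .receiver) h z.2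
    (σ.playInterimR (h, x, z.1)) with hf
  have minfo : Measurable fun z : Report × ℝ => σ.playInterimR ((h, x, z.1) : Info n) :=
    σ.measurable_playInterimR.comp (measurable_const.prodMk (measurable_const.prodMk measurable_fst))
  have mf : Measurable f :=
    measurable_tot M δ .receiver (Z.measurable_val q .receiver) h measurable_snd minfo
  set K' := |Z.vSS| + |Z.vSR| + |Z.vRS| + |Z.vRR|
  have bf : ∀ θ y, y ∈ Set.Icc (0 : ℝ) 1 → |f (P.rep θ, y)| ≤ |1 - δ| * K + |δ| * K' := by
    exact fun θ y hy => abs_tot_le M δ .receiver h (hK _ _ _ hy (hB θ)) (Z.abs_val_le q .receiver)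
  have key := integral_disintegrate P.measurable_rep P.bel P.bayes M.prior_ae_mem mf _
    (fun θ hθ => bf θ θ hθ)
  have mpm : Measurable fun r => P.pm r :=
    ((measurable_snd (α := Report) (β := ℝ)).stronglyMeasurable.integral_kernel_prod_right'
      (κ := P.bel)).measurable
  constructor
  · exact M.integrable_prior (g := fun θ => f (P.rep θ, P.pm (P.rep θ)))
      (mf.comp (P.measurable_rep.prodMk (mpm.comp P.measurable_rep))) _
      fun θ _ => bf θ _ (mean_mem (P.support _))
  · have e : ∀ r, ∫ y, f (r, y) ∂P.bel r = f (r, P.pm r) := fun r =>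
      integral_tot_receiver (Z.val q .receiver) (P.support r) h (σ.playInterimR (h, x, r))
    have e2 : (fun θ => ∫ y, f (P.rep θ, y) ∂P.bel (P.rep θ)) = fun θ => f (P.rep θ, P.pm (P.rep θ)) :=
      funext fun θ => e (P.rep θ)
    rw [e2] at key
    exact key

theorem integral_tot_playReport_le (h1 : δ < 1) (R : ReceiverStrategy) {n : ℕ} (h : Hist n)
    (x : Pay × Pay) :
    ∫ θ, M.tot δ .receiver (Z.val q .receiver) h θ
      (Profile.playReport ⟨Z.senderStrategy q, R⟩ h x θ) ∂M.prior ≤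
    (1 - δ) * ((Z.phase (Z.phaseIx (Z.state q n h) x)).recvVal - netTransfer x.2 x.1) +
      δ * Z.vNext .receiver (Z.phaseIx (Z.state q n h) x) ∧
    ∫ θ, M.tot δ .receiver (Z.val q .receiver) h θ
      ((Z.profile q).playReport h x θ) ∂M.prior =
    (1 - δ) * ((Z.phase (Z.phaseIx (Z.state q n h) x)).recvVal - netTransfer x.2 x.1) +
      δ * Z.vNext .receiver (Z.phaseIx (Z.state q n h) x) := by
  have hE : ∫ θ, M.tot δ .receiver (Z.val q .receiver) h θ
      ((Z.profile q).playReport h x θ) ∂M.prior =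
    (1 - δ) * ((Z.phase (Z.phaseIx (Z.state q n h) x)).recvVal - netTransfer x.2 x.1) +
      δ * Z.vNext .receiver (Z.phaseIx (Z.state q n h) x) := by
    set P := Z.phase (Z.phaseIx (Z.state q n h) x) with hP
    have e : ∀ θ, M.tot δ .receiver (Z.val q .receiver) h θ ((Z.profile q).playReport h x θ) =
        (1 - δ) * (M.uR (P.dec (P.rep θ)) θ + (P.rep θ).2.1 - netTransfer x.2 x.1) +
        δ * Z.vNext .receiver (Z.phaseIx (Z.state q n h) x) := by
      intro θ
      have e2 := Z.val_extend_obey q .receiver h ((Z.profile q).playReport h x θ) rfl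
      have e3 : ((Z.profile q).playReport h x θ).1 = x := rfl
      unfold tot
      rw [e2, e3]
      congr 2
      simp only [Profile.playReport, Profile.playInterimR, Profile.playDecision, Profile.playExPostS,
        Profile.playExPostR, stagePayoff, netTransfer, profile, receiverStrategy, senderStrategy,
        ← hP]
      simp only [Prod.fst_zero, Prod.snd_zero, NNReal.coe_zero]
      ring
    simp_rw [e]
    have i1 := (integrable_sender P).2
    have i2 : Integrable (fun θ => M.uR (P.dec (P.rep θ)) θ + (P.rep θ).2.1 -
        netTransfer x.2 x.1) M.prior := i1.sub (integrable_const _)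
    rw [integral_add (i2.const_mul _) (integrable_const _),
      integral_const_mul, integral_sub i1 (integrable_const _)]
    simp [Phase.recvVal]
  refine ⟨?_, hE⟩
  rw [← hE]
  obtain ⟨a1, a2⟩ := Z.integral_tot_report q R h x
  obtain ⟨b1, b2⟩ := Z.integral_tot_report q (Z.receiverStrategy q) h x
  rw [a2]
  refine le_trans (integral_mono a1 b1 fun θ => ?_) (le_of_eq b2.symm)
  exact Z.tot_playInterimR_le q h1 R h x _

theorem receiver_exAnte_le (h1 : δ < 1) {n : ℕ} (h : Hist n) (x y : Pay) :
    (1 - δ) * ((Z.phase (Z.phaseIx (Z.state q n h) (x, y))).recvVal - netTransfer y x) +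
      δ * Z.vNext .receiver (Z.phaseIx (Z.state q n h) (x, y)) ≤
    (1 - δ) * ((Z.phase (Z.phaseIx (Z.state q n h)
        (x, (Z.receiverStrategy q).exAnte n (h, x)))).recvVal -
        netTransfer ((Z.receiverStrategy q).exAnte n (h, x)) x) +
      δ * Z.vNext .receiver (Z.phaseIx (Z.state q n h)
        (x, (Z.receiverStrategy q).exAnte n (h, x))) := by
  have hδ : 0 ≤ 1 - δ := by linarith
  have hy1 := mul_nonneg hδ y.1.coe_nonneg
  have hy2 := mul_nonneg hδ y.2.coe_nonneg
  by_cases hs : Z.state q n h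
  · simp only [receiverStrategy, hs, phaseIx, netTransfer, if_true]
    simp only [Prod.fst_zero, Prod.snd_zero, NNReal.coe_zero]
    linarith
  · simp only [receiverStrategy, hs, phaseIx, vNext, netTransfer]
    by_cases hy : y = (Z.payR, 0)
    · subst hy
      simp
    · simp only [hy]
      have e1 := Z.eqRR
      have e2 := mul_le_mul_of_nonneg_left Z.punR hδ
      simp
      linarith

theorem receiver_exAnte_eq {n : ℕ} (h : Hist n) :
    (1 - δ) * ((Z.phase (Z.phaseIx (Z.state q n h) ((Z.senderStrategy q).exAnte n h,
      (Z.receiverStrategy q).exAnte n (h, (Z.senderStrategy q).exAnte n h)))).recvVal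
      - netTransfer ((Z.receiverStrategy q).exAnte n (h, (Z.senderStrategy q).exAnte n h))
        ((Z.senderStrategy q).exAnte n h)) +
      δ * Z.vNext .receiver (Z.phaseIx (Z.state q n h) ((Z.senderStrategy q).exAnte n h,
      (Z.receiverStrategy q).exAnte n (h, (Z.senderStrategy q).exAnte n h))) =
    Z.val q .receiver n h := by
  by_cases hs : Z.state q n h
  · simp only [receiverStrategy, senderStrategy, hs, phaseIx, val, vNext, netTransfer, if_true]
    have := Z.eqRS
    simp
    linear_combination (1 - δ) * this
  · simp only [receiverStrategy, senderStrategy, hs, phaseIx, val, vNext, netTransfer]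
    have := Z.eqRR
    simp
    linear_combination this

theorem value_receiver (h0 : 0 ≤ δ) (h1 : δ < 1) {n : ℕ} (h : Hist n) :
    M.value δ (Z.profile q) .receiver h = Z.val q .receiver n h := by
  refine M.value_eq_of_oneShot _ _ h0 h1 _ (Z.measurable_val q .receiver)
    (Z.abs_val_le q .receiver) (fun n h => ?_) h
  exact (Z.integral_tot_playReport_le q h1 (Z.receiverStrategy q) h _).2.trans
    (Z.receiver_exAnte_eq q h)

theorem value_deviant_receiver (h0 : 0 ≤ δ) (h1 : δ < 1) (R : ReceiverStrategy) {n : ℕ}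
    (h : Hist n) : M.value δ ⟨Z.senderStrategy q, R⟩ .receiver h ≤ Z.val q .receiver n h := by
  refine M.value_le_of_oneShot _ _ h0 h1 _ (Z.measurable_val q .receiver)
    (Z.abs_val_le q .receiver) (fun n h => ?_) h
  refine (Z.integral_tot_playReport_le q h1 R h _).1.trans ?_
  exact (Z.receiver_exAnte_le q h1 h _ _).trans (Z.receiver_exAnte_eq q h).le

theorem receiverRational (h0 : 0 ≤ δ) (h1 : δ < 1) :
    M.ReceiverRational δ (Z.profile q) (Z.beliefs q) := by
  intro R n h
  have hle : ∀ θ o, M.total δ ⟨(Z.profile q).S, R⟩ .receiver h θ o ≤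
      M.tot δ .receiver (Z.val q .receiver) h θ o := fun θ o =>
    add_le_add le_rfl (mul_le_mul_of_nonneg_left (Z.value_deviant_receiver q h0 h1 R _) h0)
  have heq : ∀ θ o, M.total δ (Z.profile q) .receiver h θ o =
      M.tot δ .receiver (Z.val q .receiver) h θ o := fun θ o => by
    unfold total tot; rw [Z.value_receiver q h0 h1]
  simp_rw [heq]
  refine ⟨fun x => ?_, fun x r => ?_⟩
  · set y := R.exAnte n (h, x)
    refine le_trans ?_ ((Z.integral_tot_playReport_le q h1 R h (x, y)).1.trans
      ((Z.receiver_exAnte_le q h1 h x y).trans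
      (Z.integral_tot_playReport_le q h1 R h _).2.symm.le))
    obtain ⟨B0, hB0⟩ := Profile.exists_bound_playExAnteR ⟨Z.senderStrategy q, R⟩
    obtain ⟨B1, hB1⟩ := exists_payLE x
    have hB := fun θ => hB0 n h x θ (max B0 B1) (hB1.mono (le_max_right _ _)) (le_max_left _ _)
    have hm : Measurable fun θ : ℝ => Profile.playExAnteR ⟨Z.senderStrategy q, R⟩ h x θ :=
      (Profile.measurable_playExAnteR ⟨Z.senderStrategy q, R⟩).comp
        ((measurable_const (a := (h, x))).prodMk measurable_id)
    exact integral_mono (M.integrable_total _ _ h0 h1 M.prior_ae_mem h hm hB)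
      (M.integrable_tot .receiver (Z.measurable_val q .receiver) (Z.abs_val_le q .receiver)
        M.prior_ae_mem h hm hB) fun θ => hle θ _
  set P := Z.phase (Z.phaseIx (Z.state q n h) x) with hP
  have := P.markov
  have hbel : ((Z.beliefs q).belief n) (h, x, r) = P.bel r := rfl
  have hsupp := P.support r
  have hmem := ae_mem_of_measure_eq_one hsupp
  have hint : ∀ o : Outcome, ∫ θ, M.total δ ⟨(Z.profile q).S, R⟩ .receiver h θ o ∂(P.bel r) ≤
      M.tot δ .receiver (Z.val q .receiver) h (P.pm r) o := by
    intro o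
    obtain ⟨B, hB⟩ := exists_bound_outcome o
    refine le_trans (integral_mono (M.integrable_total _ _ h0 h1 hmem h measurable_const
      fun _ => hB) (M.integrable_tot .receiver (Z.measurable_val q .receiver)
      (Z.abs_val_le q .receiver) hmem h measurable_const fun _ => hB) fun θ => hle θ o) ?_
    exact (integral_tot_receiver _ hsupp h o).le
  rw [hbel]
  simp_rw [integral_tot_receiver (Z.val q .receiver) hsupp]
  have hpm : mean (P.bel r) = P.pm r := rfl
  rw [hpm]
  refine ⟨(hint _).trans (Z.tot_playInterimR_le q h1 R h x r),
    fun p => (hint _).trans (Z.tot_playDecision_le q h1 R h x r p), fun y z => (hint _).trans ?_⟩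
  unfold tot
  refine add_le_add (mul_le_mul_of_nonneg_left ?_ (by linarith)) (le_of_eq ?_)
  · simp only [Profile.playExPostR, stagePayoff, netTransfer, profile, receiverStrategy]
    simp only [Prod.fst_zero, Prod.snd_zero, NNReal.coe_zero]
    have := (R.exPost n (((h, x, r), y), z)).1.coe_nonneg
    have := (R.exPost n (((h, x, r), y), z)).2.coe_nonneg
    linarith
  · simp only [val, state_extend]
    rfl

theorem isEquilibrium (h0 : 0 ≤ δ) (h1 : δ < 1) : M.IsEquilibrium δ (Z.profile q) :=
  ⟨Z.beliefs q, Z.consistent q, Z.senderRational q h0 h1, Z.receiverRational q h0 h1⟩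

theorem mem_eqPayoffs (h0 : 0 ≤ δ) (h1 : δ < 1) :
    (Z.vSS, Z.vRS) ∈ M.eqPayoffs δ ∧ (Z.vSR, Z.vRR) ∈ M.eqPayoffs δ := by
  constructor
  · refine ⟨Z.profile true, Z.isEquilibrium true h0 h1, ?_⟩
    rw [Z.value_sender true h0 h1, Z.value_receiver true h0 h1]
    simp [val, state]
  · refine ⟨Z.profile false, Z.isEquilibrium false h0 h1, ?_⟩
    rw [Z.value_sender false h0 h1, Z.value_receiver false h0 h1]
    simp [val, state]

end Scheme
end Model
end RelComm

namespace RelComm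

/-! ### Phases with monotone decisions -/

/-- Monotone decisions after the messages of a rule, within distance `s` of the receiver's preferred
ones. -/
structure DecisionRule (m : Rule) (M : Model) (s : ℝ) where
  D : ℕ → ℝ
  mono : MonotoneOn (fun θ => D (m.msg θ)) (Set.Icc 0 1)
  near : ∀ k, |D k - M.rhoR (m.y M k)| ≤ s
  off : ∀ k, ¬ (m.cell k).Nonempty → D k = M.b - s

namespace DecisionRule

variable {m : Rule} {M : Model} {s : ℝ} (R : DecisionRule m M s)

theorem mul_sub_le_integral {θ θ' : ℝ} (h : θ ∈ Set.Icc (0 : ℝ) 1) (h' : θ' ∈ Set.Icc (0 : ℝ) 1) :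
    R.D (m.msg θ') * (θ - θ') ≤ ∫ t in θ'..θ, R.D (m.msg t) := by
  have hi := fun x z => m.intervalIntegrable_comp_msg R.D x z
  rcases le_total θ' θ with hle | hle
  · have := intervalIntegral.integral_mono_on hle intervalIntegrable_const (hi θ' θ)
      fun t ht => R.mono h' ⟨h'.1.trans ht.1, ht.2.trans h.2⟩ ht.1
    simpa [mul_comm] using this
  · have := intervalIntegral.integral_mono_on hle (hi θ θ') intervalIntegrable_const
      fun t ht => R.mono ⟨h.1.trans ht.1, ht.2.trans h'.2⟩ h' ht.2
    rw [intervalIntegral.integral_symm]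
    simp only [intervalIntegral.integral_const, smul_eq_mul] at this
    linarith

/-- The sender's interim payoff. -/
noncomputable def T (θ : ℝ) : ℝ :=
  M.uS (M.b - s) 0 + (1 - M.c * M.a) * ∫ t in (0 : ℝ)..θ, R.D (m.msg t)

theorem T_sub (θ θ' : ℝ) :
    R.T θ - R.T θ' = (1 - M.c * M.a) * ∫ t in θ'..θ, R.D (m.msg t) := by
  have hi := fun x z => m.intervalIntegrable_comp_msg R.D x z
  have := intervalIntegral.integral_add_adjacent_intervals (hi 0 θ') (hi θ' θ)
  unfold T
  rw [← this]
  ring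

/-- Interim payoffs built as integrals of a monotone decision are convex. Supporting lines at all
states make the mechanism globally incentive compatible. -/
theorem T_subgradient {θ θ' : ℝ} (h : θ ∈ Set.Icc (0 : ℝ) 1) (h' : θ' ∈ Set.Icc (0 : ℝ) 1) :
    R.T θ' + (1 - M.c * M.a) * (R.D (m.msg θ') * (θ - θ')) ≤ R.T θ := by
  have h1 := R.T_sub θ θ'
  have h2 := mul_le_mul_of_nonneg_left (R.mul_sub_le_integral h h')
    (by linarith [M.ca_lt] : 0 ≤ 1 - M.c * M.a)
  linarith

/-- The sender's interim payment that goes with a message. -/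
noncomputable def payment (k : ℕ) : ℝ := M.uS (R.D k) (m.pt k) - R.T (m.pt k)

theorem uS_sub_payment (k : ℕ) (θ : ℝ) :
    M.uS (R.D k) θ - R.payment k = R.T (m.pt k) + (1 - M.c * M.a) * (R.D k * (θ - m.pt k)) := by
  have := M.uS_sub (R.D k) θ (m.pt k)
  unfold payment
  linarith

/-- The payment is computed at an arbitrary state of the cell. The decision is constant on the cell,
so the two subgradient inequalities coincide, `T` is affine there, and the choice is immaterial. -/
theorem uS_sub_payment_eq {θ : ℝ} (h : θ ∈ Set.Icc (0 : ℝ) 1) :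
    M.uS (R.D (m.msg θ)) θ - R.payment (m.msg θ) = R.T θ := by
  have hp := m.pt_mem ⟨θ, m.mem_cell h⟩
  have h1 := R.T_subgradient h hp.1
  have h2 := R.T_subgradient hp.1 h
  rw [hp.2] at h1
  rw [uS_sub_payment]
  linarith

theorem b_sub_le (ha : 2 < M.a) (k : ℕ) : M.b - s ≤ R.D k := by
  have h1 := (abs_le.1 (R.near k)).1
  have h2 := mul_nonneg (by linarith : 0 ≤ M.a) (m.y_mem M k).1
  unfold Model.rhoR at h1
  linarith

/-- This deters reports that are never expected: they are answered with $b-s$. Both sides agree at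
$0$, and the left side grows more slowly because no decision is below $b-s$. -/
theorem le_T (ha : 2 < M.a) {θ : ℝ} (h : θ ∈ Set.Icc (0 : ℝ) 1) : M.uS (M.b - s) θ ≤ R.T θ := by
  have h1 := M.uS_sub (M.b - s) θ 0
  have h2 := intervalIntegral.integral_mono_on h.1 intervalIntegrable_const
    (m.intervalIntegrable_comp_msg R.D 0 θ) fun t _ => R.b_sub_le ha (m.msg t)
  simp only [intervalIntegral.integral_const, smul_eq_mul] at h2
  have h3 := mul_le_mul_of_nonneg_left h2 (by linarith [M.ca_lt] : 0 ≤ 1 - M.c * M.a)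
  unfold T
  linarith

/-- By incentive compatibility at state $0$, the message less its payment is worth at most the
punishment payoff there, while `uS_punish_le` makes its decision worth at least as much. -/
theorem payment_nonneg (ha : 2 < M.a) (hb : M.a + M.b < 1) {k : ℕ} (hk : (m.cell k).Nonempty) :
    0 ≤ R.payment k := by
  have hp := m.pt_mem hk
  have h1 := R.T_subgradient (θ := 0) (by simp) hp.1
  rw [hp.2] at h1
  have h2 := M.uS_sub (R.D k) (m.pt k) 0
  have h3 := Model.uS_punish_le ha hb (R.near k) (m.y_mem M k)
  have h4 : R.T 0 = M.uS (M.b - s) 0 := by simp [T]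
  unfold payment
  linarith

/-- The report that goes with a message. -/
noncomputable def report (k : ℕ) : Report := ((k : ℝ), ((R.payment k).toNNReal, 0))

/-- A bound for the messages. -/
noncomputable def bound (m : Rule) : ℕ := m.bdd.choose

theorem msg_le_bound (m : Rule) (θ : ℝ) : m.msg θ ≤ bound m := m.bdd.choose_spec θ

open Classical in
/-- The message contained in a report; reports that should not occur are read as a message that is
never sent. -/
noncomputable def read (r : Report) : ℕ :=
  -- The number `bound m + 1` exceeds every message that is sent, so its cell is empty.
  if r ∈ R.report '' Set.Iic (bound m) then ⌊r.1⌋₊ else bound m + 1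

theorem measurable_read : Measurable R.read := by
  refine Measurable.ite ?_ (Nat.measurable_floor.comp measurable_fst) measurable_const
  exact ((Set.finite_Iic _).image _).measurableSet

theorem read_report {k : ℕ} (hk : k ≤ bound m) : R.read (R.report k) = k := by
  unfold read
  rw [if_pos ⟨k, hk, rfl⟩]
  simp [report]

theorem read_of_notMem {r : Report} (h : r ∉ R.report '' Set.Iic (bound m)) :
    ¬ (m.cell (R.read r)).Nonempty := by
  unfold read
  rw [if_neg h]
  rintro ⟨θ, hθ⟩
  have := msg_le_bound m θ
  rw [hθ.2] at this
  omega

/-- The phase in which decisions follow a given rule. -/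
noncomputable def phase (ha : 2 < M.a) (hb : M.a + M.b < 1) : M.Phase where
  rep θ := R.report (m.msg θ)
  dec r := R.D (R.read r)
  bel := (m.bel M).comap R.read R.measurable_read
  measurable_rep := m.measurable_comp_msg _
  measurable_dec := (measurable_from_top (f := R.D)).comp R.measurable_read
  markov := inferInstance
  support r := by
    rw [Kernel.comap_apply, Rule.bel_apply]
    exact m.belMeasure_Icc M _
  bdd := by
    refine ⟨∑ k ∈ Finset.range (bound m + 2), ((R.payment k).toNNReal + ‖R.D k‖₊),
      fun θ => ⟨?_, zero_le⟩, fun r => ?_⟩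
    · refine le_trans le_self_add (Finset.single_le_sum
        (f := fun k => (R.payment k).toNNReal + ‖R.D k‖₊) (fun _ _ => zero_le) (?_ : m.msg θ ∈ _))
      have := msg_le_bound m θ
      simp; omega
    · have hr : R.read r ∈ Finset.range (bound m + 2) := by
        rw [Finset.mem_range]
        by_cases h : r ∈ R.report '' Set.Iic (bound m)
        · obtain ⟨k, hk, rfl⟩ := h
          rw [R.read_report hk]
          have : k ≤ bound m := hk
          omega
        · unfold read; rw [if_neg h]; omega
      have h2 : ‖R.D (R.read r)‖₊ ≤
          ∑ k ∈ Finset.range (bound m + 2), ((R.payment k).toNNReal + ‖R.D k‖₊) :=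
        le_trans le_add_self (Finset.single_le_sum
          (f := fun k => (R.payment k).toNNReal + ‖R.D k‖₊) (fun _ _ => zero_le) hr)
      exact_mod_cast h2
  bayes A hA B _ := by
    have := m.bayes M A hA {k | R.report k ∈ B}
    simp only [Set.mem_ofPred_eq] at this
    rw [this]
    refine lintegral_congr fun θ => ?_
    rw [Kernel.comap_apply, R.read_report (msg_le_bound m θ)]
  conc θ hθ := by
    rw [Kernel.comap_apply, R.read_report (msg_le_bound m θ), Rule.bel_apply,
      ← m.belMeasure_cell M ⟨θ, m.mem_cell hθ⟩]
    congr 1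
    ext θ'
    refine and_congr_right fun _ => ⟨fun h => ?_, fun h => by rw [h]⟩
    have : (m.msg θ' : ℝ) = m.msg θ := congrArg Prod.fst h
    exact_mod_cast this
  no_burning θ := rfl
  ic θ hθ r := by
    have h1 := r.2.1.coe_nonneg
    have h2 := r.2.2.coe_nonneg
    have hR : M.uS (R.D (R.read (R.report (m.msg θ)))) θ - (R.report (m.msg θ)).2.1 = R.T θ := by
      rw [R.read_report (msg_le_bound m θ), ← R.uS_sub_payment_eq hθ]
      simp only [report]
      rw [Real.coe_toNNReal _ (R.payment_nonneg ha hb ⟨θ, m.mem_cell hθ⟩)]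
    rw [hR]
    by_cases hk : (m.cell (R.read r)).Nonempty
    · have hr : r ∈ R.report '' Set.Iic (bound m) := by
        by_contra h
        exact R.read_of_notMem h hk
      obtain ⟨k, hk', rfl⟩ := hr
      rw [R.read_report hk'] at hk ⊢
      have hp := m.pt_mem hk
      have := R.T_subgradient hθ hp.1
      rw [hp.2, ← R.uS_sub_payment] at this
      simp only [report]
      rw [Real.coe_toNNReal _ (R.payment_nonneg ha hb hk)]
      simpa using this
    · rw [R.off _ hk]
      linarith [R.le_T ha hθ]

variable (ha : 2 < M.a) (hb : M.a + M.b < 1)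

theorem phase_dec_rep (θ : ℝ) :
    (R.phase ha hb).dec ((R.phase ha hb).rep θ) = R.D (m.msg θ) :=
  congrArg R.D (R.read_report (msg_le_bound m θ))

theorem phase_near (r : Report) :
    |(R.phase ha hb).dec r - M.rhoR ((R.phase ha hb).pm r)| ≤ s := by
  have : (R.phase ha hb).pm r = m.y M (R.read r) := rfl
  rw [this]
  exact R.near _

theorem senderVal_phase : (R.phase ha hb).senderVal =
    M.uS (M.b - s) 0 + (1 - M.c * M.a) * ∫ θ, (∫ t in (0 : ℝ)..θ, R.D (m.msg t)) ∂M.prior := by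
  have e : (R.phase ha hb).senderVal = ∫ θ, R.T θ ∂M.prior := by
    refine integral_congr_ae ?_
    filter_upwards [M.prior_ae_mem] with θ hθ
    rw [R.phase_dec_rep ha hb]
    simp only [phase, report]
    rw [Real.coe_toNNReal _ (R.payment_nonneg ha hb ⟨θ, m.mem_cell hθ⟩), R.uS_sub_payment_eq hθ]
  rw [e]
  unfold T
  rw [integral_add (integrable_const _) ((Model.integrable_primitive_comp_msg M m R.D).const_mul _),
    integral_const_mul]
  simp

theorem senderVal_add_recvVal : (R.phase ha hb).senderVal + (R.phase ha hb).recvVal =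
    ∫ θ, Model.uJoint (R.D (m.msg θ)) (m.Y M θ) ∂M.prior := by
  have i := Model.Scheme.integrable_sender (R.phase ha hb)
  rw [← m.integral_uJoint_msg M R.D]
  unfold Model.Phase.senderVal Model.Phase.recvVal
  rw [← integral_add i.1 i.2]
  congr 1; ext θ
  rw [R.phase_dec_rep ha hb]
  unfold Model.uS
  ring

/-- Decisions within $s$ of the preferred ones cost at most $cs^2/2$. Information does not hurt: the
receiver's maximal payoff is convex in the posterior mean and lies above its tangent at the prior
mean. The sender's payments only add to this. -/
theorem le_recvVal : M.r0 - M.c * s ^ 2 / 2 ≤ (R.phase ha hb).recvVal := by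
  have hI := fun g => m.integrable_comp_msg M g
  have i1 : Integrable (fun θ => M.c * (M.b * R.D (m.msg θ) - R.D (m.msg θ) ^ 2 / 2)) M.prior :=
    hI fun k => M.c * (M.b * R.D k - R.D k ^ 2 / 2)
  have i2 : Integrable (fun θ => M.c * M.a * R.D (m.msg θ) * θ) M.prior :=
    m.integrable_mul M (fun k => M.c * M.a * R.D k) measurable_id fun θ => Rule.abs_le_one_of_mem
  have e1 : ∫ θ, M.uR (R.D (m.msg θ)) θ ∂M.prior = ∫ θ, M.uR (R.D (m.msg θ)) (m.Y M θ) ∂M.prior := by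
    have h := m.integral_mul_id M fun k => M.c * M.a * R.D k
    have i3 : Integrable (fun θ => M.c * M.a * R.D (m.msg θ) * m.Y M θ) M.prior :=
      hI fun k => M.c * M.a * R.D k * m.y M k
    have e2 := integral_add i2 i1
    have e3 := integral_add i3 i1
    rw [h, ← e3] at e2
    convert e2 using 2 <;> ext θ <;> simp only [Model.uR] <;> ring
  have h1 : ∫ θ, M.uR (R.D (m.msg θ)) θ ∂M.prior ≤ (R.phase ha hb).recvVal := by
    have i4 : Integrable (fun θ => M.uR (R.D (m.msg θ)) θ) M.prior :=
      (i2.add i1).congr (Eventually.of_forall fun θ => by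
        simp only [Pi.add_apply, Model.uR]; ring)
    refine integral_mono i4 (Model.Scheme.integrable_sender (R.phase ha hb)).2 fun θ => ?_
    have := ((R.phase ha hb).rep θ).2.1.coe_nonneg
    simp only [R.phase_dec_rep ha hb]
    linarith
  refine le_trans ?_ h1
  rw [e1]
  have h2 : ∫ θ, (M.c * M.a * M.rhoR M.mu * m.Y M θ + (M.c * (M.b * M.rhoR M.mu -
      M.rhoR M.mu ^ 2 / 2) - M.c * s ^ 2 / 2)) ∂M.prior ≤
      ∫ θ, M.uR (R.D (m.msg θ)) (m.Y M θ) ∂M.prior := by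
    refine integral_mono (((hI (m.y M)).const_mul _).add (integrable_const _))
      (hI fun k => M.uR (R.D k) (m.y M k)) fun θ => ?_
    have h3 := abs_le.1 (R.near (m.msg θ))
    have h4 : (R.D (m.msg θ) - M.rhoR (m.y M (m.msg θ))) ^ 2 ≤ s ^ 2 := sq_le_sq' h3.1 h3.2
    have h5 := mul_le_mul_of_nonneg_left h4 M.c_pos.le
    have h6 := mul_nonneg M.c_pos.le (sq_nonneg (M.rhoR (m.y M (m.msg θ)) - M.rhoR M.mu))
    simp only [Rule.Y, Model.uR]
    unfold Model.rhoR at *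
    nlinarith
  have h7 := integral_add (μ := M.prior) ((hI (m.y M)).const_mul (M.c * M.a * M.rhoR M.mu))
    (integrable_const (M.c * (M.b * M.rhoR M.mu - M.rhoR M.mu ^ 2 / 2) - M.c * s ^ 2 / 2))
  rw [integral_const_mul] at h7
  have h8 : ∫ θ, m.y M (m.msg θ) ∂M.prior = M.mu := m.integral_Y M
  rw [h8] at h7
  refine le_trans (le_of_eq ?_) (h7.symm.le.trans h2)
  simp only [integral_const, probReal_univ, smul_eq_mul, Model.r0, Model.uR, Model.rhoR]
  ring

end DecisionRule

open Classical in
/-- The best decisions that can be enforced. -/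
noncomputable def bestDecision (m : Rule) {M : Model} (ha : 2 < M.a) (hb : M.a + M.b < 1) {s : ℝ}
    (hs : 0 ≤ s) : DecisionRule m M s where
  D k := if (m.cell k).Nonempty then min (m.y M k) (M.rhoR (m.y M k) + s) else M.b - s
  mono θ h θ' h' hle := by
    have hY : m.y M (m.msg θ) ≤ m.y M (m.msg θ') := m.Y_mono M h h' hle
    simp only
    rw [if_pos ⟨θ, m.mem_cell h⟩, if_pos ⟨θ', m.mem_cell h'⟩]
    have := mul_le_mul_of_nonneg_left hY (by linarith : 0 ≤ M.a)
    exact min_le_min hY (by unfold Model.rhoR; linarith)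
  near k := by
    have h1 := Model.gap_pos ha hb (m.y_mem M k).2
    unfold Model.gap at h1
    split_ifs with h
    · rw [abs_le]
      constructor
      · have := le_min (by linarith : M.rhoR (m.y M k) - s ≤ m.y M k)
          (by linarith : M.rhoR (m.y M k) - s ≤ M.rhoR (m.y M k) + s)
        linarith
      · have := min_le_right (m.y M k) (M.rhoR (m.y M k) + s)
        linarith
    · have h0 : M.prior (m.cell k) = 0 := by rw [Set.not_nonempty_iff_eq_empty.1 h]; simp
      have : m.y M k = 0 := by
        unfold Rule.y Rule.belMeasure Rule.pt
        rw [if_neg (by simpa using h0), dif_neg h, mean_dirac]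
      rw [this]
      simp [Model.rhoR, abs_of_nonneg hs]
  off k h := if_neg h

/-- The lowest decisions that can be enforced. -/
noncomputable def lowestDecision (m : Rule) {M : Model} (ha : 2 < M.a) {s : ℝ} (hs : 0 ≤ s) :
    DecisionRule m M s where
  D k := M.rhoR (m.y M k) - s
  mono θ h θ' h' hle := by
    have := mul_le_mul_of_nonneg_left (m.Y_mono M h h' hle) (by linarith : 0 ≤ M.a)
    simp only [Model.rhoR]
    unfold Rule.Y at this
    linarith
  near k := by simp [abs_of_nonneg hs]
  off k h := by
    have h0 : M.prior (m.cell k) = 0 := by rw [Set.not_nonempty_iff_eq_empty.1 h]; simp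
    have : m.y M k = 0 := by
      unfold Rule.y Rule.belMeasure Rule.pt
      rw [if_neg (by simpa using h0), dif_neg h, mean_dirac]
    rw [this]
    simp [Model.rhoR]

/-! ### Assembling the two-state equilibria. -/

namespace Model

/-- The phase without communication. -/
noncomputable def babbling (M : Model) : M.Phase where
  rep _ := 0
  dec _ := M.rhoR M.mu
  bel := Kernel.const _ M.prior
  measurable_rep := measurable_const
  measurable_dec := measurable_const
  markov := inferInstance
  support _ := M.prior_Icc
  bdd := ⟨‖M.rhoR M.mu‖₊, fun _ => zero_payLE _, fun _ => le_rfl⟩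
  bayes A hA B _ := by
    by_cases h : (0 : Report) ∈ B
    · simp [h]
    · simp [h]
  conc θ _ := by
    rw [Kernel.const_apply]
    convert M.prior_Icc using 2
    ext θ
    simp
  no_burning _ := rfl
  ic θ _ r := by
    have h1 := r.2.1.coe_nonneg
    have h2 := r.2.2.coe_nonneg
    simp only [Prod.snd_zero, Prod.fst_zero, NNReal.coe_zero]
    linarith

theorem recvVal_babbling (M : Model) : M.babbling.recvVal = M.r0 := by
  unfold Phase.recvVal
  have := M.integral_uR M.prior_Icc (M.rhoR M.mu)
  simp only [babbling, Prod.snd_zero, Prod.fst_zero, NNReal.coe_zero, add_zero]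
  exact this

variable {M : Model} {δ s : ℝ}

theorem senderVal_lowest (ha : 2 < M.a) (hb : M.a + M.b < 1) (hs : 0 ≤ s) (m : Rule) :
    ((lowestDecision m ha hs).phase ha hb).senderVal = M.punish (m.J M) s := by
  rw [DecisionRule.senderVal_phase]
  have := M.integral_primitive_affine m M.a (M.b - s)
  have e : ∀ t, (lowestDecision m ha hs).D (m.msg t) = M.a * m.Y M t + (M.b - s) := fun t => by
    simp only [lowestDecision, rhoR, Rule.Y]; ring
  simp_rw [e]
  rw [this]
  unfold punish
  ring

/-- Both phases give the sender the same payoff in state $0$. Higher decisions then yield higher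
rents. -/
theorem punish_le_senderVal (ha : 2 < M.a) (hb : M.a + M.b < 1) (hs : 0 ≤ s) (m : Rule) :
    M.punish (m.J M) s ≤ ((bestDecision m ha hb hs).phase ha hb).senderVal := by
  rw [← senderVal_lowest ha hb hs, DecisionRule.senderVal_phase, DecisionRule.senderVal_phase]
  refine add_le_add le_rfl (mul_le_mul_of_nonneg_left ?_ (by linarith [M.ca_lt]))
  refine integral_mono_ae (integrable_primitive_comp_msg M m _)
    (integrable_primitive_comp_msg M m _) ?_
  filter_upwards [M.prior_ae_mem] with θ hθ
  refine intervalIntegral.integral_mono_on hθ.1 (m.intervalIntegrable_comp_msg _ _ _)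
    (m.intervalIntegrable_comp_msg _ _ _) fun t _ => ?_
  have := (abs_le.1 ((bestDecision m ha hb hs).near (m.msg t))).1
  simp only [lowestDecision]
  linarith

theorem joint_best (ha : 2 < M.a) (hb : M.a + M.b < 1) (hs : 0 ≤ s) (m : Rule) :
    ((bestDecision m ha hb hs).phase ha hb).senderVal +
      ((bestDecision m ha hb hs).phase ha hb).recvVal = m.V M s := by
  rw [DecisionRule.senderVal_add_recvVal]
  refine integral_congr_ae ?_
  filter_upwards [M.prior_ae_mem] with θ hθ
  simp only [bestDecision]
  rw [if_pos ⟨θ, m.mem_cell hθ⟩]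
  exact M.uJoint_eq_w

/-- The equilibrium scheme with enforcement radius `s`. -/
theorem exists_scheme (ha : 2 < M.a) (hb : M.a + M.b < 1) (h1 : δ < 1) (hs : 0 ≤ s)
    (m₁ m₂ : Rule) (hJ : m₂.J M ≤ m₁.J M)
    (h : M.c * s ^ 2 / 2 ≤ δ / (1 - δ) * (m₁.V M s - M.punish (m₂.J M) s - M.r0)) :
    ∃ Z : M.Scheme δ, Z.vSS = M.punish (m₂.J M) s ∧ Z.vRS = m₁.V M s - M.punish (m₂.J M) s ∧
      Z.vRR = M.r0 := by
  set A := (bestDecision m₁ ha hb hs).phase ha hb with hA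
  set B := (lowestDecision m₂ ha hs).phase ha hb with hB
  set U := M.punish (m₂.J M) s with hU
  set W := m₁.V M s with hW
  have hφ : δ = δ / (1 - δ) * (1 - δ) := by field_simp [(by linarith : 1 - δ ≠ 0)]
  set φ := δ / (1 - δ) with hφ'
  have hBv : B.senderVal = U := senderVal_lowest ha hb hs m₂
  have hAv : A.senderVal + A.recvVal = W := joint_best ha hb hs m₁
  have hAU : U ≤ A.senderVal := by
    refine le_trans ?_ (punish_le_senderVal ha hb hs m₁)
    have := mul_le_mul_of_nonneg_left hJ (by linarith : 0 ≤ M.a)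
    exact add_le_add le_rfl (mul_le_mul_of_nonneg_left (by linarith) (by linarith [M.ca_lt]))
  have hAR : M.r0 - M.c * s ^ 2 / 2 ≤ A.recvVal :=
    (bestDecision m₁ ha hb hs).le_recvVal ha hb
  -- The ex-ante payment that pushes the receiver down to `r0` must be nonnegative. The current loss
  -- of the receiver is at most $cs^2/2$, which the discounted surplus covers.
  have hpR : 0 ≤ A.recvVal - M.r0 + φ * (W - U - M.r0) := by linarith
  have h1' : 0 < 1 - δ := by linarith
  have henf : ∀ (P : M.Phase), (∀ r, |P.dec r - M.rhoR (P.pm r)| ≤ s) → ∀ r,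
      (1 - δ) * (M.c / 2 * (P.dec r - M.rhoR (P.pm r)) ^ 2) ≤ δ * (W - U - M.r0) := by
    intro P hP r
    have h3 := abs_le.1 (hP r)
    have h4 := mul_le_mul_of_nonneg_left (sq_le_sq' h3.1 h3.2) M.c_pos.le
    have h5 : (1 - δ) * (M.c / 2 * (P.dec r - M.rhoR (P.pm r)) ^ 2) ≤
        (1 - δ) * (φ * (W - U - M.r0)) := mul_le_mul_of_nonneg_left (by linarith) h1'.le
    refine h5.trans (le_of_eq ?_)
    linear_combination -(W - U - M.r0) * hφ
  have eqSS : A.senderVal - (A.senderVal - U) = U := by ring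
  have eqRS : A.recvVal + (A.senderVal - U) = W - U := by linarith
  have eqRR : (1 - δ) * (A.recvVal - (A.recvVal - M.r0 + φ * (W - U - M.r0))) + δ * (W - U) =
      M.r0 := by
    linear_combination (W - U - M.r0) * hφ
  refine ⟨{
    -- Best decisions under `m₁` after compliance; lowest decisions under `m₂` against the sender;
    -- no communication against the receiver.
    phase := ![A, B, M.babbling]
    payS := ⟨A.senderVal - U, by linarith⟩
    payR := ⟨A.recvVal - M.r0 + φ * (W - U - M.r0), hpR⟩
    vSS := U
    vSR := (1 - δ) * (A.senderVal + (A.recvVal - M.r0 + φ * (W - U - M.r0))) + δ * U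
    vRS := W - U
    vRR := M.r0
    eqSS := eqSS
    eqRS := eqRS
    eqSR := rfl
    eqRR := eqRR
    punS := hBv.le
    punR := M.recvVal_babbling.le
    enforce := ?_
    myopic := fun r => rfl }, rfl, rfl, rfl⟩
  intro j hj r
  fin_cases j
  · exact henf A ((bestDecision m₁ ha hb hs).phase_near ha hb) r
  · exact henf B ((lowestDecision m₂ ha hs).phase_near ha hb) r
  · exact absurd rfl hj

end Model
end RelComm

namespace RelComm
namespace Model

/-! ### The surplus -/

variable {M : Model} {δ s : ℝ}

/-- `Vsup` and `Jinf` need not be attained by finite rules. The strict inequality leaves a slack,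
split evenly between the two approximations. -/
theorem le_surplus (ha : 2 < M.a) (hb : M.a + M.b < 1) (h0 : 0 < δ) (h1 : δ < 1) (hs : 0 ≤ s)
    (h : M.kappa s < δ / (1 - δ)) : ((M.c * s ^ 2 / 2 : ℝ) : EReal) ≤ M.surplus δ := by
  have hG := (surplusFloor_pos ha).trans_le (G_pos ha hb hs)
  have hφ : 0 < δ / (1 - δ) := div_pos h0 (by linarith)
  set φ := δ / (1 - δ) with hφ'
  have h2 : M.c * s ^ 2 / 2 < φ * M.G s := by
    unfold kappa at h
    rw [div_lt_iff₀ (by linarith)] at h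
    linarith
  set ε := (φ * M.G s - M.c * s ^ 2 / 2) / φ with hε
  have hε0 : 0 < ε := div_pos (by linarith) hφ
  have hεφ : φ * ε = φ * M.G s - M.c * s ^ 2 / 2 := by rw [hε]; field_simp
  have hq : 0 < (1 - M.c * M.a) * M.a := mul_pos (by linarith [M.ca_lt]) (by linarith)
  obtain ⟨m₁, hm₁⟩ := exists_lt_of_lt_ciSup (show M.Vsup s - ε / 2 < ⨆ m : Rule, m.V M s from
    by have : M.Vsup s = ⨆ m : Rule, m.V M s := rfl
       linarith)
  obtain ⟨m₀, hm₀⟩ := exists_lt_of_ciInf_lt (show (⨅ m : Rule, m.J M) <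
      M.Jinf + ε / 2 / ((1 - M.c * M.a) * M.a) from by
    have : M.Jinf = ⨅ m : Rule, m.J M := rfl
    have : 0 < ε / 2 / ((1 - M.c * M.a) * M.a) := by positivity
    linarith)
  -- The scheme needs the punishment rule to have the smaller rent term, so the better of `m₀` and
  -- `m₁` is used.
  obtain ⟨m₂, hm₂, hJ⟩ : ∃ m₂ : Rule,
      m₂.J M < M.Jinf + ε / 2 / ((1 - M.c * M.a) * M.a) ∧ m₂.J M ≤ m₁.J M := by
    rcases le_total (m₀.J M) (m₁.J M) with h | h
    · exact ⟨m₀, hm₀, h⟩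
    · exact ⟨m₁, h.trans_lt hm₀, le_rfl⟩
  have hpun : M.punish (m₂.J M) s ≤ M.punish M.Jinf s + ε / 2 := by
    have h3 : (m₂.J M - M.Jinf) * ((1 - M.c * M.a) * M.a) < ε / 2 := by
      rw [← lt_div_iff₀ hq]; linarith
    unfold punish
    linarith
  have hsum : M.c * s ^ 2 / 2 ≤ φ * (m₁.V M s - M.punish (m₂.J M) s - M.r0) := by
    have : M.G s - ε ≤ m₁.V M s - M.punish (m₂.J M) s - M.r0 := by unfold G; linarith
    have := mul_le_mul_of_nonneg_left this hφ.le
    linarith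
  obtain ⟨Z, e1, e2, e3⟩ := exists_scheme ha hb h1 hs m₁ m₂ hJ hsum
  obtain ⟨z1, z2⟩ := Z.mem_eqPayoffs h0.le h1
  have v1 : ((m₁.V M s : ℝ) : EReal) ≤ M.vBar δ := by
    refine le_trans (le_of_eq ?_) (le_iSup₂_of_le (Z.vSS, Z.vRS) z1 le_rfl)
    rw [e1, e2]
    congr 1
    ring
  have v2 : M.vLowS δ ≤ ((M.punish (m₂.J M) s : ℝ) : EReal) :=
    iInf₂_le_of_le (Z.vSS, Z.vRS) z1 (by rw [e1])
  have v3 : M.vLowR δ ≤ ((M.r0 : ℝ) : EReal) :=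
    iInf₂_le_of_le (Z.vSR, Z.vRR) z2 (by rw [e3])
  calc ((M.c * s ^ 2 / 2 : ℝ) : EReal)
      ≤ ((φ * (m₁.V M s - M.punish (m₂.J M) s - M.r0) : ℝ) : EReal) := by exact_mod_cast hsum
    _ = (φ : EReal) * ((m₁.V M s : EReal) - (M.punish (m₂.J M) s : EReal) - (M.r0 : EReal)) := by
      push_cast; rfl
    _ ≤ _ := mul_le_mul_of_nonneg_left (EReal.sub_le_sub (EReal.sub_le_sub v1 v2) v3)
      (by exact_mod_cast hφ.le)

/-- Every equilibrium sustains a radius $t$ with `kappa t` at most the odds, so $t\le s$. All payoff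
bounds are monotone in the radius. -/
theorem surplus_le (ha : 2 < M.a) (hb : M.a + M.b < 1) (h0 : 0 ≤ δ) (h1 : δ < 1) (hs : 0 ≤ s)
    (h : M.kappa s = δ / (1 - δ)) : M.surplus δ ≤ ((M.c * s ^ 2 / 2 : ℝ) : EReal) := by
  have hG := (surplusFloor_pos ha).trans_le (G_pos ha hb hs)
  have hφ : 0 ≤ δ / (1 - δ) := div_nonneg h0 (by linarith)
  have key : ∀ v ∈ M.eqPayoffs δ, v.1 + v.2 ≤ M.Vsup s ∧ M.punish M.Jinf s ≤ v.1 ∧ M.r0 ≤ v.2 := by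
    rintro v ⟨σ, hσ, rfl⟩
    obtain ⟨t, ht, ht2, ht3⟩ := exists_radius_of_isEquilibrium ha hb h0 h1 hσ
    have hts : t ≤ s := by
      rw [← kappa_le_iff ha hb ht, ← h] at ht2
      exact (kappa_strictMono ha hb).le_iff_le ht hs |>.1 ht2
    obtain ⟨a1, a2, a3⟩ := ht3 0 Fin.elim0
    exact ⟨a1.trans (M.Vsup_mono hts), (punish_anti ha hb _ ht hts).trans a2, a3⟩
  have v1 : M.vBar δ ≤ ((M.Vsup s : ℝ) : EReal) :=
    iSup₂_le fun v hv => by exact_mod_cast (key v hv).1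
  have v2 : ((M.punish M.Jinf s : ℝ) : EReal) ≤ M.vLowS δ :=
    le_iInf₂ fun v hv => by exact_mod_cast (key v hv).2.1
  have v3 : ((M.r0 : ℝ) : EReal) ≤ M.vLowR δ :=
    le_iInf₂ fun v hv => by exact_mod_cast (key v hv).2.2
  have e : δ / (1 - δ) * M.G s = M.c * s ^ 2 / 2 := by
    rw [← h]; unfold kappa; field_simp
  rw [← e]
  calc M.surplus δ ≤ ((δ / (1 - δ) : ℝ) : EReal) * ((M.Vsup s : EReal) -
        (M.punish M.Jinf s : EReal) - (M.r0 : EReal)) :=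
        mul_le_mul_of_nonneg_left (EReal.sub_le_sub (EReal.sub_le_sub v1 v2) v3)
          (by exact_mod_cast hφ)
    _ = _ := by unfold G; push_cast; rfl

theorem surplus_eq (ha : 2 < M.a) (hb : M.a + M.b < 1) (h0 : 0 ≤ δ) (h1 : δ < 1) (hs : 0 ≤ s)
    (h : M.kappa s = δ / (1 - δ)) : M.surplus δ = ((M.c * s ^ 2 / 2 : ℝ) : EReal) := by
  refine le_antisymm (surplus_le ha hb h0 h1 hs h) ?_
  -- At $s=0$ the odds vanish, and zero times any extended real is zero. For $s>0$ the lower bound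
  -- is the limit along radii below $s$, where the sustainability inequality is strict.
  rcases hs.eq_or_lt with hs0 | hs0
  · rw [← hs0, kappa_zero] at h
    rw [← hs0]
    unfold surplus
    rw [← h]
    simp
  have hδ : 0 < δ := by
    have : 0 < M.kappa s := by
      rw [← M.kappa_zero]
      exact kappa_strictMono ha hb Set.self_mem_Ici hs hs0
    rw [h] at this
    rcases h0.eq_or_lt with h2 | h2
    · rw [← h2] at this; simp at this
    · exact h2
  have hc : Tendsto (fun t : ℝ => ((M.c * t ^ 2 / 2 : ℝ) : EReal)) (𝓝[<] s)
      (𝓝 ((M.c * s ^ 2 / 2 : ℝ) : EReal)) :=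
    tendsto_nhdsWithin_of_tendsto_nhds 
      ((continuous_coe_real_ereal.comp (by fun_prop : Continuous fun t : ℝ => M.c * t ^ 2 / 2)).tendsto s)
  refine le_of_tendsto hc ?_
  filter_upwards [Ioo_mem_nhdsLT hs0] with t ht
  exact le_surplus ha hb hδ h1 ht.1.le (h ▸ kappa_strictMono ha hb ht.1.le hs ht.2)

/-- Decisions are enforceable as if they could differ by `s` from the receiver's preferred ones. -/
structure HasRadius (M : Model) (δ s : ℝ) : Prop where
  nonneg : 0 ≤ s
  uStar_eq : ∀ ν : Measure ℝ, IsProbabilityMeasure ν → ν (Set.Icc (0 : ℝ) 1) = 1 →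
    M.uStar δ ν = M.w s (mean ν)
  extreme_eq : M.extremeStates δ = {θ | θ ∈ Set.Icc (0 : ℝ) 1 ∧ s < M.gap θ}

theorem enforceable_iff (hs : 0 ≤ s) (h : M.surplus δ = ((M.c * s ^ 2 / 2 : ℝ) : EReal))
    {ν : Measure ℝ} [IsProbabilityMeasure ν] (hν : ν (Set.Icc (0 : ℝ) 1) = 1) (d : ℝ) :
    M.Enforceable δ d ν ↔ |d - M.rhoR (mean ν)| ≤ s := by
  unfold Enforceable
  rw [h, M.temptation_eq hν, EReal.coe_le_coe_iff, ← abs_of_nonneg hs, ← sq_le_sq,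
    abs_of_nonneg hs]
  have := M.c_pos
  constructor
  · intro h
    by_contra! h2
    nlinarith
  · intro h
    nlinarith

theorem hasRadius_of_surplus_eq (ha : 2 < M.a) (hb : M.a + M.b < 1) (hs : 0 ≤ s)
    (h : M.surplus δ = ((M.c * s ^ 2 / 2 : ℝ) : EReal)) : M.HasRadius δ s where
  nonneg := hs
  uStar_eq ν _ hν := by
    have hy := mean_mem hν
    have hg := gap_pos ha hb hy.2
    refine IsGreatest.csSup_eq ⟨⟨min (mean ν) (M.rhoR (mean ν) + s), ?_, ?_⟩, ?_⟩
    · rw [enforceable_iff hs h hν, abs_le]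
      unfold gap at hg
      rcases le_total (mean ν) (M.rhoR (mean ν) + s) with h | h
      · rw [min_eq_left h]; constructor <;> linarith
      · rw [min_eq_right h]; constructor <;> linarith
    · rw [integral_uJoint hν, uJoint_eq_w]
    · rintro _ ⟨d, hd, rfl⟩
      rw [enforceable_iff hs h hν] at hd
      rw [integral_uJoint hν]
      exact M.uJoint_le_w (by linarith [(abs_le.1 hd).2])
  extreme_eq := by
    ext θ
    refine and_congr_right fun hθ => ?_
    have hθ' : (Measure.dirac θ) (Set.Icc (0 : ℝ) 1) = 1 := by
      rw [Measure.dirac_apply' _ measurableSet_Icc]; simp [hθ, -Set.mem_Icc]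
    have hg := gap_pos ha hb hθ.2
    rw [enforceable_iff hs h hθ', mean_dirac, not_le]
    unfold rhoFB
    rw [show θ - M.rhoR θ = M.gap θ from rfl, abs_of_pos hg]

/-- No gap exceeds $-b$, so first-best decisions are enforceable at every belief and the exact
surplus is irrelevant. This covers odds for which `kappa s` may never equal them. -/
theorem hasRadius_of_le_surplus (ha : 2 < M.a) (hb : M.a + M.b < 1)
    (h : ((M.c * (-M.b) ^ 2 / 2 : ℝ) : EReal) ≤ M.surplus δ) : M.HasRadius δ (-M.b) := by
  have henf : ∀ ν : Measure ℝ, IsProbabilityMeasure ν → ν (Set.Icc (0 : ℝ) 1) = 1 →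
      M.Enforceable δ (mean ν) ν := by
    intro ν _ hν
    have hy := mean_mem hν
    have hg := gap_pos ha hb hy.2
    have hg' := gap_le ha hy.1
    unfold Enforceable
    refine le_trans ?_ h
    rw [M.temptation_eq hν, EReal.coe_le_coe_iff, show mean ν - M.rhoR (mean ν) = M.gap (mean ν) from rfl]
    have := M.c_pos
    have : M.gap (mean ν) ^ 2 ≤ (-M.b) ^ 2 := pow_le_pow_left₀ hg.le hg' 2
    nlinarith
  refine ⟨by linarith, fun ν _ hν => ?_, ?_⟩
  · have hy := mean_mem hν
    have hg' := gap_le ha hy.1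
    have hw : M.w (-M.b) (mean ν) = (mean ν) ^ 2 / 2 := by
      unfold w; rw [max_eq_right (by linarith)]; ring
    rw [hw]
    refine IsGreatest.csSup_eq ⟨⟨mean ν, henf ν inferInstance hν, ?_⟩, ?_⟩
    · rw [integral_uJoint hν]; unfold uJoint; ring
    · rintro _ ⟨d, -, rfl⟩
      rw [integral_uJoint hν]
      unfold uJoint
      nlinarith [sq_nonneg (mean ν - d)]
  · ext θ
    refine and_congr_right fun hθ => ?_
    have hθ' : (Measure.dirac θ) (Set.Icc (0 : ℝ) 1) = 1 := by
      rw [Measure.dirac_apply' _ measurableSet_Icc]; simp [hθ, -Set.mem_Icc]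
    have h1 := henf _ inferInstance hθ'
    rw [mean_dirac] at h1
    have h2 := gap_le ha hθ.1
    exact iff_of_false (not_not_intro h1) (by linarith)

open Classical in
/-- The enforcement radius. -/
noncomputable def radius (M : Model) (δ : ℝ) : ℝ :=
  if h : ∃ s, 0 ≤ s ∧ M.kappa s = δ / (1 - δ) then h.choose else -M.b

theorem exists_kappa_eq (ha : 2 < M.a) (hb : M.a + M.b < 1) {φ : ℝ} (h0 : 0 ≤ φ)
    (h : φ ≤ M.kappa (-M.b)) : ∃ s, 0 ≤ s ∧ M.kappa s = φ := by
  have := intermediate_value_Icc (by linarith : 0 ≤ -M.b)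
    ((kappa_continuousOn ha hb).mono Set.Icc_subset_Ici_self)
  rw [M.kappa_zero] at this
  obtain ⟨s, hs, he⟩ := this ⟨h0, h⟩
  exact ⟨s, hs.1, he⟩

theorem hasRadius_radius (ha : 2 < M.a) (hb : M.a + M.b < 1) (h0 : 0 ≤ δ) (h1 : δ < 1) :
    M.HasRadius δ (M.radius δ) := by
  have hφ : 0 ≤ δ / (1 - δ) := div_nonneg h0 (by linarith)
  unfold radius
  split_ifs with h
  · exact hasRadius_of_surplus_eq ha hb h.choose_spec.1
      (surplus_eq ha hb h0 h1 h.choose_spec.1 h.choose_spec.2)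
  · have hlt : M.kappa (-M.b) < δ / (1 - δ) := by
      by_contra! hle
      exact h (exists_kappa_eq ha hb hφ hle)
    have hδ : 0 < δ := by
      rcases h0.eq_or_lt with h2 | h2
      · exact absurd ⟨0, le_rfl, by rw [M.kappa_zero, ← h2]; simp⟩ h
      · exact h2
    exact hasRadius_of_le_surplus ha hb (le_surplus ha hb hδ h1 (by linarith) hlt)

theorem kappa_radius (ha : 2 < M.a) (hb : M.a + M.b < 1) (h0 : 0 ≤ δ) (h1 : δ < 1)
    (h : δ / (1 - δ) ≤ M.kappa (-M.b)) : M.kappa (M.radius δ) = δ / (1 - δ) := by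
  have hφ : 0 ≤ δ / (1 - δ) := div_nonneg h0 (by linarith)
  have := exists_kappa_eq ha hb hφ h
  unfold radius
  rw [dif_pos this]
  exact this.choose_spec.2

theorem le_radius (ha : 2 < M.a) (hb : M.a + M.b < 1)
    (h : M.kappa (-M.b) ≤ δ / (1 - δ)) : -M.b ≤ M.radius δ := by
  unfold radius
  split_ifs with h2
  · rw [← h2.choose_spec.2] at h
    exact (kappa_strictMono ha hb).le_iff_le (by simp; linarith) h2.choose_spec.1 |>.1 h
  · exact le_rfl

end Model
end RelComm

namespace RelComm
namespace Model

/-! ### Pooling sets -/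

variable (M : Model)

/-- The posterior mean given that the state belongs to a set. -/
noncomputable def condMean (C : Set ℝ) : ℝ := mean (ProbabilityTheory.cond M.prior C)

variable {M} {C : Set ℝ}

theorem condMean_eq :
    M.condMean C = (M.prior.real C)⁻¹ * ∫ θ in C, θ ∂M.prior := by
  unfold condMean mean ProbabilityTheory.cond
  rw [integral_smul_measure, ENNReal.toReal_inv]
  rfl

theorem integrable_id_prior (M : Model) : Integrable (fun θ : ℝ => θ) M.prior :=
  integrable_id_of_mem M.prior_ae_mem

theorem setIntegral_id (h0 : M.prior C ≠ 0) :
    ∫ θ in C, θ ∂M.prior = M.prior.real C * M.condMean C := by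
  have : M.prior.real C ≠ 0 := by
    rw [measureReal_ne_zero_iff]; exact h0
  rw [condMean_eq, mul_inv_cancel_left₀ this]

theorem cond_Icc (h0 : M.prior C ≠ 0) :
    (ProbabilityTheory.cond M.prior C) (Set.Icc (0 : ℝ) 1) = 1 := by
  have := cond_isProbabilityMeasure h0
  rw [prob_compl_eq_zero_iff measurableSet_Icc |>.symm]
  exact (cond_absolutelyContinuous (μ := M.prior) (s := C)) M.prior_ae_mem

theorem condMean_lt (hC : MeasurableSet C) (h0 : M.prior C ≠ 0) {x : ℝ} (hx : C ⊆ Set.Iic x) :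
    M.condMean C < x := by
  have hi : IntegrableOn (fun θ : ℝ => x - θ) C M.prior :=
    ((integrable_const x).sub M.integrable_id_prior).integrableOn
  have hpos : 0 < ∫ θ in C, (x - θ) ∂M.prior := by
    rw [setIntegral_pos_iff_support_of_nonneg_ae
      ((ae_restrict_mem hC).mono fun θ hθ => sub_nonneg.2 (hx hθ)) hi, pos_iff_ne_zero]
    intro h1
    refine h0 (measure_mono_null (t := (Function.support (fun θ : ℝ => x - θ) ∩ C) ∪ {x})
      (fun θ hθ => ?_) (measure_union_null h1 (measure_singleton x)))
    by_cases h : θ = x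
    · exact Or.inr h
    · exact Or.inl ⟨sub_ne_zero.2 (Ne.symm h), hθ⟩
  rw [integral_sub (integrable_const x) M.integrable_id_prior.integrableOn, setIntegral_id h0,
    setIntegral_const, smul_eq_mul, ← mul_sub] at hpos
  exact sub_pos.1 (pos_of_mul_pos_right hpos measureReal_nonneg)

theorem lt_condMean (hC : MeasurableSet C) (h0 : M.prior C ≠ 0) {x : ℝ} (hx : C ⊆ Set.Ici x) :
    x < M.condMean C := by
  have hi : IntegrableOn (fun θ : ℝ => θ - x) C M.prior :=
    (M.integrable_id_prior.sub (integrable_const x)).integrableOn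
  have hpos : 0 < ∫ θ in C, (θ - x) ∂M.prior := by
    rw [setIntegral_pos_iff_support_of_nonneg_ae
      ((ae_restrict_mem hC).mono fun θ hθ => sub_nonneg.2 (hx hθ)) hi, pos_iff_ne_zero]
    intro h1
    refine h0 (measure_mono_null (t := (Function.support (fun θ : ℝ => θ - x) ∩ C) ∪ {x})
      (fun θ hθ => ?_) (measure_union_null h1 (measure_singleton x)))
    by_cases h : θ = x
    · exact Or.inr h
    · exact Or.inl ⟨sub_ne_zero.2 h, hθ⟩
  rw [integral_sub M.integrable_id_prior.integrableOn (integrable_const x), setIntegral_id h0,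
    setIntegral_const, smul_eq_mul, ← mul_sub] at hpos
  exact sub_pos.1 (pos_of_mul_pos_right hpos measureReal_nonneg)

/-- Relatively open neighborhoods have positive probability. -/
theorem prior_ne_zero {U : Set ℝ} (hU : IsOpen U) {θ : ℝ} (hθ : θ ∈ U)
    (hθ' : θ ∈ Set.Icc (0 : ℝ) 1) : M.prior (U ∩ Set.Icc 0 1) ≠ 0 := by
  intro h
  have h1 := M.volume_absolutelyContinuous h
  rw [Measure.restrict_apply (hU.measurableSet.inter measurableSet_Icc), Set.inter_assoc,
    Set.inter_self] at h1
  -- The state may be an endpoint, so the open interval is reached through its closure.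
  have hne : (U ∩ Set.Ioo (0 : ℝ) 1).Nonempty := by
    have : θ ∈ closure (Set.Ioo (0 : ℝ) 1) := by rw [closure_Ioo zero_ne_one]; exact hθ'
    exact mem_closure_iff.1 this U hU hθ
  refine (hU.inter isOpen_Ioo).measure_pos volume hne |>.ne' ?_
  exact measure_mono_null (Set.inter_subset_inter_right _ Set.Ioo_subset_Icc_self) h1

variable {P : Set ℝ}

theorem IsPoolingSet.subset (hP : IsPoolingSet P) : P ⊆ Set.Icc 0 1 := by
  obtain ⟨U, _, rfl⟩ := hP
  exact Set.inter_subset_right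

theorem IsPoolingSet.measurableSet (hP : IsPoolingSet P) : MeasurableSet P := by
  obtain ⟨U, hU, rfl⟩ := hP
  exact hU.measurableSet.inter measurableSet_Icc

theorem measurableSet_component (P : Set ℝ) (θ : ℝ) :
    MeasurableSet (connectedComponentIn P θ) :=
  isPreconnected_connectedComponentIn.ordConnected.measurableSet

theorem IsPoolingSet.exists_ball (hP : IsPoolingSet P) {θ : ℝ} (hθ : θ ∈ P) :
    ∃ ε > 0, Metric.ball θ ε ∩ Set.Icc 0 1 ⊆ connectedComponentIn P θ := by
  have h1 := hP.subset hθ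
  obtain ⟨U, hU, rfl⟩ := hP
  obtain ⟨ε, hε, hb⟩ := Metric.isOpen_iff.1 hU θ hθ.1
  refine ⟨ε, hε, IsPreconnected.subset_connectedComponentIn ?_ ⟨Metric.mem_ball_self hε, h1⟩
    (Set.inter_subset_inter_left _ hb)⟩
  rw [Real.ball_eq_Ioo]
  exact (Set.ordConnected_Ioo.inter Set.ordConnected_Icc).isPreconnected

theorem IsPoolingSet.prior_ne_zero (hP : IsPoolingSet P) {θ : ℝ} (hθ : θ ∈ P) :
    M.prior (connectedComponentIn P θ) ≠ 0 := by
  obtain ⟨ε, hε, hb⟩ := hP.exists_ball hθ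
  exact fun h => Model.prior_ne_zero Metric.isOpen_ball (Metric.mem_ball_self hε) (hP.subset hθ)
    (measure_mono_null hb h)

variable (M) in
/-- The posterior mean under the message rule with pooling set `P`. -/
noncomputable def pooledMean (P : Set ℝ) (θ : ℝ) : ℝ := mean (M.posterior P θ)

theorem pooledMean_of_mem {θ : ℝ} (h : θ ∈ P) :
    M.pooledMean P θ = M.condMean (connectedComponentIn P θ) := by
  unfold pooledMean posterior condMean; rw [if_pos h]

theorem pooledMean_of_notMem {θ : ℝ} (h : θ ∉ P) : M.pooledMean P θ = θ := by
  unfold pooledMean posterior; rw [if_neg h, mean_dirac]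

theorem pooledMean_eq {θ θ' : ℝ} (h : θ ∈ P) (h' : θ' ∈ connectedComponentIn P θ) :
    M.pooledMean P θ' = M.pooledMean P θ := by
  rw [pooledMean_of_mem h, pooledMean_of_mem (connectedComponentIn_subset _ _ h'),
    connectedComponentIn_eq h']

theorem IsPoolingSet.posterior_isProbabilityMeasure (hP : IsPoolingSet P) (θ : ℝ) :
    IsProbabilityMeasure (M.posterior P θ) := by
  unfold posterior
  split_ifs with h
  · exact cond_isProbabilityMeasure (hP.prior_ne_zero h)
  · infer_instance

theorem IsPoolingSet.posterior_Icc (hP : IsPoolingSet P) {θ : ℝ} (hθ : θ ∈ Set.Icc (0 : ℝ) 1) :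
    M.posterior P θ (Set.Icc 0 1) = 1 := by
  unfold posterior
  split_ifs with h
  · exact cond_Icc (hP.prior_ne_zero h)
  · rw [Measure.dirac_apply' _ measurableSet_Icc]; simp [hθ, -Set.mem_Icc]

theorem IsPoolingSet.pooledMean_mem (hP : IsPoolingSet P) {θ : ℝ} (hθ : θ ∈ Set.Icc (0 : ℝ) 1) :
    M.pooledMean P θ ∈ Set.Icc (0 : ℝ) 1 := by
  have := hP.posterior_isProbabilityMeasure (M := M) θ
  exact mean_mem (hP.posterior_Icc hθ)

/-- The components of a pooling set. -/
def components (P : Set ℝ) : Set (Set ℝ) := connectedComponentIn P '' P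

theorem components_pairwiseDisjoint (P : Set ℝ) : (components P).PairwiseDisjoint id := by
  rintro _ ⟨x, hx, rfl⟩ _ ⟨z, hz, rfl⟩ hne
  refine Set.disjoint_left.2 fun θ h h' => hne ?_
  rw [connectedComponentIn_eq h, connectedComponentIn_eq h']

/-- The components are disjoint, and each contains an open interval, even one at an endpoint of
$[0,1]$. -/
theorem IsPoolingSet.countable_components (hP : IsPoolingSet P) : (components P).Countable := by
  refine (components_pairwiseDisjoint P).countable_of_nonempty_interior ?_
  rintro _ ⟨θ, hθ, rfl⟩
  obtain ⟨ε, hε, hb⟩ := hP.exists_ball hθ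
  have hne : (Metric.ball θ ε ∩ Set.Ioo (0 : ℝ) 1).Nonempty := by
    have : θ ∈ closure (Set.Ioo (0 : ℝ) 1) := by rw [closure_Ioo zero_ne_one]; exact hP.subset hθ
    exact mem_closure_iff.1 this _ Metric.isOpen_ball (Metric.mem_ball_self hε)
  exact hne.mono (interior_maximal
    ((Set.inter_subset_inter_right _ Set.Ioo_subset_Icc_self).trans hb)
    (Metric.isOpen_ball.inter isOpen_Ioo))

theorem iUnion_components (P : Set ℝ) : ⋃ C : components P, (C : Set ℝ) = P := by
  ext θ
  simp only [Set.mem_iUnion, Subtype.exists, exists_prop]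
  constructor
  · rintro ⟨_, ⟨z, _, rfl⟩, h⟩
    exact connectedComponentIn_subset _ _ h
  · exact fun h => ⟨_, ⟨θ, h, rfl⟩, mem_connectedComponentIn h⟩

theorem IsPoolingSet.aemeasurable_pooledMean (hP : IsPoolingSet P) :
    AEMeasurable (M.pooledMean P) M.prior := by
  have := hP.countable_components.to_subtype
  have h1 : AEMeasurable (M.pooledMean P) (M.prior.restrict P) := by
    have : AEMeasurable (M.pooledMean P) (M.prior.restrict (⋃ C : components P, (C : Set ℝ))) := by
      rw [aemeasurable_iUnion_iff]
      rintro ⟨_, ⟨z, hz, rfl⟩⟩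
      refine (aemeasurable_const (b := M.pooledMean P z)).congr ?_
      filter_upwards [ae_restrict_mem (measurableSet_component P z)] with θ hθ
      exact (pooledMean_eq hz hθ).symm
    rwa [iUnion_components] at this
  have h2 : AEMeasurable (M.pooledMean P) (M.prior.restrict Pᶜ) := by
    refine aemeasurable_id.congr ?_
    filter_upwards [ae_restrict_mem hP.measurableSet.compl] with θ hθ
    exact (pooledMean_of_notMem hθ).symm
  have := aemeasurable_union_iff.2 ⟨h1, h2⟩
  rwa [Set.union_compl_self, Measure.restrict_univ] at this

theorem IsPoolingSet.integrable_comp (hP : IsPoolingSet P) {g : ℝ → ℝ} (hg : Measurable g) {K : ℝ}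
    (hK : ∀ y ∈ Set.Icc (0 : ℝ) 1, |g y| ≤ K) :
    Integrable (fun θ => g (M.pooledMean P θ)) M.prior :=
  Integrable.of_bound (hg.comp_aemeasurable hP.aemeasurable_pooledMean).aestronglyMeasurable K
    (M.prior_ae_mem.mono fun _ h => hK _ (hP.pooledMean_mem h))

theorem IsPoolingSet.integrable_mul_sub (hP : IsPoolingSet P) {g : ℝ → ℝ} (hg : Measurable g) {K : ℝ}
    (hK : ∀ y ∈ Set.Icc (0 : ℝ) 1, |g y| ≤ K) :
    Integrable (fun θ => g (M.pooledMean P θ) * (θ - M.pooledMean P θ)) M.prior := by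
  have h1 := hP.aemeasurable_pooledMean (M := M)
  refine Integrable.of_bound ((hg.comp_aemeasurable h1).mul
    (aemeasurable_id.sub h1)).aestronglyMeasurable K ?_
  filter_upwards [M.prior_ae_mem] with θ hθ
  have h2 := hP.pooledMean_mem (M := M) hθ
  have h3 : |θ - M.pooledMean P θ| ≤ 1 := by
    rw [abs_le]; constructor <;> linarith [hθ.1, hθ.2, h2.1, h2.2]
  rw [Real.norm_eq_abs, abs_mul]
  exact (mul_le_mul (hK _ h2) h3 (abs_nonneg _) ((abs_nonneg _).trans (hK _ h2))).trans (by simp)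

/-- The prediction error is uncorrelated with the posterior mean. -/
theorem IsPoolingSet.integral_mul_sub (hP : IsPoolingSet P) {g : ℝ → ℝ} (hg : Measurable g) {K : ℝ}
    (hK : ∀ y ∈ Set.Icc (0 : ℝ) 1, |g y| ≤ K) :
    ∫ θ, g (M.pooledMean P θ) * (θ - M.pooledMean P θ) ∂M.prior = 0 := by
  have := hP.countable_components.to_subtype
  have hi := hP.integrable_mul_sub (M := M) hg hK
  have h1 : ∫ θ in P, g (M.pooledMean P θ) * (θ - M.pooledMean P θ) ∂M.prior = 0 := by
    have h2 := integral_iUnion (μ := M.prior) (s := fun C : components P => (C : Set ℝ))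
      (f := fun θ => g (M.pooledMean P θ) * (θ - M.pooledMean P θ))
      (by rintro ⟨_, ⟨z, hz, rfl⟩⟩; exact measurableSet_component P z)
      (fun C D hne => components_pairwiseDisjoint P C.2 D.2 fun h => hne (Subtype.ext h))
      hi.integrableOn
    rw [iUnion_components] at h2
    rw [h2]
    convert tsum_zero with C
    obtain ⟨_, ⟨z, hz, rfl⟩⟩ := C
    have h0 := hP.prior_ne_zero (M := M) hz
    have hm := measurableSet_component P z
    have e : ∀ θ ∈ connectedComponentIn P z, g (M.pooledMean P θ) * (θ - M.pooledMean P θ) =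
        g (M.pooledMean P z) * (θ - M.pooledMean P z) := fun θ hθ => by rw [pooledMean_eq hz hθ]
    simp only
    rw [setIntegral_congr_fun hm e, integral_const_mul,
      integral_sub M.integrable_id_prior.integrableOn (integrable_const _), setIntegral_id h0,
      setIntegral_const, pooledMean_of_mem hz]
    simp
  have h2 : ∫ θ in Pᶜ, g (M.pooledMean P θ) * (θ - M.pooledMean P θ) ∂M.prior = 0 := by
    refine setIntegral_eq_zero_of_forall_eq_zero fun θ hθ => ?_
    rw [pooledMean_of_notMem hθ]; simp
  rw [← integral_add_compl hP.measurableSet hi, h1, h2, add_zero]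

theorem HasRadius.poolingPayoff_eq {δ s : ℝ} (h : M.HasRadius δ s) (hP : IsPoolingSet P) :
    M.poolingPayoff δ P = ∫ θ, M.w s (M.pooledMean P θ) ∂M.prior := by
  refine integral_congr_ae ?_
  filter_upwards [M.prior_ae_mem] with θ hθ
  exact h.uStar_eq _ (hP.posterior_isProbabilityMeasure θ) (hP.posterior_Icc hθ)

end Model
end RelComm

namespace RelComm
namespace Model

/-! ### Verification of lower pooling -/

/-- A tangent line of `w` at `y`, above `w` on `[0, x]`, that certifies that pooling the states
below `x` is optimal. -/
structure Certificate (M : Model) (s x y β : ℝ) : Prop where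
  mem : x ∈ Set.Icc (0 : ℝ) 1
  y_le : y ≤ x
  lt : ∀ z, 0 ≤ z → z < x → z ≠ y → M.w s z < M.w s y + β * (z - y)
  le : M.w s x ≤ M.w s y + β * (x - y)
  eq : x < 1 → M.w s y + β * (x - y) = x ^ 2 / 2
  slope : x < 1 → β ≤ x
  w_eq : ∀ z, x < z → z ≤ 1 → M.w s z = z ^ 2 / 2

namespace Certificate

variable {M : Model} {s x y β : ℝ}

/-- The convex function that bounds the joint payoff. -/
noncomputable def bd (M : Model) (s x y β θ : ℝ) : ℝ :=
  if θ ≤ x then M.w s y + β * (θ - y) else θ ^ 2 / 2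

/-- The slopes of its supporting lines. -/
noncomputable def sub (x β z : ℝ) : ℝ := if z ≤ x then β else z

theorem measurable_bd (M : Model) (s x y β : ℝ) : Measurable (bd M s x y β) :=
  Measurable.ite measurableSet_Iic (by fun_prop) (by fun_prop)

theorem measurable_sub (x β : ℝ) : Measurable (sub x β) :=
  Measurable.ite measurableSet_Iic (by fun_prop) (by fun_prop)

theorem abs_sub_le {z : ℝ} (hz : z ∈ Set.Icc (0 : ℝ) 1) : |sub x β z| ≤ |β| + 1 := by
  unfold sub
  have := abs_nonneg β
  split_ifs
  · linarith
  · rw [abs_of_nonneg hz.1]; linarith [hz.2]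

/-- The loss at state `θ` if the posterior mean is `z`. -/
noncomputable def loss (M : Model) (s x y β θ z : ℝ) : ℝ :=
  bd M s x y β θ - M.w s z - sub x β z * (θ - z)


theorem w_le (T : M.Certificate s x y β) {z : ℝ} (h0 : 0 ≤ z) (hz : z ≤ x) : M.w s z ≤ M.w s y + β * (z - y) := by
  rcases hz.eq_or_lt with h | h
  · rw [h]; exact T.le
  · by_cases hzy : z = y
    · rw [hzy]; simp
    · exact (T.lt z h0 h hzy).le

/-- The function `bd` is convex because the tangent meets the parabola at $x$ with slope at most
$x$. It majorizes $w$, and `sub` selects slopes of its supporting lines, so `bd θ ≥ bd z + sub z *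
(θ - z) ≥ w z + sub z * (θ - z)`. -/
theorem loss_nonneg (T : M.Certificate s x y β) {θ z : ℝ} (hθ : θ ≤ 1)
    (hz : z ∈ Set.Icc (0 : ℝ) 1) :
    0 ≤ loss M s x y β θ z := by
  unfold loss bd sub
  rcases le_or_gt z x with h | h
  · have h1 := T.w_le hz.1 h
    rw [if_pos h]
    split_ifs with h2
    · linarith
    · push Not at h2
      have hx1 : x < 1 := by linarith
      have h3 := T.eq hx1
      have h4 := T.slope hx1
      nlinarith
  · have hx1 : x < 1 := by linarith [hz.2]
    rw [if_neg (not_le.2 h), T.w_eq z h hz.2]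
    split_ifs with h2
    · have h3 := T.eq hx1
      have h4 := T.slope hx1
      have : (z - β) * (x - θ) ≥ 0 := mul_nonneg (by linarith) (by linarith)
      nlinarith [sq_nonneg (z - x)]
    · nlinarith [sq_nonneg (z - θ)]

theorem loss_pos_of_lt (T : M.Certificate s x y β) {θ z : ℝ} (hθ : θ ≤ 1)
    (hz : 0 ≤ z) (hzx : z ≤ x) (hxθ : x < θ) :
    0 < loss M s x y β θ z := by
  unfold loss bd sub
  have h1 := T.w_le hz hzx
  rw [if_pos hzx, if_neg (not_le.2 hxθ)]
  have hx1 : x < 1 := by linarith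
  have h3 := T.eq hx1
  have h4 := T.slope hx1
  have : 0 ≤ (x - β) * (θ - x) := mul_nonneg (by linarith) (by linarith)
  nlinarith [mul_pos (sub_pos.2 hxθ) (sub_pos.2 hxθ)]

theorem loss_pos_of_gt (T : M.Certificate s x y β) {θ z : ℝ} (hz : z ≤ 1)
    (hxz : x < z) (hxθ : x < θ) (hne : θ ≠ z) :
    0 < loss M s x y β θ z := by
  unfold loss bd sub
  rw [if_neg (not_le.2 hxz), if_neg (not_le.2 hxθ), T.w_eq z hxz hz]
  have : 0 < (θ - z) ^ 2 := by
    have := sub_ne_zero.2 hne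
    positivity
  nlinarith

theorem loss_pos_of_ne (T : M.Certificate s x y β) {θ z : ℝ} (hθ : θ ≤ 1)
    (hz : 0 ≤ z) (hzx : z < x) (hne : z ≠ y) :
    0 < loss M s x y β θ z := by
  rcases le_or_gt θ x with h | h
  · have h1 := T.lt z hz hzx hne
    unfold loss bd sub
    rw [if_pos h, if_pos hzx.le]
    linarith
  · exact T.loss_pos_of_lt hθ hz hzx.le h

theorem loss_eq_zero (T : M.Certificate s x y β) {θ : ℝ} (hθ : θ ≤ x) : loss M s x y β θ y = 0 := by
  unfold loss bd sub
  rw [if_pos hθ, if_pos T.y_le]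
  ring

theorem loss_self (T : M.Certificate s x y β) {θ : ℝ} (hθ : θ ≤ 1) (hxθ : x < θ) : loss M s x y β θ θ = 0 := by
  unfold loss bd
  rw [if_neg (not_le.2 hxθ), T.w_eq θ hxθ hθ]
  ring


theorem integrable_bd (M : Model) (s x y β : ℝ) : Integrable (bd M s x y β) M.prior := by
  refine M.integrable_prior (measurable_bd M s x y β) (|M.w s y| + |β| * (1 + |y|) + 1)
    fun θ hθ => ?_
  unfold bd
  have := abs_nonneg β
  have h1 := abs_nonneg y
  have := mul_nonneg this (by linarith : 0 ≤ 1 + |y|)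
  have := abs_nonneg (M.w s y)
  split_ifs
  · refine (abs_add_le _ _).trans ?_
    rw [abs_mul]
    have h2 : |θ - y| ≤ 1 + |y| :=
      (abs_sub θ y).trans (by linarith [Rule.abs_le_one_of_mem hθ])
    have := mul_le_mul_of_nonneg_left h2 (abs_nonneg β)
    linarith
  · rw [abs_of_nonneg (by positivity)]
    nlinarith [hθ.1, hθ.2]

variable {P Q : Set ℝ}

/-- The linear term has mean zero, because the prediction error is uncorrelated with the posterior
mean. The payoff thus falls short of a bound that does not depend on `P` by exactly the expected
loss. -/
theorem integral_loss (ha : 2 < M.a) (hb : M.a + M.b < 1) (hs : 0 ≤ s) (hP : IsPoolingSet P) :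
    Integrable (fun θ => loss M s x y β θ (M.pooledMean P θ)) M.prior ∧
    ∫ θ, loss M s x y β θ (M.pooledMean P θ) ∂M.prior =
      ∫ θ, bd M s x y β θ ∂M.prior - ∫ θ, M.w s (M.pooledMean P θ) ∂M.prior := by
  have i1 := integrable_bd M s x y β
  have i2 := hP.integrable_comp (M := M) (M.measurable_w s) fun z hz => abs_w_le ha hb hs hz
  have i3 := hP.integrable_mul_sub (M := M) (measurable_sub x β) fun z hz => abs_sub_le hz
  have e := hP.integral_mul_sub (M := M) (measurable_sub x β) fun z hz => abs_sub_le hz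
  have i12 : Integrable (fun θ => bd M s x y β θ - M.w s (M.pooledMean P θ)) M.prior := i1.sub i2
  refine ⟨i12.sub i3, ?_⟩
  unfold loss
  rw [integral_sub i12 i3, integral_sub i1 i2, e, sub_zero]

theorem payoff_le (T : M.Certificate s x y β) (ha : 2 < M.a) (hb : M.a + M.b < 1) (hs : 0 ≤ s)
    (hP : IsPoolingSet P) :
    ∫ θ, M.w s (M.pooledMean P θ) ∂M.prior ≤ ∫ θ, bd M s x y β θ ∂M.prior := by
  rw [← sub_nonneg, ← (integral_loss ha hb hs hP).2]
  refine integral_nonneg_of_ae ?_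
  filter_upwards [M.prior_ae_mem] with θ hθ
  exact T.loss_nonneg hθ.2 (hP.pooledMean_mem hθ)

theorem payoff_eq (T : M.Certificate s x y β) (ha : 2 < M.a) (hb : M.a + M.b < 1) (hs : 0 ≤ s)
    (hQ : IsPoolingSet Q) (hc : Q.OrdConnected) (h1 : Set.Ico 0 x ⊆ Q) (h2 : Q ⊆ Set.Icc 0 x)
    (hy : Q.Nonempty → M.condMean Q = y) :
    ∫ θ, M.w s (M.pooledMean Q θ) ∂M.prior = ∫ θ, bd M s x y β θ ∂M.prior := by
  rw [eq_comm, ← sub_eq_zero, ← (integral_loss ha hb hs hQ).2]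
  refine integral_eq_zero_of_ae ?_
  have hx : ∀ᵐ θ ∂M.prior, θ ≠ x := by
    rw [ae_iff]; simp
  filter_upwards [M.prior_ae_mem, hx] with θ hθ hne
  rcases lt_or_gt_of_ne hne with h | h
  · have hm : θ ∈ Q := h1 ⟨hθ.1, h⟩
    rw [pooledMean_of_mem hm, hc.isPreconnected.connectedComponentIn hm, hy ⟨θ, hm⟩]
    exact T.loss_eq_zero h.le
  · rw [pooledMean_of_notMem fun hm => absurd (h2 hm).2 (not_le.2 h)]
    exact T.loss_self hθ.2 h

theorem exists_mem_of_ae {p : ℝ → Prop} (h : ∀ᵐ θ ∂M.prior, p θ) {A : Set ℝ} (hA : M.prior A ≠ 0) :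
    ∃ θ ∈ A, p θ := by
  by_contra! hn
  exact hA (measure_mono_null (fun θ hθ => hn θ hθ) h)

/-- Only lower pooling is optimal. -/
theorem eq_of_payoff_eq (T : M.Certificate s x y β) (ha : 2 < M.a) (hb : M.a + M.b < 1) (hs : 0 ≤ s)
    (hP : IsPoolingSet P)
    (h : ∫ θ, bd M s x y β θ ∂M.prior ≤ ∫ θ, M.w s (M.pooledMean P θ) ∂M.prior) :
    P ∩ Set.Ioo 0 1 = Set.Ioo 0 x := by
  have hx0 := T.mem.1
  have hx1 := T.mem.2
  have hl : ∀ᵐ θ ∂M.prior, loss M s x y β θ (M.pooledMean P θ) = 0 := by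
    obtain ⟨i, e⟩ := integral_loss (x := x) (y := y) (β := β) ha hb hs hP
    have h0 : 0 ≤ᵐ[M.prior] fun θ => loss M s x y β θ (M.pooledMean P θ) := by
      filter_upwards [M.prior_ae_mem] with θ hθ
      exact T.loss_nonneg hθ.2 (hP.pooledMean_mem hθ)
    refine (integral_eq_zero_iff_of_nonneg_ae h0 i).1 (le_antisymm ?_ (integral_nonneg_of_ae h0))
    rw [e]; linarith
  -- no pooling above the threshold
  have hle : ∀ θ ∈ P, θ ≤ x := by
    intro θ hθ
    by_contra! hlt
    obtain ⟨ε, hε, hball⟩ := hP.exists_ball hθ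
    have hne : ∀ᵐ θ' ∂M.prior, θ' ≠ M.pooledMean P θ := by rw [ae_iff]; simp
    have hpos : M.prior ((Metric.ball θ ε ∩ Set.Ioi x) ∩ Set.Icc 0 1) ≠ 0 :=
      Model.prior_ne_zero (Metric.isOpen_ball.inter isOpen_Ioi)
        ⟨Metric.mem_ball_self hε, hlt⟩ (hP.subset hθ)
    obtain ⟨θ', hθ', hl', hne'⟩ := exists_mem_of_ae (hl.and hne) hpos
    rw [pooledMean_eq hθ (hball ⟨hθ'.1.1, hθ'.2⟩)] at hl'
    have hm := hP.pooledMean_mem (M := M) (hP.subset hθ)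
    rcases le_or_gt (M.pooledMean P θ) x with h1 | h1
    · exact (T.loss_pos_of_lt hθ'.2.2 hm.1 h1 hθ'.1.2).ne' hl'
    · exact (T.loss_pos_of_gt hm.2 h1 hθ'.1.2 hne').ne' hl'
  have hlt : ∀ θ ∈ P, θ < 1 → θ < x := by
    intro θ hθ h1
    refine (hle θ hθ).lt_of_ne fun he => ?_
    obtain ⟨ε, hε, hball⟩ := hP.exists_ball hθ
    have h0 := (hP.subset hθ).1
    -- Relative openness at $\theta=x<1$ would put a larger state into $P$. The minimum keeps it in
    -- $[0,1]$.
    have hmem : min (θ + ε / 2) 1 ∈ P := by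
      refine (hball.trans (connectedComponentIn_subset _ _)) ⟨?_, ?_, min_le_right _ _⟩
      · rw [Metric.mem_ball, Real.dist_eq, abs_of_nonneg]
        · linarith [min_le_left (θ + ε / 2) 1]
        · exact sub_nonneg.2 (le_min (by linarith) h1.le)
      · exact le_min (by linarith) zero_le_one
    have := hle _ hmem
    have : θ < min (θ + ε / 2) 1 := lt_min (by linarith) h1
    linarith
  -- all messages have the same mean
  have hy : ∀ θ ∈ P, M.condMean (connectedComponentIn P θ) = y := by
    intro θ hθ
    have h0 := hP.prior_ne_zero (M := M) hθ
    obtain ⟨θ', hθ', hl'⟩ := exists_mem_of_ae hl h0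
    rw [pooledMean_eq hθ hθ', pooledMean_of_mem hθ] at hl'
    have hm := hP.pooledMean_mem (M := M) (hP.subset hθ)
    rw [pooledMean_of_mem hθ] at hm
    have h3 : M.condMean (connectedComponentIn P θ) < x := condMean_lt (measurableSet_component _ _)
      h0 fun z hz => hle z (connectedComponentIn_subset _ _ hz)
    by_contra hne
    exact (T.loss_pos_of_ne (hP.subset (connectedComponentIn_subset _ _ hθ')).2 hm.1 h3 hne).ne' hl'
  -- there are no gaps
  have hnull : ∀ᵐ θ ∂M.prior, θ < x → θ ∈ P := by
    have hne : ∀ᵐ θ' ∂M.prior, θ' ≠ y := by rw [ae_iff]; simp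
    filter_upwards [hl, hne, M.prior_ae_mem] with θ hl hne hθ hlt
    by_contra hm
    rw [pooledMean_of_notMem hm] at hl
    exact (T.loss_pos_of_ne hθ.2 hθ.1 hlt hne).ne' hl
  have hsub : Set.Ioo 0 x ⊆ P := by
    intro θ hθ
    by_contra hm
    have hI : ∀ z ∈ P, (connectedComponentIn P z).OrdConnected := fun z _ =>
      isPreconnected_connectedComponentIn.ordConnected
    obtain ⟨z1, hz1, hz1'⟩ := exists_mem_of_ae hnull (Model.prior_ne_zero (M := M) (isOpen_Iio (a := θ))
      (θ := 0) hθ.1 (by simp))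
    have hz1P : z1 ∈ P := hz1' (lt_trans hz1.1 hθ.2)
    obtain ⟨z2, hz2, hz2'⟩ := exists_mem_of_ae hnull (Model.prior_ne_zero (M := M)
      (isOpen_Ioo (a := θ) (b := x)) (θ := (θ + x) / 2) ⟨by linarith [hθ.2], by linarith [hθ.2]⟩
      ⟨by linarith [hθ.1, hθ.2], by linarith [hθ.1, hθ.2]⟩)
    have hz2P : z2 ∈ P := hz2' hz2.1.2
    -- A missing state $\theta$ separates the components on its two sides, so their means lie on
    -- different sides of $\theta$, although both equal $y$.
    have c1 : M.condMean (connectedComponentIn P z1) < θ := by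
      refine condMean_lt (measurableSet_component _ _) (hP.prior_ne_zero hz1P) fun z hz => ?_
      by_contra! hlt
      exact hm (connectedComponentIn_subset _ _ ((hI z1 hz1P).out (mem_connectedComponentIn hz1P) hz
        ⟨le_of_lt hz1.1, le_of_lt (not_le.1 hlt)⟩))
    have c2 : θ < M.condMean (connectedComponentIn P z2) := by
      refine lt_condMean (measurableSet_component _ _) (hP.prior_ne_zero hz2P) fun z hz => ?_
      by_contra! hlt
      exact hm (connectedComponentIn_subset _ _ ((hI z2 hz2P).out hz (mem_connectedComponentIn hz2P)
        ⟨le_of_lt (not_le.1 hlt), hz2.1.1.le⟩))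
    rw [hy z1 hz1P] at c1
    rw [hy z2 hz2P] at c2
    exact lt_asymm c1 c2
  ext θ
  constructor
  · rintro ⟨h1, h2, h3⟩
    exact ⟨h2, hlt θ h1 h3⟩
  · rintro h1
    exact ⟨hsub h1, h1.1, h1.2.trans_le hx1⟩

theorem optimalPoolingSetIs (T : M.Certificate s x y β) (ha : 2 < M.a) (hb : M.a + M.b < 1) {δ : ℝ}
    (hR : M.HasRadius δ s) (hQ : IsPoolingSet Q) (hc : Q.OrdConnected) (h1 : Set.Ico 0 x ⊆ Q)
    (h2 : Q ⊆ Set.Icc 0 x) (hy : Q.Nonempty → M.condMean Q = y) : M.OptimalPoolingSetIs δ Q := by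
  have e := T.payoff_eq ha hb hR.nonneg hQ hc h1 h2 hy
  refine ⟨⟨hQ, fun P hP => ?_⟩, fun P hP => ?_⟩
  · rw [hR.poolingPayoff_eq hP, hR.poolingPayoff_eq hQ, e]
    exact T.payoff_le ha hb hR.nonneg hP
  · rw [T.eq_of_payoff_eq ha hb hR.nonneg hQ e.ge, T.eq_of_payoff_eq ha hb hR.nonneg hP.1]
    have := hP.2 Q hQ
    rwa [hR.poolingPayoff_eq hP.1, hR.poolingPayoff_eq hQ, e] at this

end Certificate
end Model
end RelComm

namespace RelComm
namespace Model

/-! ### Lower pooling -/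

variable (M : Model)

/-- The mean of the states below `x`. -/
noncomputable def lowerMean (x : ℝ) : ℝ := M.condMean (Set.Icc 0 x)

variable {M} {x : ℝ}

theorem prior_lower_ne_zero (hx : 0 < x) : M.prior (Set.Icc 0 x) ≠ 0 := fun h =>
  Model.prior_ne_zero (M := M) (isOpen_Iio (a := x)) (θ := 0) hx (by simp)
    (measure_mono_null (t := Set.Icc 0 x) (fun θ h => ⟨h.2.1, le_of_lt h.1⟩) h)

theorem lowerMean_pos (hx : 0 < x) : 0 < M.lowerMean x :=
  lt_condMean measurableSet_Icc (prior_lower_ne_zero hx) fun _ h => h.1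

theorem lowerMean_lt (hx : 0 < x) : M.lowerMean x < x :=
  condMean_lt measurableSet_Icc (prior_lower_ne_zero hx) fun _ h => h.2

theorem integral_lower {g : ℝ → ℝ} (hx : 0 ≤ x) :
    ∫ θ in Set.Icc 0 x, g θ ∂M.prior = ∫ θ in (0 : ℝ)..x, g θ ∂M.prior := by
  rw [intervalIntegral.integral_of_le hx, integral_Icc_eq_integral_Ioc]

theorem prior_lower_eq (hx : 0 ≤ x) :
    M.prior.real (Set.Icc 0 x) = ∫ _ in (0 : ℝ)..x, (1 : ℝ) ∂M.prior := by
  rw [← integral_lower hx, setIntegral_const, smul_eq_mul, mul_one]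

theorem lowerMean_eq (hx : 0 ≤ x) : M.lowerMean x =
    (∫ θ in (0 : ℝ)..x, θ ∂M.prior) / ∫ _ in (0 : ℝ)..x, (1 : ℝ) ∂M.prior := by
  unfold lowerMean
  rw [condMean_eq, prior_lower_eq hx, integral_lower hx, inv_mul_eq_div]

theorem prior_lower_pos (hx : 0 < x) : 0 < ∫ _ in (0 : ℝ)..x, (1 : ℝ) ∂M.prior := by
  rw [← prior_lower_eq hx.le]
  exact measureReal_nonneg.lt_of_ne' ((measureReal_ne_zero_iff).2 (prior_lower_ne_zero hx))

theorem lowerMean_continuousOn : ContinuousOn M.lowerMean (Set.Ioi 0) := by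
  have h1 : Continuous fun x => ∫ θ in (0 : ℝ)..x, θ ∂M.prior :=
    intervalIntegral.continuous_primitive (fun _ _ => M.integrable_id_prior.intervalIntegrable) 0
  have h2 : Continuous fun x => ∫ _ in (0 : ℝ)..x, (1 : ℝ) ∂M.prior :=
    intervalIntegral.continuous_primitive
      (fun _ _ => (integrable_const (1 : ℝ)).intervalIntegrable) 0
  refine (h1.continuousOn.div h2.continuousOn fun x hx => (prior_lower_pos hx).ne').congr ?_
  exact fun x hx => lowerMean_eq (le_of_lt hx)

theorem lowerMean_mono {x' : ℝ} (hx : 0 < x) (h : x ≤ x') : M.lowerMean x ≤ M.lowerMean x' := by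
  have hi1 : ∀ a b, IntervalIntegrable (fun θ : ℝ => θ) M.prior a b :=
    fun _ _ => M.integrable_id_prior.intervalIntegrable
  have hi2 : ∀ a b, IntervalIntegrable (fun _ : ℝ => (1 : ℝ)) M.prior a b :=
    fun _ _ => (integrable_const (1 : ℝ)).intervalIntegrable
  have hm := lowerMean_lt (M := M) hx
  have e1 := intervalIntegral.integral_add_adjacent_intervals (hi1 0 x) (hi1 x x')
  have e2 := intervalIntegral.integral_add_adjacent_intervals (hi2 0 x) (hi2 x x')
  have h1 := intervalIntegral.integral_mono_on h ((hi2 x x').const_mul x) (hi1 x x')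
    fun θ hθ => by simpa using hθ.1
  rw [intervalIntegral.integral_const_mul] at h1
  have h2 : 0 ≤ ∫ _ in x..x', (1 : ℝ) ∂M.prior :=
    intervalIntegral.integral_nonneg h fun _ _ => zero_le_one
  have p1 := prior_lower_pos (M := M) hx
  have p2 := prior_lower_pos (M := M) (hx.trans_le h)
  have e3 : M.lowerMean x * ∫ _ in (0 : ℝ)..x, (1 : ℝ) ∂M.prior = ∫ θ in (0 : ℝ)..x, θ ∂M.prior := by
    rw [lowerMean_eq hx.le, div_mul_cancel₀ _ p1.ne']
  rw [lowerMean_eq (hx.le.trans h), le_div_iff₀ p2, ← e1, ← e2]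
  nlinarith [mul_le_mul_of_nonneg_right hm.le h2]

theorem integral_prior_eq {g : ℝ → ℝ} (hx : x ∈ Set.Icc (0 : ℝ) 1) :
    ∫ θ in (0 : ℝ)..x, g θ ∂M.prior = ∫ θ in (0 : ℝ)..x, M.f θ * g θ := by
  rw [intervalIntegral.integral_of_le hx.1, intervalIntegral.integral_of_le hx.1]
  unfold prior
  have hsub : Set.Ioc 0 x ⊆ Set.Icc (0 : ℝ) 1 := fun θ h => ⟨h.1.le, h.2.trans hx.2⟩
  rw [setIntegral_withDensity_eq_setIntegral_toReal_smul M.f_measurable.ennreal_ofReal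
    (by simp) _ measurableSet_Ioc, Measure.restrict_restrict measurableSet_Ioc,
    Set.inter_eq_left.2 hsub]
  refine setIntegral_congr_fun measurableSet_Ioc fun θ hθ => ?_
  simp only [smul_eq_mul]
  rw [ENNReal.toReal_ofReal (M.f_pos θ (hsub hθ)).le]

theorem hasDerivAt_integral_prior (hf : ContinuousOn M.f (Set.Icc 0 1)) {g : ℝ → ℝ}
    (hg : Continuous g) (hx : x ∈ Set.Ioo (0 : ℝ) 1) :
    HasDerivAt (fun x => ∫ θ in (0 : ℝ)..x, g θ ∂M.prior) (M.f x * g x) x := by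
  have hc : ContinuousOn (fun θ => M.f θ * g θ) (Set.Icc 0 1) := hf.mul hg.continuousOn
  have hca : ContinuousAt (fun θ => M.f θ * g θ) x := hc.continuousAt (Icc_mem_nhds hx.1 hx.2)
  have hi : IntervalIntegrable (fun θ => M.f θ * g θ) volume 0 x := by
    refine (hc.mono ?_).intervalIntegrable
    rw [Set.uIcc_of_le hx.1.le]
    exact Set.Icc_subset_Icc_right hx.2.le
  have h := intervalIntegral.integral_hasDerivAt_right hi
    ((M.f_measurable.mul hg.measurable).stronglyMeasurable.stronglyMeasurableAtFilter) hca
  refine h.congr_of_eventuallyEq ?_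
  filter_upwards [Icc_mem_nhds hx.1 hx.2] with z hz
  exact integral_prior_eq hz

/-- The quotient rule for the two integrals over $[0,x]$. This is where a continuous density is
needed. -/
theorem differentiableAt_lowerMean (hf : ContinuousOn M.f (Set.Icc 0 1))
    (hx : x ∈ Set.Ioo (0 : ℝ) 1) : DifferentiableAt ℝ M.lowerMean x := by
  have h1 := hasDerivAt_integral_prior hf continuous_id hx
  have h2 := hasDerivAt_integral_prior hf (continuous_const (y := (1 : ℝ))) hx
  refine (h1.div h2 (prior_lower_pos hx.1).ne').differentiableAt.congr_of_eventuallyEq ?_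
  filter_upwards [Ioi_mem_nhds hx.1] with z hz
  exact lowerMean_eq (le_of_lt hz)

/-! ### The pooling threshold -/

variable (M) in
/-- The ratio of the distances of the cutoff for extreme states and of the pooling threshold from
the mean of the pooled states. -/
noncomputable def tangency : ℝ := 1 - √(1 - 1 / (M.a - 1) ^ 2)

/-- With $k=(a-1)^2$ and $l-y=g(x-y)$, the tangent of $w$ at $y<l$ meets $z^2/2$ at $x>y$ exactly
when $kg(2-g)=1$. The smaller root is real and lies in $(0,1)$ because $k>1$. -/
theorem tangency_spec (ha : 2 < M.a) : 0 < M.tangency ∧ M.tangency < 1 ∧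
    (M.a - 1) ^ 2 * (M.tangency * (2 - M.tangency)) = 1 := by
  have hk : 1 < (M.a - 1) ^ 2 := by nlinarith
  have h1 : 1 / (M.a - 1) ^ 2 < 1 := (div_lt_one (by linarith)).2 hk
  have h2 : 0 < 1 / (M.a - 1) ^ 2 := by positivity
  have h3 := Real.sq_sqrt (by linarith : 0 ≤ 1 - 1 / (M.a - 1) ^ 2)
  have h4 : 0 < √(1 - 1 / (M.a - 1) ^ 2) := Real.sqrt_pos.2 (by linarith)
  unfold tangency
  set r := √(1 - 1 / (M.a - 1) ^ 2)
  refine ⟨by nlinarith, by linarith, ?_⟩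
  have e : (1 - r) * (2 - (1 - r)) = 1 / (M.a - 1) ^ 2 := by nlinarith
  rw [e]
  exact mul_one_div_cancel (by linarith)

variable (M) in
/-- The cutoff for extreme states at which the states below `x` are pooled. -/
noncomputable def cutoff (x : ℝ) : ℝ := (1 - M.tangency) * M.lowerMean x + M.tangency * x

theorem cutoff_pos (ha : 2 < M.a) (hx : 0 < x) : 0 < M.cutoff x := by
  obtain ⟨h1, h2, _⟩ := tangency_spec ha
  have := mul_pos (sub_pos.2 h2) (lowerMean_pos (M := M) hx)
  have := mul_pos h1 hx
  unfold cutoff; linarith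

theorem cutoff_lt (ha : 2 < M.a) (hx : 0 < x) : M.cutoff x < x := by
  obtain ⟨h1, h2, _⟩ := tangency_spec ha
  have := mul_lt_mul_of_pos_left (lowerMean_lt (M := M) hx) (sub_pos.2 h2)
  unfold cutoff; linarith

theorem cutoff_strictMonoOn (ha : 2 < M.a) : StrictMonoOn M.cutoff (Set.Ioi 0) := by
  intro x hx x' _ h
  obtain ⟨h1, h2, _⟩ := tangency_spec ha
  have h3 := mul_le_mul_of_nonneg_left (lowerMean_mono (M := M) hx h.le) (sub_pos.2 h2).le
  have h4 := mul_lt_mul_of_pos_left h h1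
  unfold cutoff; linarith

theorem cutoff_continuousOn : ContinuousOn M.cutoff (Set.Ioi 0) := by
  have := lowerMean_continuousOn (M := M)
  unfold cutoff
  fun_prop

theorem exists_cutoff_eq (ha : 2 < M.a) {l : ℝ} (h0 : 0 < l) (h1 : l < M.cutoff 1) :
    ∃ x ∈ Set.Ioo (0 : ℝ) 1, M.cutoff x = l := by
  have hl : l < 1 := h1.trans (cutoff_lt ha one_pos)
  have := intermediate_value_Ioo hl.le (cutoff_continuousOn (M := M) |>.mono
    fun z hz => lt_of_lt_of_le h0 hz.1)
  obtain ⟨x, hx, he⟩ := this ⟨cutoff_lt ha h0, h1⟩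
  exact ⟨x, ⟨h0.trans hx.1, hx.2⟩, he⟩

variable (M) in
/-- The supremum of the extreme states. -/
noncomputable def extremeBound (s : ℝ) : ℝ := (-M.b - s) / (M.a - 1)

variable {s : ℝ}

theorem gap_sub (ha : 2 < M.a) (z : ℝ) :
    M.gap z - s = (M.a - 1) * (M.extremeBound s - z) := by
  have : M.a - 1 ≠ 0 := by linarith
  rw [gap_eq]
  unfold extremeBound
  field_simp
  ring

theorem w_eq_of_le (ha : 2 < M.a) {z : ℝ} (hz : M.extremeBound s ≤ z) : M.w s z = z ^ 2 / 2 := by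
  unfold w
  rw [gap_sub ha, max_eq_right (by nlinarith)]
  ring

/-- Here $(a-1)^2>1$ makes $w$ concave, whereas above the bound it is the convex $z^2/2$. This shape
calls for pooling at the bottom. -/
theorem w_eq_of_ge (ha : 2 < M.a) {z : ℝ} (hz : z ≤ M.extremeBound s) :
    M.w s z = z ^ 2 / 2 - (M.a - 1) ^ 2 * (M.extremeBound s - z) ^ 2 / 2 := by
  unfold w
  rw [gap_sub ha, max_eq_left (by nlinarith)]
  ring

/-- Below the bound this is strict concavity. Above it, the hypothesis on $z$ says that the point
where the tangent meets the parabola has not been reached. -/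
theorem w_lt_tangent (ha : 2 < M.a) {y z : ℝ} (hy : y < M.extremeBound s)
    (hz : M.tangency * (z - y) < M.extremeBound s - y) (hne : z ≠ y) :
    M.w s z < M.w s y + (y + (M.a - 1) ^ 2 * (M.extremeBound s - y)) * (z - y) := by
  obtain ⟨h1, h2, h3⟩ := tangency_spec ha
  have hk : 1 < (M.a - 1) ^ 2 := by nlinarith
  set l := M.extremeBound s
  set g := M.tangency
  set k := (M.a - 1) ^ 2
  rw [w_eq_of_ge ha hy.le]
  rcases le_or_gt z l with h | h
  · rw [w_eq_of_ge ha h]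
    have : 0 < (k - 1) * (z - y) ^ 2 := by
      have := sub_ne_zero.2 hne
      have := sub_pos.2 hk
      positivity
    change z ^ 2 / 2 - k * (l - z) ^ 2 / 2 < y ^ 2 / 2 - k * (l - y) ^ 2 / 2 + _
    nlinarith
  · rw [w_eq_of_le ha h.le]
    change z ^ 2 / 2 < y ^ 2 / 2 - k * (l - y) ^ 2 / 2 + _
    have hD : 0 < z - y := by linarith
    have hm : 0 < l - y - g * (z - y) := by linarith
    have hm2 : 0 < 2 * (z - y) * (1 - g) - (l - y - g * (z - y)) := by nlinarith
    have := mul_pos (mul_pos (by linarith : 0 < k) hm) hm2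
    -- Replacing $(z-y)^2$ by $kg(2-g)(z-y)^2$ factors the tangent minus the parabola.
    have e : y ^ 2 / 2 - k * (l - y) ^ 2 / 2 + (y + k * (l - y)) * (z - y) - z ^ 2 / 2 =
        (k * (l - y - g * (z - y)) * (2 * (z - y) * (1 - g) - (l - y - g * (z - y)))) / 2 := by
      linear_combination (z - y) ^ 2 / 2 * h3
    linarith

theorem w_tangent_eq (ha : 2 < M.a) {y z : ℝ} (hy : y < M.extremeBound s)
    (hz : M.tangency * (z - y) = M.extremeBound s - y) :
    M.w s y + (y + (M.a - 1) ^ 2 * (M.extremeBound s - y)) * (z - y) = z ^ 2 / 2 := by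
  obtain ⟨h1, h2, h3⟩ := tangency_spec ha
  rw [w_eq_of_ge ha hy.le, ← hz]
  linear_combination (z - y) ^ 2 / 2 * h3

/-- Pooling the states below `x`. -/
theorem certificate_lower (ha : 2 < M.a) (hx : 0 < x) (hx1 : x ≤ 1)
    (h : M.cutoff x ≤ M.extremeBound s) (h' : x < 1 → M.cutoff x = M.extremeBound s) :
    M.Certificate s x (M.lowerMean x) (M.lowerMean x +
      (M.a - 1) ^ 2 * (M.extremeBound s - M.lowerMean x)) := by
  obtain ⟨h1, h2, h3⟩ := tangency_spec ha
  have hk : 1 < (M.a - 1) ^ 2 := by nlinarith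
  have hy := lowerMean_lt (M := M) hx
  have hl : M.lowerMean x < M.extremeBound s := by
    unfold cutoff at h; nlinarith
  have ht : M.tangency * (x - M.lowerMean x) ≤ M.extremeBound s - M.lowerMean x := by
    unfold cutoff at h; linarith
  have ht' : x < 1 → M.tangency * (x - M.lowerMean x) = M.extremeBound s - M.lowerMean x := by
    intro hlt; have := h' hlt; unfold cutoff at this; linarith
  refine ⟨⟨hx.le, hx1⟩, hy.le, fun z _ hz hne => w_lt_tangent ha hl ?_ hne, ?_, fun hlt =>
    w_tangent_eq ha hl (ht' hlt), fun hlt => ?_, fun z hz hz1 => w_eq_of_le ha ?_⟩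
  · nlinarith
  · rcases ht.eq_or_lt with h4 | h4
    · rw [w_tangent_eq ha hl h4]
      unfold w
      nlinarith [sq_nonneg (max (M.gap x - s) 0)]
    · exact (w_lt_tangent ha hl h4 hy.ne').le
  · rw [← ht' hlt]
    -- The slope of the tangent is $y+kg(x-y)$, and $kg(2-g)=1$ with $g<1$ gives $kg<1$, so it is at
    -- most $x$.
    have h5 : (M.a - 1) ^ 2 * M.tangency ≤ 1 := by nlinarith [mul_pos (by linarith : 0 < (M.a - 1) ^ 2) h1]
    nlinarith
  · have := h' (hz.trans_le hz1)
    have := cutoff_lt ha hx (M := M)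
    linarith

/-- Full separation. -/
theorem certificate_empty (ha : 2 < M.a) (h : -M.b ≤ s) : M.Certificate s 0 0 0 := by
  have hl : M.extremeBound s ≤ 0 := div_nonpos_of_nonpos_of_nonneg (by linarith) (by linarith)
  have h0 := w_eq_of_le ha hl
  refine ⟨by simp, le_rfl, fun z h1 h2 => by linarith, by simp, fun _ => ?_, fun _ => le_rfl,
    fun z hz _ => w_eq_of_le ha (hl.trans hz.le)⟩
  rw [h0]; simp

end Model
end RelComm

namespace RelComm
namespace Model

/-! ### Comparative statics -/

variable {M : Model} {δ δ' s t : ℝ}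

variable (M) in
/-- The discount factor at which the enforcement radius `s` is just sustainable. -/
noncomputable def threshold (s : ℝ) : ℝ := M.kappa s / (1 + M.kappa s)

theorem kappa_nonneg (ha : 2 < M.a) (hb : M.a + M.b < 1) (hs : 0 ≤ s) : 0 ≤ M.kappa s := by
  rw [← M.kappa_zero]
  exact (kappa_strictMono ha hb).monotoneOn Set.self_mem_Ici hs hs

theorem threshold_nonneg (ha : 2 < M.a) (hb : M.a + M.b < 1) (hs : 0 ≤ s) : 0 ≤ M.threshold s := by
  have := kappa_nonneg ha hb hs
  unfold threshold; positivity

theorem threshold_lt_one (ha : 2 < M.a) (hb : M.a + M.b < 1) (hs : 0 ≤ s) : M.threshold s < 1 := by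
  have := kappa_nonneg ha hb hs
  exact (div_lt_one (by linarith)).2 (by linarith)

theorem odds_lt_iff (h1 : δ < 1) (h1' : δ' < 1) : δ / (1 - δ) < δ' / (1 - δ') ↔ δ < δ' := by
  rw [div_lt_div_iff₀ (by linarith) (by linarith)]
  constructor <;> intro h <;> nlinarith

theorem odds_threshold (ha : 2 < M.a) (hb : M.a + M.b < 1) (hs : 0 ≤ s) :
    M.threshold s / (1 - M.threshold s) = M.kappa s := by
  have := kappa_nonneg ha hb hs
  unfold threshold
  field_simp
  ring

theorem threshold_lt_iff (ha : 2 < M.a) (hb : M.a + M.b < 1) (hs : 0 ≤ s) (ht : 0 ≤ t) :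
    M.threshold s < M.threshold t ↔ s < t := by
  rw [← odds_lt_iff (threshold_lt_one ha hb hs) (threshold_lt_one ha hb ht), odds_threshold ha hb hs,
    odds_threshold ha hb ht]
  exact (kappa_strictMono ha hb).lt_iff_lt hs ht

theorem kappa_radius_of_lt (ha : 2 < M.a) (hb : M.a + M.b < 1) (h0 : 0 ≤ δ)
    (h : δ < M.threshold (-M.b)) : M.kappa (M.radius δ) = δ / (1 - δ) := by
  have hA : 0 ≤ -M.b := by linarith
  have h1 := threshold_lt_one ha hb hA
  refine kappa_radius ha hb h0 (h.trans h1) ?_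
  rw [← odds_threshold ha hb hA]
  exact ((odds_lt_iff (h.trans h1) h1).2 h).le

theorem radius_lt_iff (ha : 2 < M.a) (hb : M.a + M.b < 1) (h0 : 0 ≤ δ)
    (h : δ < M.threshold (-M.b)) (hs : 0 ≤ s) : M.radius δ < s ↔ δ < M.threshold s := by
  have h1 := h.trans (threshold_lt_one ha hb (by linarith : 0 ≤ -M.b))
  have hr := (hasRadius_radius ha hb h0 h1).nonneg
  rw [← (kappa_strictMono ha hb).lt_iff_lt hr hs, kappa_radius_of_lt ha hb h0 h,
    ← odds_threshold ha hb hs, odds_lt_iff h1 (threshold_lt_one ha hb hs)]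

theorem lt_radius_iff (ha : 2 < M.a) (hb : M.a + M.b < 1) (h0 : 0 ≤ δ)
    (h : δ < M.threshold (-M.b)) (hs : 0 ≤ s) : s < M.radius δ ↔ M.threshold s < δ := by
  have h1 := h.trans (threshold_lt_one ha hb (by linarith : 0 ≤ -M.b))
  have hr := (hasRadius_radius ha hb h0 h1).nonneg
  rw [← (kappa_strictMono ha hb).lt_iff_lt hs hr, kappa_radius_of_lt ha hb h0 h,
    ← odds_threshold ha hb hs, odds_lt_iff (threshold_lt_one ha hb hs) h1]

theorem radius_lt_radius (ha : 2 < M.a) (hb : M.a + M.b < 1) (h0 : 0 ≤ δ) (h : δ < δ')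
    (h' : δ' < M.threshold (-M.b)) : M.radius δ < M.radius δ' := by
  have h1 := h'.trans (threshold_lt_one ha hb (by linarith : 0 ≤ -M.b))
  have hodds := (odds_lt_iff (h.trans h1) h1).2 h
  rw [← kappa_radius_of_lt ha hb h0 (h.trans h'), ← kappa_radius_of_lt ha hb (h0.trans h.le) h'] at hodds
  exact ((kappa_strictMono ha hb).lt_iff_lt (hasRadius_radius ha hb h0 (h.trans h1)).nonneg
    (hasRadius_radius ha hb (h0.trans h.le) h1).nonneg).1 hodds

/-- The enforcement radius increases in the discount factor at a nonzero rate. -/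
theorem exists_radius_rate (ha : 2 < M.a) (hb : M.a + M.b < 1) (hs : 0 < s) :
    ∃ K > 0, ∀ δ δ', M.threshold s < δ → δ < δ' → δ' < M.threshold (-M.b) →
      δ' - δ ≤ K * (M.radius δ' - M.radius δ) := by
  have hA : 0 ≤ -M.b := by linarith
  have hκ := kappa_nonneg ha hb hA
  refine ⟨(M.kappa (-M.b) + 1) * (2 * -M.b) / s ^ 2, ?_, fun δ δ' h1 h2 h3 => ?_⟩
  · have : 0 < -M.b := by linarith
    positivity
  have h0 := (threshold_nonneg ha hb hs.le).trans h1.le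
  have hlt1 := threshold_lt_one ha hb hA
  have hr := (lt_radius_iff ha hb h0 (h2.trans h3) hs.le).2 h1
  have hr' := (radius_lt_iff ha hb (h0.trans h2.le) h3 hA).2 h3
  have k1 := kappa_radius_of_lt ha hb h0 (h2.trans h3)
  have k2 := kappa_radius_of_lt ha hb (h0.trans h2.le) h3
  have hrr := radius_lt_radius ha hb h0 h2 h3
  set r := M.radius δ
  set r' := M.radius δ'
  -- Since `G` is nondecreasing, `kappa` grows at most like the square of the radius. A change in
  -- the odds therefore forces a comparable change in the radius, without any derivative of `Vsup`.
  have hk := kappa_div_le ha hb (hs.le.trans hr.le) hrr.le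
  have hkA : M.kappa r ≤ M.kappa (-M.b) :=
    (kappa_strictMono ha hb).monotoneOn (hs.le.trans hr.le) hA (hrr.trans hr').le
  have hk0 := kappa_nonneg ha hb (hs.le.trans hr.le)
  -- The odds are an expansion: their difference is $\delta'-\delta$ divided by
  -- $(1-\delta')(1-\delta)\le1$.
  have hd : δ' - δ ≤ M.kappa r' - M.kappa r := by
    rw [k1, k2]
    have e : δ' / (1 - δ') - δ / (1 - δ) = (δ' - δ) / ((1 - δ') * (1 - δ)) := by
      have : 1 - δ' ≠ 0 := by linarith
      have : 1 - δ ≠ 0 := by linarith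
      field_simp; ring
    rw [e, le_div_iff₀ (mul_pos (by linarith) (by linarith))]
    have : (1 - δ') * (1 - δ) ≤ 1 := by nlinarith
    nlinarith
  have hs2 : 0 < s ^ 2 := by positivity
  have hsr : s ^ 2 ≤ r ^ 2 := pow_le_pow_left₀ hs.le hr.le 2
  have hmain : (δ' - δ) * s ^ 2 ≤ (M.kappa (-M.b) + 1) * (2 * -M.b) * (r' - r) := by
    calc (δ' - δ) * s ^ 2 ≤ (δ' - δ) * r ^ 2 := mul_le_mul_of_nonneg_left hsr (by linarith)
      _ ≤ (M.kappa r' - M.kappa r) * r ^ 2 := mul_le_mul_of_nonneg_right hd (by positivity)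
      _ ≤ M.kappa r * ((r' + r) * (r' - r)) := by nlinarith
      _ ≤ (M.kappa (-M.b) + 1) * ((2 * -M.b) * (r' - r)) := by
        have h5 : (r' + r) * (r' - r) ≤ 2 * -M.b * (r' - r) :=
          mul_le_mul_of_nonneg_right (by linarith) (by linarith)
        have h6 : 0 ≤ (r' + r) * (r' - r) := mul_nonneg (by linarith) (by linarith)
        exact mul_le_mul (by linarith) h5 h6 (by linarith)
      _ = _ := by ring
  rw [div_mul_eq_mul_div, le_div_iff₀ hs2]
  exact hmain

theorem extremeBound_lt_iff (ha : 2 < M.a) {x : ℝ} :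
    M.extremeBound s < x ↔ -M.b - (M.a - 1) * x < s := by
  unfold extremeBound
  rw [div_lt_iff₀ (by linarith)]
  constructor <;> intro h <;> linarith

theorem lt_extremeBound_iff (ha : 2 < M.a) {x : ℝ} :
    x < M.extremeBound s ↔ s < -M.b - (M.a - 1) * x := by
  unfold extremeBound
  rw [lt_div_iff₀ (by linarith)]
  constructor <;> intro h <;> linarith

theorem mem_extremeStates_iff (ha : 2 < M.a) (hR : M.HasRadius δ s) {θ : ℝ} :
    θ ∈ M.extremeStates δ ↔ θ ∈ Set.Icc (0 : ℝ) 1 ∧ θ < M.extremeBound s := by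
  rw [hR.extreme_eq]
  refine and_congr_right fun _ => ?_
  rw [← sub_pos, gap_sub ha]
  constructor
  · intro h
    exact sub_pos.1 (pos_of_mul_pos_right h (by linarith))
  · exact fun h => mul_pos (by linarith) (sub_pos.2 h)

open Classical in
variable (M) in
/-- The pooling threshold. -/
noncomputable def poolingThreshold (s : ℝ) : ℝ :=
  if h : ∃ x ∈ Set.Ioo (0 : ℝ) 1, M.cutoff x = M.extremeBound s then h.choose else 0

theorem poolingThreshold_spec (ha : 2 < M.a) (h0 : 0 < M.extremeBound s)
    (h1 : M.extremeBound s < M.cutoff 1) :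
    M.poolingThreshold s ∈ Set.Ioo (0 : ℝ) 1 ∧
      M.cutoff (M.poolingThreshold s) = M.extremeBound s := by
  have h := exists_cutoff_eq ha h0 h1
  unfold poolingThreshold
  rw [dif_pos h]
  exact h.choose_spec

theorem condMean_Ico (x : ℝ) : M.condMean (Set.Ico 0 x) = M.lowerMean x := by
  have h : (Set.Ico 0 x : Set ℝ) =ᵐ[M.prior] Set.Icc 0 x := Ico_ae_eq_Icc
  unfold lowerMean
  rw [condMean_eq, condMean_eq, setIntegral_congr_set h, measureReal_congr h]

theorem isPoolingSet_Ico {x : ℝ} (h : x ≤ 1) : IsPoolingSet (Set.Ico 0 x) := by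
  refine ⟨Set.Iio x, isOpen_Iio, ?_⟩
  ext θ
  constructor
  · exact fun hθ => ⟨hθ.2, hθ.1, hθ.2.le.trans h⟩
  · exact fun hθ => ⟨hθ.2.1, hθ.1⟩

theorem optimal_empty (ha : 2 < M.a) (hb : M.a + M.b < 1) (hR : M.HasRadius δ s) (h : -M.b ≤ s) :
    M.OptimalPoolingSetIs δ ∅ :=
  (certificate_empty ha h).optimalPoolingSetIs ha hb hR ⟨∅, isOpen_empty, by simp⟩
    Set.ordConnected_empty (by simp) (by simp) fun h => absurd h Set.not_nonempty_empty

theorem optimal_Icc (ha : 2 < M.a) (hb : M.a + M.b < 1) (hR : M.HasRadius δ s)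
    (h : M.cutoff 1 ≤ M.extremeBound s) : M.OptimalPoolingSetIs δ (Set.Icc 0 1) :=
  (certificate_lower ha one_pos le_rfl h fun h => absurd h (lt_irrefl _)).optimalPoolingSetIs ha hb hR
    ⟨Set.univ, isOpen_univ, by simp⟩ Set.ordConnected_Icc Set.Ico_subset_Icc_self subset_rfl
    fun _ => rfl

theorem optimal_Ico (ha : 2 < M.a) (hb : M.a + M.b < 1) (hR : M.HasRadius δ s) {x : ℝ}
    (hx : x ∈ Set.Ioo (0 : ℝ) 1) (h : M.cutoff x = M.extremeBound s) :
    M.OptimalPoolingSetIs δ (Set.Ico 0 x) :=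
  (certificate_lower ha hx.1 hx.2.le h.le fun _ => h).optimalPoolingSetIs ha hb hR
    (isPoolingSet_Ico hx.2.le) Set.ordConnected_Ico subset_rfl Set.Ico_subset_Icc_self
    fun _ => condMean_Ico x

/-- The pooling threshold inverts `cutoff`, so an upper bound on the growth of `cutoff` at $x$ is a
lower bound on the speed of the threshold. -/
theorem cutoff_lipschitz_at (hf : ContinuousOn M.f (Set.Icc 0 1)) {x : ℝ}
    (hx : x ∈ Set.Ioo (0 : ℝ) 1) :
    ∃ K > 0, ∃ r > 0, ∀ z, |z - x| < r → |M.cutoff z - M.cutoff x| ≤ K * |z - x| := by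
  have h : DifferentiableAt ℝ M.cutoff x :=
    ((differentiableAt_lowerMean hf hx).const_mul _).add (differentiableAt_id.const_mul _)
  obtain ⟨K, hK0, hK⟩ := h.hasDerivAt.isBigO_sub.exists_pos
  obtain ⟨r, hr, hball⟩ := Metric.eventually_nhds_iff.1 hK.bound
  exact ⟨K, hK0, r, hr, fun z hz => by simpa using hball (by rwa [Real.dist_eq])⟩

/-- The enforcement radius, and with it the extreme states and the optimal pooling set, is governed
by the discount factor. -/
theorem exists_thresholds (ha : 2 < M.a) (hb : M.a + M.b < 1) :
    ∃ δA δB : ℝ, ∃ θL : ℝ → ℝ, 0 < δB ∧ δB < δA ∧ δA < 1 ∧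
      (∀ δ ∈ Set.Ioo δA 1, M.extremeStates δ = ∅) ∧
      (∀ δ ∈ Set.Ioo δB δA,
        θL δ ∈ Set.Ioo (0 : ℝ) 1 ∧ M.extremeStates δ = Set.Ico 0 (θL δ)) ∧
      (∀ δ ∈ Set.Ico 0 δB, M.extremeStates δ = Set.Icc 0 1) ∧
      ∃ δs ∈ Set.Ioo δB δA, ∃ θs : ℝ → ℝ,
        (∀ δ ∈ Set.Ioo δA 1, M.OptimalPoolingSetIs δ ∅) ∧
        (∀ δ ∈ Set.Ioo δs δA,
          θs δ ∈ Set.Ioo (θL δ) 1 ∧ M.OptimalPoolingSetIs δ (Set.Ico 0 (θs δ))) ∧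
        (∀ δ ∈ Set.Ico 0 δs, M.OptimalPoolingSetIs δ (Set.Icc 0 1)) ∧
        StrictAntiOn θs (Set.Ioo δs δA) ∧
        (ContinuousOn M.f (Set.Icc 0 1) → ∀ δ ∈ Set.Ioo δs δA,
          ∃ κ > 0, ∀ᶠ δ' in 𝓝[≠] δ, (θs δ' - θs δ) / (δ' - δ) ≤ -κ) := by
  have ha1 : 0 < M.a - 1 := by linarith
  have hc0 := cutoff_pos (M := M) ha one_pos
  have hc1 := cutoff_lt (M := M) ha one_pos
  have hA : 0 ≤ -M.b := by linarith
  have hB : 0 < -M.b - (M.a - 1) * 1 := by linarith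
  set c := M.cutoff 1 with hc
  have hBs : -M.b - (M.a - 1) * 1 < -M.b - (M.a - 1) * c := by nlinarith
  have hsA : -M.b - (M.a - 1) * c < -M.b := by nlinarith
  have hs0 : 0 < -M.b - (M.a - 1) * c := hB.trans hBs
  have tB : 0 < M.threshold (-M.b - (M.a - 1) * 1) := by
    have := (threshold_lt_iff ha hb le_rfl hB.le).2 hB
    simpa [threshold, M.kappa_zero] using this
  have tBs := (threshold_lt_iff ha hb hB.le hs0.le).2 hBs
  have tsA := (threshold_lt_iff ha hb hs0.le hA).2 hsA
  have tA := threshold_lt_one ha hb hA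
  -- The three radii are those at which the bound on extreme states equals $0$, $1$ and `cutoff 1`.
  set δA := M.threshold (-M.b)
  set δB := M.threshold (-M.b - (M.a - 1) * 1)
  set δs := M.threshold (-M.b - (M.a - 1) * c)
  have hR : ∀ δ, 0 ≤ δ → δ < 1 → M.HasRadius δ (M.radius δ) := fun δ h0 h1 =>
    hasRadius_radius ha hb h0 h1
  have hhigh : ∀ δ ∈ Set.Ioo δA 1, -M.b ≤ M.radius δ := fun δ hδ => by
    refine le_radius ha hb ?_
    rw [← odds_threshold ha hb hA]
    exact ((odds_lt_iff tA hδ.2).2 hδ.1).le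
  have hpos : ∀ δ, 0 ≤ δ → δ < δA → 0 < M.extremeBound (M.radius δ) := fun δ h0 h => by
    rw [lt_extremeBound_iff ha]
    have := (radius_lt_iff ha hb h0 h hA).2 h
    linarith
  have hmid : ∀ δ, δs < δ → δ < δA → M.extremeBound (M.radius δ) < c := fun δ h h' => by
    rw [extremeBound_lt_iff ha, lt_radius_iff ha hb (by linarith) h' hs0.le]
    exact h
  have hspec := fun δ (hδ : δ ∈ Set.Ioo δs δA) =>
    poolingThreshold_spec ha (hpos δ (by linarith [hδ.1]) hδ.2) (hmid δ hδ.1 hδ.2)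
  have hanti : ∀ δ δ', δs < δ → δ < δ' → δ' < δA →
      M.poolingThreshold (M.radius δ') < M.poolingThreshold (M.radius δ) := by
    intro δ δ' h1 h2 h3
    obtain ⟨p1, p2⟩ := hspec δ ⟨h1, h2.trans h3⟩
    obtain ⟨q1, q2⟩ := hspec δ' ⟨h1.trans h2, h3⟩
    rw [← (cutoff_strictMonoOn ha).lt_iff_lt q1.1 p1.1, p2, q2]
    have hr : M.radius δ < M.radius δ' := radius_lt_radius ha hb (by linarith) h2 h3
    unfold extremeBound
    exact div_lt_div_of_pos_right (by linarith) ha1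
  refine ⟨δA, δB, fun δ => M.extremeBound (M.radius δ), tB, tBs.trans tsA, tA, ?_, ?_, ?_, δs,
    ⟨tBs, tsA⟩, fun δ => M.poolingThreshold (M.radius δ), ?_, ?_, ?_, ?_, ?_⟩
  · intro δ hδ
    ext θ
    rw [mem_extremeStates_iff ha (hR δ (by linarith [hδ.1]) hδ.2)]
    have : M.extremeBound (M.radius δ) ≤ 0 :=
      div_nonpos_of_nonpos_of_nonneg (by linarith [hhigh δ hδ]) ha1.le
    simp only [Set.mem_empty_iff_false, iff_false, not_and, not_lt]
    exact fun h => this.trans h.1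
  · intro δ hδ
    have h0 : 0 ≤ δ := by linarith [hδ.1]
    have h1 : M.extremeBound (M.radius δ) < 1 := by
      rw [extremeBound_lt_iff ha, lt_radius_iff ha hb h0 hδ.2 hB.le]
      exact hδ.1
    refine ⟨⟨hpos δ h0 hδ.2, h1⟩, ?_⟩
    ext θ
    rw [mem_extremeStates_iff ha (hR δ h0 (hδ.2.trans tA))]
    exact ⟨fun h => ⟨h.1.1, h.2⟩, fun h => ⟨⟨h.1, (h.2.trans h1).le⟩, h.2⟩⟩
  · intro δ hδ
    have hlt : δ < δA := hδ.2.trans (tBs.trans tsA)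
    have h1 : 1 < M.extremeBound (M.radius δ) := by
      rw [lt_extremeBound_iff ha, radius_lt_iff ha hb hδ.1 hlt hB.le]
      exact hδ.2
    ext θ
    rw [mem_extremeStates_iff ha (hR δ hδ.1 (hlt.trans tA))]
    exact ⟨fun h => h.1, fun h => ⟨h, h.2.trans_lt h1⟩⟩
  · intro δ hδ
    exact optimal_empty ha hb (hR δ (by linarith [hδ.1]) hδ.2) (hhigh δ hδ)
  · intro δ hδ
    obtain ⟨p1, p2⟩ := hspec δ hδ
    refine ⟨⟨p2.symm.trans_lt (cutoff_lt ha p1.1), p1.2⟩, optimal_Ico ha hb (hR δ (by linarith [hδ.1]) (hδ.2.trans tA)) p1 p2⟩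
  · intro δ hδ
    have hlt : δ < δA := hδ.2.trans tsA
    refine optimal_Icc ha hb (hR δ hδ.1 (hlt.trans tA)) (le_of_lt ?_)
    rw [lt_extremeBound_iff ha, radius_lt_iff ha hb hδ.1 hlt hs0.le]
    exact hδ.2
  · exact fun δ hδ δ' hδ' h => hanti δ δ' hδ.1 h hδ'.2
  · intro hf δ hδ
    obtain ⟨K, hK0, hK⟩ := exists_radius_rate ha hb hs0
    obtain ⟨p1, p2⟩ := hspec δ hδ
    obtain ⟨C, hC0, r, hr, hC⟩ := cutoff_lipschitz_at hf p1
    set x := M.poolingThreshold (M.radius δ) with hx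
    -- Near $x$ the chain runs from the discount factor to the radius, to the bound on extreme
    -- states, to the threshold. The threshold is not known to be continuous in $\delta$; if it is
    -- at least $r$ away from $x$, the trivial bound $|\delta'-\delta|\le1$ suffices.
    have key : ∀ δ' ∈ Set.Ioo δs δA, |δ' - δ| ≤
        max (K * (M.a - 1) * C) (1 / r) * |M.poolingThreshold (M.radius δ') - x| := by
      intro δ' hδ'
      obtain ⟨q1, q2⟩ := hspec δ' hδ'
      set x' := M.poolingThreshold (M.radius δ')
      rcases lt_or_ge |x' - x| r with h | h
      · have h1 := hC x' h
        rw [p2, q2] at h1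
        have e : M.extremeBound (M.radius δ') - M.extremeBound (M.radius δ) =
            -(M.radius δ' - M.radius δ) / (M.a - 1) := by
          unfold extremeBound; ring
        rw [e, abs_div, abs_neg, abs_of_pos ha1, div_le_iff₀ ha1] at h1
        have h2 : |δ' - δ| ≤ K * |M.radius δ' - M.radius δ| := by
          rcases lt_trichotomy δ δ' with h3 | h3 | h3
          · have h4 := hK δ δ' hδ.1 h3 hδ'.2
            rw [abs_of_pos (by linarith)]
            exact h4.trans (mul_le_mul_of_nonneg_left (le_abs_self _) hK0.le)
          · subst h3; simp
          · have h4 := hK δ' δ hδ'.1 h3 hδ.2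
            rw [abs_sub_comm, abs_of_pos (by linarith), abs_sub_comm (M.radius δ')]
            exact h4.trans (mul_le_mul_of_nonneg_left (le_abs_self _) hK0.le)
        calc |δ' - δ| ≤ K * (C * |x' - x| * (M.a - 1)) :=
              h2.trans (mul_le_mul_of_nonneg_left h1 hK0.le)
          _ = K * (M.a - 1) * C * |x' - x| := by ring
          _ ≤ _ := mul_le_mul_of_nonneg_right (le_max_left _ _) (abs_nonneg _)
      · have h1 : |δ' - δ| ≤ 1 := by
          rw [abs_le]; constructor <;> linarith [hδ.1, hδ.2, hδ'.1, hδ'.2]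
        calc |δ' - δ| ≤ 1 / r * r := by rw [one_div_mul_cancel hr.ne']; exact h1
          _ ≤ 1 / r * |x' - x| := mul_le_mul_of_nonneg_left h (by positivity)
          _ ≤ _ := mul_le_mul_of_nonneg_right (le_max_right _ _) (abs_nonneg _)
    set N := max (K * (M.a - 1) * C) (1 / r) with hN
    have hN0 : 0 < N := lt_max_of_lt_right (by positivity)
    refine ⟨1 / N, by positivity, ?_⟩
    have hev : ∀ᶠ δ' in 𝓝[≠] δ, δ' ∈ Set.Ioo δs δA :=
      mem_nhdsWithin_of_mem_nhds (Ioo_mem_nhds hδ.1 hδ.2)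
    filter_upwards [hev, self_mem_nhdsWithin] with δ' hδ' hne
    have h1 := key δ' hδ'
    rcases lt_or_gt_of_ne (show δ' ≠ δ from hne) with h | h
    · have h2 := hanti δ' δ hδ'.1 h hδ.2
      rw [abs_of_neg (by linarith), abs_of_pos (by linarith)] at h1
      rw [div_le_iff_of_neg (by linarith), neg_mul, one_div_mul_eq_div, ← neg_div, div_le_iff₀ hN0]
      linarith
    · have h2 := hanti δ δ' hδ.1 h hδ'.2
      rw [abs_of_pos (by linarith), abs_of_neg (by linarith)] at h1
      rw [div_le_iff₀ (by linarith), neg_mul, one_div_mul_eq_div, ← neg_div, le_div_iff₀ hN0]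
      linarith

end Model
end RelComm

theorem proposition6 (M : RelComm.Model) (hresp : M.HighlyResponsive)
    (hbias : M.DownwardlyBiased) :
    ∃ δA δB : ℝ, ∃ θL : ℝ → ℝ, 0 < δB ∧ δB < δA ∧ δA < 1 ∧
      -- the thresholds and the state that describe the set of extreme states
      (∀ δ ∈ Set.Ioo δA 1, M.extremeStates δ = ∅) ∧
      (∀ δ ∈ Set.Ioo δB δA,
        θL δ ∈ Set.Ioo (0 : ℝ) 1 ∧ M.extremeStates δ = Set.Ico 0 (θL δ)) ∧
      (∀ δ ∈ Set.Ico 0 δB, M.extremeStates δ = Set.Icc 0 1) ∧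
      -- the optimal pooling set
      ∃ δs ∈ Set.Ioo δB δA, ∃ θs : ℝ → ℝ,
        (∀ δ ∈ Set.Ioo δA 1, M.OptimalPoolingSetIs δ ∅) ∧
        (∀ δ ∈ Set.Ioo δs δA,
          θs δ ∈ Set.Ioo (θL δ) 1 ∧ M.OptimalPoolingSetIs δ (Set.Ico 0 (θs δ))) ∧
        (∀ δ ∈ Set.Ico 0 δs, M.OptimalPoolingSetIs δ (Set.Icc 0 1)) ∧
        -- the pooling threshold strictly decreases in the discount factor
        StrictAntiOn θs (Set.Ioo δs δA) ∧
        -- and, for a continuous density, it does so at a nonzero rate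
        (ContinuousOn M.f (Set.Icc 0 1) → ∀ δ ∈ Set.Ioo δs δA,
          ∃ κ > 0, ∀ᶠ δ' in 𝓝[≠] δ, (θs δ' - θs δ) / (δ' - δ) ≤ -κ) :=
  RelComm.Model.exists_thresholds (M.two_lt_a hresp) (M.a_add_b_lt hbias)
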